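/- **Setting.** Let $L\ge 1$ be a natural number, let $k\in\mathbb N/L$ with $k>0$, let $s\in(1,3/2]$, and write $\langle x\rangle=(1+x^2)^{1/2}$. Frequencies $\xi$ range over $2\pi\mathbb Z/L$. Put $$\alpha_{1,j}=2\pi(3k+\tfrac jL),\quad \alpha_{2,j}=2\pi(k+\tfrac jL),\quad \alpha_{3,j}=2\pi\tfrac jL,\quad \alpha_{4,j}=2\pi(4k+\tfrac jL),$$ $\mathcal R_m=\{\alpha_{m,j}: j\in\mathbb Z,\ 0\le j<L\}$ and $\mathcal R=\bigcup_{m=1}^4\mathcal R_m$. *Full system* (the quintic Schrödinger equation $i\partial_tu+\partial_x^2u=|u|^4u$ on a torus of length $L$, written for the coefficients in $u=\frac1L\sum_\xi a_\xi(t)e^{ix\xi-it\xi^2}$): for all $\xi$, $$i\dot a_\xi=\frac1{L^4}\sum_{\xi_1-\xi_2+\xi_3-\xi_4+\xi_5=\xi}a_{\xi_1}\overline{a_{\xi_2}}a_{\xi_3}\overline{a_{\xi_4}}a_{\xi_5}\,e^{-it(\xi_1^2-\xi_2^2+\xi_3^2-\xi_4^2+\xi_5^2-\xi^2)},$$ the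 sum being absolutely convergent. *Resonant truncation*: for $\xi\in\mathcal R$, $$i\dot r_\xi=\frac1{L^4}\sum_{(\xi_1,\dots,\xi_5)\in\mathrm{res}(\xi)}r_{\xi_1}\overline{r_{\xi_2}}r_{\xi_3}\overline{r_{\xi_4}}r_{\xi_5},$$ and $r_\xi=0$ for $\xi\notin\mathcal R$. Here $(\xi_1,\dots,\xi_5)\in\mathrm{res}(\xi_6)$ means that $\xi_1+\xi_3+\xi_5=\xi_2+\xi_4+\xi_6$ and that there are $m_1,\dots,m_4$ with $\{(m_1,m_3),(m_2,m_4)\}=\{(1,3),(2,4)\}$ and integers $j_1,\dots,j_6\in[0,L)$ such that, up to order, $(\xi_1,\xi_3,\xi_5)$ is $(\alpha_{m_1,j_1},\alpha_{m_1,j_3},\alpha_{m_3,j_5})$ and $(\xi_2,\xi_4,\xi_6)$ is $(\alpha_{m_2,j_2},\alpha_{m_2,j_4},\alpha_{m_4,j_6})$, with $\{j_1,j_3\}=\{j_2,j_4\}$ and $j_5=j_6=(j_1+j_3)/2=(j_2+j_4)/2$. *Norm*: $\|u\|_s^2=\frac1L\sum_\xi m(\xi)^2|u_\xi|^2$, where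 the multiplier $m$ is defined as follows. - $\mathcal N_r$ is the set of $\xi=2\pi(k\tilde\eta+\tilde\tau+\frac jL)$ with $\tilde\eta\in\{0,1,3,4\}$ and integers $\tilde\tau\in(-k/2,k/2]$, $j\in[0,L)$. On it, $m(\xi)=\langle\tilde\tau\rangle^{s-1/2}$. (If $k$ is not an integer and several $\tilde\eta$ are possible, the least one is used.) - $\mathcal N_l$ and $\mathcal N_m$ are the sets of $\xi=2\pi(k\eta+\tau+\frac jL)$ with integers $\tau\in[0,k)$, $j\in[0,L)$ and, respectively, integers $-99\le\eta\le98$, and $\eta\in\{99,-100\}$. - On $\mathcal N_l\setminus\mathcal N_r$, $m(\xi)=\langle k\rangle^{s-1/2}$. - On the rest of $\mathcal N_m$, $m(\xi)=\langle k\rangle^{s-1/2}\langle\tau\rangle^{1/2}$ if $\xi>0$ (where $\eta=99$), and $m(\xi)=\langle k\rangle^{s-1/2}\langle k-\tau\rangle^{1/2}$ if $\xi<0$ (where $\eta=-100$). - For all other $\xi$, $m(\xi)=\langle\xi\rangle^{s}$. **Proposition.** Let $s\in(1,3/2]$ and $C_0,C_1>0$. There are constants $C,c>0$, depending only on $s,C_0,C_1$,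 such that the following holds for all natural $L\ge1$, all $k\in\mathbb N/L$ with $k>0$, all $0<\nu\le1$ and all $T>0$. Let $a$ and $r$ solve the full system and the resonant truncation on $[0,T]$, with $a(0)=r(0)$ and $\frac1L\sum_\xi|r_\xi(0)|^2\le C_1\nu$, and let $e=a-r$ (so $e(0)=0$). If $$\sup_{0\le t\le T}\|e(t)\|_s^2\le C_0\nu,$$ then for all $t\in[0,T]$ $$\|e(t)\|_s^2\le C\left(\frac{\nu^3}{\langle k\rangle^{5/2-s}}e^{c\nu^2t}+\frac{\nu^3}{\langle k\rangle^{3/2-s}}\left(e^{c\nu^2t}-1\right)+\nu\left(e^{c\nu^2t}-1-c\nu^2t\right)\right).$$ -/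

import Mathlib

noncomputable section

namespace QuinticNLS

/-- The frequency `ξ = 2πn/L` with index `n ∈ ℤ`; every family indexed by `2πℤ/L` is written as a
family indexed by `ℤ`. -/
def freq (L : ℕ) (n : ℤ) : ℝ := 2 * Real.pi * (n : ℝ) / (L : ℝ)

/-- The wave number `k = κ/L`, an element of `ℕ/L`. -/
def waveNumber (L κ : ℕ) : ℝ := (κ : ℝ) / (L : ℝ)

/-- The bracket `⟨x⟩ = (1 + |x|²)^{1/2}`. -/
def bracket (x : ℝ) : ℝ := Real.sqrt (1 + x ^ 2)

/-! ### The full system of Fourier modes -/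

/-- Quintuples of frequencies with `ξ₁ - ξ₂ + ξ₃ - ξ₄ + ξ₅ = ξ`. -/
def hyperplane (n : ℤ) : Set (Fin 5 → ℤ) :=
  {p | p 0 - p 1 + p 2 - p 3 + p 4 = n}

/-- The product `u_{ξ₁} \bar u_{ξ₂} u_{ξ₃} \bar u_{ξ₄} u_{ξ₅}`. -/
def quintic (u : ℤ → ℂ) (p : Fin 5 → ℤ) : ℂ :=
  u (p 0) * star (u (p 1)) * u (p 2) * star (u (p 3)) * u (p 4)

/-- The oscillation frequency `ξ₁² - ξ₂² + ξ₃² - ξ₄² + ξ₅² - ξ²`. -/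
def phase (L : ℕ) (p : Fin 5 → ℤ) (n : ℤ) : ℝ :=
  freq L (p 0) ^ 2 - freq L (p 1) ^ 2 + freq L (p 2) ^ 2 - freq L (p 3) ^ 2
    + freq L (p 4) ^ 2 - freq L n ^ 2

/-- One summand of the nonlinearity of the full system at time `t`. -/
def fullTerm (L : ℕ) (u : ℤ → ℂ) (t : ℝ) (n : ℤ) (p : Fin 5 → ℤ) : ℂ :=
  quintic u p * Complex.exp (-Complex.I * (t : ℂ) * (phase L p n : ℂ))

/-- `a` solves on `[0,T]` the system
`i ȧ_ξ = L⁻⁴ ∑ a_{ξ₁} \bar a_{ξ₂} a_{ξ₃} \bar a_{ξ₄} a_{ξ₅} e^{-itφ(ξ₁,…,ξ₅,ξ)}`,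
the sum (over `ξ₁ - ξ₂ + ξ₃ - ξ₄ + ξ₅ = ξ`) being absolutely convergent. -/
def IsFullSolution (L : ℕ) (T : ℝ) (a : ℝ → ℤ → ℂ) : Prop :=
  ∀ t ∈ Set.Icc (0 : ℝ) T, ∀ n : ℤ,
    Summable (fun p : hyperplane n => fullTerm L (a t) t n p) ∧
    HasDerivWithinAt (fun t' => a t' n)
      (-Complex.I * ((1 / (L : ℂ) ^ 4) * ∑' p : hyperplane n, fullTerm L (a t) t n p))
      (Set.Icc (0 : ℝ) T) t

/-! ### The resonant truncation -/

/-- The multiple of `k` in `α_{m,j}`: `3, 1, 0, 4` for `m = 1, 2, 3, 4`. The label `m` is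
represented by `m - 1 : Fin 4`. -/
def shift : Fin 4 → ℤ := ![3, 1, 0, 4]

/-- The index of `α_{m,j} = 2π (k · shift m + j/L)`. -/
def alpha (κ : ℕ) (m : Fin 4) (j : ℤ) : ℤ := shift m * (κ : ℤ) + j

/-- `𝓡 = 𝓡₁ ∪ 𝓡₂ ∪ 𝓡₃ ∪ 𝓡₄` with `𝓡_m = {α_{m,j} : 0 ≤ j < L}`. -/
def resonantModes (L κ : ℕ) : Set ℤ :=
  {n | ∃ m : Fin 4, ∃ j : ℤ, 0 ≤ j ∧ j < (L : ℤ) ∧ n = alpha κ m j}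

/-- The resonance condition for `(ξ₁, ξ₂, ξ₃, ξ₄, ξ₅, ξ)`, where `ξᵢ` has index `p (i-1)` and `ξ`
has index `n`. The pairs `(m₁, m₃)`, `(m₂, m₄)` are `(1,3)`, `(2,4)` in one of the two orders; two of
`ξ₁, ξ₃, ξ₅` are `α_{m₁,j₁}, α_{m₁,j₃}` and the remaining one is `α_{m₃,j₅}`; two of `ξ₂, ξ₄, ξ` are
`α_{m₂,j₂}, α_{m₂,j₄}` and the remaining one is `α_{m₄,j₆}`. -/
def IsResonant (L κ : ℕ) (p : Fin 5 → ℤ) (n : ℤ) : Prop :=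
  p 0 + p 2 + p 4 = p 1 + p 3 + n ∧
  ∃ m₁ m₂ m₃ m₄ : Fin 4,
    ((m₁ = 0 ∧ m₃ = 2 ∧ m₂ = 1 ∧ m₄ = 3) ∨ (m₁ = 1 ∧ m₃ = 3 ∧ m₂ = 0 ∧ m₄ = 2)) ∧
  ∃ j : Fin 6 → ℤ, (∀ i, 0 ≤ j i ∧ j i < (L : ℤ)) ∧
    ({p 0, p 2, p 4} : Multiset ℤ) =
      {alpha κ m₁ (j 0), alpha κ m₁ (j 2), alpha κ m₃ (j 4)} ∧
    ({p 1, p 3, n} : Multiset ℤ) =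
      {alpha κ m₂ (j 1), alpha κ m₂ (j 3), alpha κ m₄ (j 5)} ∧
    ({j 0, j 2} : Set ℤ) = {j 1, j 3} ∧
    2 * j 4 = j 0 + j 2 ∧ 2 * j 5 = j 1 + j 3 ∧ j 4 = j 5

/-- `res(ξ)`; it is a finite set. -/
def res (L κ : ℕ) (n : ℤ) : Set (Fin 5 → ℤ) :=
  {p | p ∈ hyperplane n ∧ IsResonant L κ p n}

/-- `r`, extended by zero outside `𝓡`, solves on `[0,T]` the system
`i ṙ_ξ = L⁻⁴ ∑_{res(ξ)} r_{ξ₁} \bar r_{ξ₂} r_{ξ₃} \bar r_{ξ₄} r_{ξ₅}` for `ξ ∈ 𝓡`. -/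
def IsResonantSolution (L κ : ℕ) (T : ℝ) (r : ℝ → ℤ → ℂ) : Prop :=
  ∀ t ∈ Set.Icc (0 : ℝ) T, ∀ n : ℤ,
    (n ∉ resonantModes L κ → r t n = 0) ∧
    (n ∈ resonantModes L κ →
      HasDerivWithinAt (fun t' => r t' n)
        (-Complex.I * ((1 / (L : ℂ) ^ 4) * ∑' p : res L κ n, quintic (r t) p))
        (Set.Icc (0 : ℝ) T) t)

/-! ### The weighted norm -/

/-- For given `η`, the integer `τ` in the expression `ξ = 2π(kη + τ + j/L)` with `j ∈ [0,L)`;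
see `tau_eq_iff`. -/
def tau (L κ : ℕ) (η n : ℤ) : ℤ := (n - (κ : ℤ) * η) / (L : ℤ)

theorem tau_eq_iff {L : ℕ} (hL : 0 < L) (κ : ℕ) (η n τ : ℤ) :
    tau L κ η n = τ ↔
      ∃ j : ℤ, 0 ≤ j ∧ j < (L : ℤ) ∧ n = (κ : ℤ) * η + (L : ℤ) * τ + j := by
  have hL' : (0 : ℤ) < (L : ℤ) := by exact_mod_cast hL
  unfold tau
  constructor
  · rintro rfl
    refine ⟨(n - (κ : ℤ) * η) % (L : ℤ), Int.emod_nonneg _ hL'.ne', Int.emod_lt_of_pos _ hL', ?_⟩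
    have := Int.emod_add_mul_ediv (n - (κ : ℤ) * η) (L : ℤ)
    linarith
  · rintro ⟨j, h0, h1, rfl⟩
    have : (κ : ℤ) * η + (L : ℤ) * τ + j - (κ : ℤ) * η = j + (L : ℤ) * τ := by ring
    rw [this, Int.add_mul_ediv_left _ _ hL'.ne', Int.ediv_eq_zero_of_lt h0 h1, zero_add]

/-- `ξ = 2π(kη + τ + j/L)` for some integers `τ ∈ [0,k)` and `j ∈ [0,L)`. -/
def StdAt (L κ : ℕ) (η n : ℤ) : Prop :=
  0 ≤ tau L κ η n ∧ (tau L κ η n : ℝ) < waveNumber L κ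

/-- `ξ = 2π(kη + τ + j/L)` for some integers `τ ∈ (-k/2,k/2]` and `j ∈ [0,L)`. -/
def CenteredAt (L κ : ℕ) (η n : ℤ) : Prop :=
  -(waveNumber L κ) / 2 < (tau L κ η n : ℝ) ∧ (tau L κ η n : ℝ) ≤ waveNumber L κ / 2

/-- The set `𝓝_l`. -/
def lowModes (L κ : ℕ) : Set ℤ := {n | ∃ η : ℤ, -99 ≤ η ∧ η ≤ 98 ∧ StdAt L κ η n}

/-- The set `𝓝_m`. -/
def midModes (L κ : ℕ) : Set ℤ := {n | StdAt L κ 99 n ∨ StdAt L κ (-100) n}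

/-- The set `𝓝_r`. -/
def nearModes (L κ : ℕ) : Set ℤ :=
  {n | CenteredAt L κ 0 n ∨ CenteredAt L κ 1 n ∨ CenteredAt L κ 3 n ∨ CenteredAt L κ 4 n}

open Classical in
/-- The integer `η̃ ∈ {0,1,3,4}` attached to `ξ ∈ 𝓝_r`. It is unique if `k` is an integer; in
general the least one is taken. -/
def etaTilde (L κ : ℕ) (n : ℤ) : ℤ :=
  if CenteredAt L κ 0 n then 0
  else if CenteredAt L κ 1 n then 1
  else if CenteredAt L κ 3 n then 3
  else 4

open Classical in
/-- The multiplier `m(ξ)`. The last case is `ξ ∈ 𝓝_h`, the complement of `𝓝_l ∪ 𝓝_m`. For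
`ξ ∈ 𝓝_m` outside `𝓝_l`, one has `η = 99` if `ξ > 0` and `η = -100` if `ξ < 0`. -/
def mult (s : ℝ) (L κ : ℕ) (n : ℤ) : ℝ :=
  if n ∈ nearModes L κ then
    bracket (tau L κ (etaTilde L κ n) n) ^ (s - 1 / 2)
  else if n ∈ lowModes L κ then
    bracket (waveNumber L κ) ^ (s - 1 / 2)
  else if n ∈ midModes L κ then
    if 0 < n then
      bracket (waveNumber L κ) ^ (s - 1 / 2) * bracket (tau L κ 99 n) ^ (1 / 2 : ℝ)
    else
      bracket (waveNumber L κ) ^ (s - 1 / 2)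
        * bracket (waveNumber L κ - tau L κ (-100) n) ^ (1 / 2 : ℝ)
  else
    bracket (freq L n) ^ s

/-- `‖u‖_s² = L⁻¹ ∑_ξ m(ξ)² |u_ξ|²`, with value `∞` if the series diverges. -/
def normSq (s : ℝ) (L κ : ℕ) (u : ℤ → ℂ) : ENNReal :=
  (∑' n : ℤ, ENNReal.ofReal (mult s L κ n ^ 2 * ‖u n‖ ^ 2)) / (L : ENNReal)

/-- The mass `L⁻¹ ∑_ξ |u_ξ|²`, with value `∞` if the series diverges. -/
def mass (L : ℕ) (u : ℤ → ℂ) : ENNReal :=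
  (∑' n : ℤ, ENNReal.ofReal (‖u n‖ ^ 2)) / (L : ENNReal)

end QuinticNLS

end

namespace QuinticNLS

open scoped ENNReal
open MeasureTheory

/-! ### Sums of non-negative extended reals -/

/-! No Gronwall argument is needed. Since `a(0) = r(0)`, the error is the drift of `a` from its
initial value minus the drift of `r`, and it is enough to bound the square of each drift in `‖·‖_s`
by a multiple of `ν^5 t^2 + ν^5 ⟨k⟩^(s-5/2)`. The quadratic term of the exponential series turns
`ν^5 t^2` into the last term of the claim, the other summand lies below the first term because `ν ≤
1`, and the middle term is not needed (`drift_bound_le`).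

On `𝓡` the multiplier is at most `2`, and the truncation conserves mass, so `‖r‖_s^2 ≲ ν`. With the
a priori bound on `e`, also `‖a‖_s^2 ≲ ν` on all of `[0,T]`. As `s > 1`, the sum of `1/m^2` is
`O(L)` uniformly in `k` (`exists_tsum_inv_mult_sq_le`), so Cauchy–Schwarz gives `ℓ¹` control of the
coefficients too. The drift of `r` is then at most `t` times a quintic expression of size `ν^(5/2)`.

For `a` the obstacle is that the output of a quintuple may have a much larger multiplier than every
input. By `exists_trichotomy` this happens only in two ways. Either the phase is at least `k^2`: the
centers `{0,1,3,4}` are closed under exact resonance (`centers_closed`), and other clustered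
configurations far out have a nonzero energy defect (`cluster_energy`). Or there is a good pair: two
slots at distance about `δ` whose multipliers make up for the output up to a loss `(k/δ)^(1/2)`.
With the other slots and the output fixed, the phase moves along such a pair with speed proportional
to `δ`, so phases of size at most `k` are rare (`tsum_fiber_le`), and Cauchy–Schwarz over the fibre
regains the loss exactly.

Quintuples that are dominated by an input, or that have a good pair and phase at most `k`, are tame:
they cost `t ν^(5/2)` (`tame_bound`). All others have phase above `k` and are integrated by parts in
time. The boundary terms give `ν^(5/2) ⟨k⟩^((s-5/2)/2)`, the terms with a differentiated factor give
`t ν^(9/2)` (`not_tame_bound`, `tsum_sq_sub_initial_le`). -/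

theorem tsum_mul_sq_le {α : Type*} [Countable α] (u v : α → ℝ≥0∞) :
    (∑' x, u x * v x) ^ 2 ≤ (∑' x, u x ^ 2) * ∑' x, v x ^ 2 := by
  let _ : MeasurableSpace α := ⊤
  have h := ENNReal.lintegral_mul_le_Lp_mul_Lq (Measure.count : Measure α)
    Real.HolderConjugate.two_two
    (f := u) (g := v) (measurable_from_top).aemeasurable (measurable_from_top).aemeasurable
  simp only [lintegral_count, Pi.mul_apply] at h
  refine (pow_le_pow_left' h 2).trans (le_of_eq ?_)
  rw [mul_pow]
  have key : ∀ x : ℝ≥0∞, (x ^ (1 / (2 : ℝ))) ^ 2 = x := fun x => by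
    rw [← ENNReal.rpow_natCast, ← ENNReal.rpow_mul]; norm_num
  rw [key, key]
  norm_num

theorem tsum_weight_mul_sq_le {α : Type*} [Countable α] (w u v : α → ℝ≥0∞) :
    (∑' x, w x * (u x * v x)) ^ 2 ≤ (∑' x, w x * u x ^ 2) * ∑' x, w x * v x ^ 2 := by
  have key : ∀ x : ℝ≥0∞, (x ^ (1 / (2 : ℝ))) ^ 2 = x := fun x => by
    rw [← ENNReal.rpow_natCast, ← ENNReal.rpow_mul]; norm_num
  have h := tsum_mul_sq_le (fun x => w x ^ (1 / (2 : ℝ)) * u x)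
    (fun x => w x ^ (1 / (2 : ℝ)) * v x)
  simp only [mul_pow, key] at h
  refine le_trans (le_of_eq ?_) h
  congr 1
  refine tsum_congr fun x => ?_
  conv_lhs => rw [← key (w x)]
  ring

theorem tsum_pi_prod {n : ℕ} (f : Fin n → ℤ → ℝ≥0∞) :
    ∑' p : Fin n → ℤ, ∏ l, f l (p l) = ∏ l, ∑' m, f l m := by
  induction n with
  | zero => simp
  | succ n ih =>
    rw [← (Fin.consEquiv fun _ : Fin (n + 1) => ℤ).tsum_eq, ENNReal.tsum_prod']
    simp only [Fin.consEquiv, Equiv.coe_fn_mk, Fin.prod_univ_succ, Fin.cons_zero, Fin.cons_succ,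
      ENNReal.tsum_mul_left, ENNReal.tsum_mul_right, ih]

/-! ### Multilinear sums over the hyperplanes -/

/-- The index `n` of the hyperplane containing `p`. -/
def out (p : Fin 5 → ℤ) : ℤ := p 0 - p 1 + p 2 - p 3 + p 4

theorem out_of_mem {n : ℤ} (p : hyperplane n) : out p = n := p.2

theorem tsum_hyperplane (g : (Fin 5 → ℤ) → ℝ≥0∞) :
    ∑' (n : ℤ) (p : hyperplane n), g p = ∑' p, g p :=
  ENNReal.tsum_fiberwise g out

/-- Cauchy–Schwarz with weight `w (π p)`. The coordinates recorded by `π` are the slots summed in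
`ℓ¹`; the kernel only has to be square summable along each fibre, where those slots and the momentum
are fixed. -/
theorem tsum_sq_le_of_fiber {Q : Type*} [Countable Q] (π : (Fin 5 → ℤ) → Q) (w : Q → ℝ≥0∞)
    (K g : (Fin 5 → ℤ) → ℝ≥0∞) (A : ℝ≥0∞)
    (hK : ∀ (n : ℤ) (q : Q), ∑' p : {p : hyperplane n // π p = q}, K p ^ 2 ≤ A) :
    ∑' n : ℤ, (∑' p : hyperplane n, K p * (w (π p) * g p)) ^ 2
      ≤ A * (∑' q, w q) * ∑' p, w (π p) * g p ^ 2 := by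
  have h1 : ∀ n : ℤ, ∑' p : hyperplane n, w (π p) * K p ^ 2 ≤ A * ∑' q, w q := by
    intro n
    rw [← ENNReal.tsum_fiberwise _ (fun p : hyperplane n => π p), ← ENNReal.tsum_mul_left]
    refine ENNReal.tsum_le_tsum fun q => ?_
    calc ∑' p : ((fun p : hyperplane n => π p) ⁻¹' {q}), w (π p) * K p ^ 2
        = ∑' p : {p : hyperplane n // π p = q}, w q * K p ^ 2 :=
          tsum_congr fun p => by rw [show π p = q from p.2]
      _ ≤ A * w q := by
          rw [ENNReal.tsum_mul_left, mul_comm]; gcongr; exact hK n q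
  rw [← tsum_hyperplane, ← ENNReal.tsum_mul_left]
  refine ENNReal.tsum_le_tsum fun n => ?_
  calc (∑' p : hyperplane n, K p * (w (π p) * g p)) ^ 2
      = (∑' p : hyperplane n, w (π p) * (K p * g p)) ^ 2 := by
        congr 1; exact tsum_congr fun p => by ring
    _ ≤ _ := (tsum_weight_mul_sq_le _ _ _).trans (by gcongr; exact h1 n)

theorem eq_of_out_eq {p p' : Fin 5 → ℤ} (i : Fin 5) (h : out p = out p')
    (h' : i.removeNth p = i.removeNth p') : p = p' := by
  have h0 : ∀ l : Fin 4, p (i.succAbove l) = p' (i.succAbove l) := fun l => congrFun h' l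
  have a0 := h0 0
  have a1 := h0 1
  have a2 := h0 2
  have a3 := h0 3
  unfold out at h
  funext l
  fin_cases i <;> simp [Fin.succAbove, Fin.lt_def] at a0 a1 a2 a3 <;> fin_cases l <;> simp <;> omega

/-- Young's inequality: the momentum and the four `ℓ¹` slots determine slot `i`, so every fibre has
at most one point and a pointwise bound on the kernel suffices. -/
theorem tsum_sq_le_one_slot (i : Fin 5) (f : Fin 5 → ℤ → ℝ≥0∞) (K : (Fin 5 → ℤ) → ℝ≥0∞)
    (A : ℝ≥0∞) (hK : ∀ p, K p ^ 2 ≤ A) :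
    ∑' n : ℤ, (∑' p : hyperplane n, K p * ∏ l, f l ((p : Fin 5 → ℤ) l)) ^ 2
      ≤ A * (∑' m, f i m ^ 2) * (∏ l : Fin 4, ∑' m, f (i.succAbove l) m) ^ 2 := by
  have h := tsum_sq_le_of_fiber (fun p => i.removeNth p)
    (fun q : Fin 4 → ℤ => ∏ l, f (i.succAbove l) (q l)) K (fun p => f i (p i)) A (by
      intro n q
      have : Subsingleton {p : hyperplane n // i.removeNth (p : Fin 5 → ℤ) = q} :=
        ⟨fun x y => Subtype.ext (Subtype.ext (eq_of_out_eq i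
          ((out_of_mem x.1).trans (out_of_mem y.1).symm) (x.2.trans y.2.symm)))⟩
      rcases isEmpty_or_nonempty {p : hyperplane n // i.removeNth (p : Fin 5 → ℤ) = q} with h | ⟨⟨x⟩⟩
      · simp
      · rw [tsum_eq_single x (fun y hy => (hy (this.elim y x)).elim)]
        exact hK _)
  rw [tsum_pi_prod] at h
  have h2 : ∑' p : Fin 5 → ℤ, (∏ l, f (i.succAbove l) (i.removeNth p l)) * f i (p i) ^ 2
      = (∑' m, f i m ^ 2) * ∏ l : Fin 4, ∑' m, f (i.succAbove l) m := by
    rw [← (Fin.insertNthEquiv (fun _ => ℤ) i).tsum_eq, ENNReal.tsum_prod']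
    simp only [Fin.insertNthEquiv, Equiv.coe_fn_mk, Fin.removeNth_insertNth, Fin.insertNth_apply_same,
      ENNReal.tsum_mul_right, tsum_pi_prod, ENNReal.tsum_mul_left]
    ring
  rw [h2] at h
  refine le_trans (le_of_eq ?_) (h.trans (le_of_eq (by ring)))
  refine tsum_congr fun n => ?_
  congr 1
  refine tsum_congr fun p => ?_
  rw [Fin.prod_univ_succAbove _ i, mul_comm (f i _)]
  rfl

/-- Here a fibre is one-dimensional, the two `ℓ²` slots moving together with fixed momentum. The
decay of the kernel in the phase will make it square summable there. -/
theorem tsum_sq_le_two_slots (i : Fin 5) (j : Fin 4) (f : Fin 5 → ℤ → ℝ≥0∞)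
    (K : (Fin 5 → ℤ) → ℝ≥0∞) (A : ℝ≥0∞)
    (hK : ∀ (n : ℤ) (q : Fin 3 → ℤ),
      ∑' p : {p : hyperplane n // j.removeNth (i.removeNth (p : Fin 5 → ℤ)) = q}, K p ^ 2 ≤ A) :
    ∑' n : ℤ, (∑' p : hyperplane n, K p * ∏ l, f l ((p : Fin 5 → ℤ) l)) ^ 2
      ≤ A * (∑' m, f i m ^ 2) * (∑' m, f (i.succAbove j) m ^ 2)
        * (∏ l : Fin 3, ∑' m, f (i.succAbove (j.succAbove l)) m) ^ 2 := by
  have h := tsum_sq_le_of_fiber (fun p => j.removeNth (i.removeNth p))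
    (fun q : Fin 3 → ℤ => ∏ l, f (i.succAbove (j.succAbove l)) (q l)) K
    (fun p => f i (p i) * f (i.succAbove j) (p (i.succAbove j))) A hK
  rw [tsum_pi_prod] at h
  have h2 : ∑' p : Fin 5 → ℤ, (∏ l, f (i.succAbove (j.succAbove l))
        (j.removeNth (i.removeNth p) l)) * (f i (p i) * f (i.succAbove j) (p (i.succAbove j))) ^ 2
      = (∑' m, f i m ^ 2) * ((∑' m, f (i.succAbove j) m ^ 2)
        * ∏ l : Fin 3, ∑' m, f (i.succAbove (j.succAbove l)) m) := by
    rw [← (Fin.insertNthEquiv (fun _ => ℤ) i).tsum_eq, ENNReal.tsum_prod']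
    simp only [Fin.insertNthEquiv, Equiv.coe_fn_mk, Fin.removeNth_insertNth,
      Fin.insertNth_apply_same, Fin.insertNth_apply_succAbove]
    simp only [← (Fin.insertNthEquiv (fun _ => ℤ) j).tsum_eq (fun q : Fin 4 → ℤ => _),
      ENNReal.tsum_prod']
    simp only [Fin.insertNthEquiv, Equiv.coe_fn_mk, Fin.removeNth_insertNth,
      Fin.insertNth_apply_same, mul_pow,
      ENNReal.tsum_mul_right, tsum_pi_prod, ENNReal.tsum_mul_left]
    ring
  rw [h2] at h
  refine le_trans (le_of_eq ?_) (h.trans (le_of_eq (by ring)))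
  refine tsum_congr fun n => ?_
  congr 1
  refine tsum_congr fun p => ?_
  rw [Fin.prod_univ_succAbove _ i, Fin.prod_univ_succAbove _ j]
  simp only [Fin.removeNth]
  ring

end QuinticNLS

namespace QuinticNLS

open scoped ENNReal

/-! ### Sums over separated phases -/

/-- The right side telescopes, which gives the bound `2 / c` for the sum over positive integers
without comparison with an integral. -/
theorem inv_one_add_sq_le {c : ℝ} (hc : 0 < c) (j : ℕ) :
    1 / (1 + (c * (j + 1)) ^ 2) ≤ 2 / c * (1 / (1 + c * j) - 1 / (1 + c * (j + 1))) := by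
  have h0 : (0 : ℝ) ≤ j := j.cast_nonneg
  have h1 : 0 < 1 + c * (j : ℝ) := by positivity
  have h2 : 0 < 1 + c * ((j : ℝ) + 1) := by positivity
  have : 2 / c * (1 / (1 + c * (j : ℝ)) - 1 / (1 + c * ((j : ℝ) + 1)))
      = 2 / ((1 + c * j) * (1 + c * (j + 1))) := by
    field_simp; ring
  rw [this, div_le_div_iff₀ (by positivity) (by positivity)]
  have : c * (j : ℝ) ≤ c * (j + 1) := by nlinarith
  nlinarith [sq_nonneg (c * ((j : ℝ) + 1) - 1)]

theorem sum_inv_one_add_sq_le {c : ℝ} (hc : 0 < c) (N : ℕ) :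
    ∑ j ∈ Finset.range N, 1 / (1 + (c * (j + 1)) ^ 2) ≤ 2 / c := by
  have h : ∑ j ∈ Finset.range N, 1 / (1 + (c * (j + 1)) ^ 2)
      ≤ 2 / c * (1 - 1 / (1 + c * N)) := by
    induction N with
    | zero => simp
    | succ N ih =>
      rw [Finset.sum_range_succ]
      have := inv_one_add_sq_le hc N
      push_cast
      calc _ ≤ 2 / c * (1 - 1 / (1 + c * N))
            + 2 / c * (1 / (1 + c * N) - 1 / (1 + c * (N + 1))) := add_le_add ih this
        _ = _ := by ring
  refine h.trans ?_
  have h2 : 0 ≤ 1 / (1 + c * (N : ℝ)) := by positivity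
  have h3 : 0 < 2 / c := by positivity
  nlinarith

theorem tsum_int_inv_one_add_sq_le {c : ℝ} (hc : 0 < c) :
    ∑' j : ℤ, ENNReal.ofReal (1 / (1 + (c * j) ^ 2)) ≤ ENNReal.ofReal (1 + 4 / c) := by
  have h : ∑' j : ℕ, ENNReal.ofReal (1 / (1 + (c * (j + 1)) ^ 2)) ≤ ENNReal.ofReal (2 / c) := by
    rw [ENNReal.tsum_eq_iSup_nat]
    refine iSup_le fun N => ?_
    rw [← ENNReal.ofReal_sum_of_nonneg (fun i _ => by positivity)]
    exact ENNReal.ofReal_le_ofReal (sum_inv_one_add_sq_le hc N)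
  rw [tsum_of_nat_of_neg_add_one ENNReal.summable ENNReal.summable, tsum_eq_zero_add' ENNReal.summable]
  have e1 : ∀ j : ℕ, ((c * ((-((j : ℤ) + 1) : ℤ) : ℝ)) ^ 2) = (c * ((j : ℝ) + 1)) ^ 2 := fun j => by
    push_cast; ring
  simp only [e1]
  push_cast
  calc _ ≤ ENNReal.ofReal 1 + ENNReal.ofReal (2 / c) + ENNReal.ofReal (2 / c) := by
        gcongr
        simp
    _ = _ := by
        rw [← ENNReal.ofReal_add (by norm_num) (by positivity),
          ← ENNReal.ofReal_add (by positivity) (by positivity)]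
        congr 1; ring

/-- If `x₀` minimizes `|φ|` over a finite set, then `|φ x| ≥ |φ x - φ x₀| / 2 ≥ b |t x - t x₀| / 2`.
So the sum is dominated by the sum over all integers with step `b / (2k)`, wherever the values of
`φ` lie. -/
theorem tsum_separated_le {α : Type*} (t : α → ℤ) (φ : α → ℝ) {b k : ℝ} (hb : 0 < b) (hk : 0 < k)
    (ht : Function.Injective t)
    (hφ : ∀ x y, b * |(t x : ℝ) - t y| ≤ |φ x - φ y|) :
    ∑' x, ENNReal.ofReal (1 / (1 + (φ x / k) ^ 2)) ≤ ENNReal.ofReal (1 + 8 * k / b) := by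
  rw [ENNReal.tsum_eq_iSup_sum]
  refine iSup_le fun F => ?_
  rcases F.eq_empty_or_nonempty with rfl | hF
  · simp
  obtain ⟨x₀, -, hx₀⟩ := F.exists_min_image (fun x => |φ x|) hF
  have hc : 0 < b / (2 * k) := by positivity
  calc ∑ x ∈ F, ENNReal.ofReal (1 / (1 + (φ x / k) ^ 2))
      ≤ ∑ x ∈ F, ENNReal.ofReal (1 / (1 + (b / (2 * k) * ((t x - t x₀ : ℤ) : ℝ)) ^ 2)) := by
        refine Finset.sum_le_sum fun x hx => ENNReal.ofReal_le_ofReal ?_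
        refine one_div_le_one_div_of_le (by positivity) ?_
        gcongr 1 + ?_
        rw [sq_le_sq, abs_div, abs_mul, abs_of_pos hc, abs_of_pos hk, le_div_iff₀ hk]
        have h1 := hφ x x₀
        have h2 := hx₀ x hx
        have h3 := abs_sub (φ x) (φ x₀)
        push_cast
        calc b / (2 * k) * |(t x : ℝ) - t x₀| * k = b * |(t x : ℝ) - t x₀| / 2 := by
              field_simp
          _ ≤ |φ x| := by linarith
    _ ≤ ∑' x, ENNReal.ofReal (1 / (1 + (b / (2 * k) * ((t x - t x₀ : ℤ) : ℝ)) ^ 2)) :=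
        ENNReal.sum_le_tsum _
    _ ≤ ∑' j : ℤ, ENNReal.ofReal (1 / (1 + (b / (2 * k) * j) ^ 2)) :=
        ENNReal.tsum_comp_le_tsum_of_injective (f := fun x => t x - t x₀)
          (fun x y h => ht (by simpa using h))
          (fun j : ℤ => ENNReal.ofReal (1 / (1 + (b / (2 * k) * (j : ℝ)) ^ 2)))
    _ ≤ _ := (tsum_int_inv_one_add_sq_le hc).trans (ENNReal.ofReal_le_ofReal (le_of_eq (by
        field_simp
        ring)))

/-- The signs with which the frequencies enter the momentum and the phase. -/
def sgn : Fin 5 → ℝ := ![1, -1, 1, -1, 1]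

theorem sgn_eq (i : Fin 5) : sgn i = 1 ∨ sgn i = -1 := by
  fin_cases i <;> simp [sgn]

/-! ### Variation of the phase along a pair of slots -/

theorem cast_out (p : Fin 5 → ℤ) : (out p : ℝ) = ∑ l, sgn l * p l := by
  simp [out, sgn, Fin.sum_univ_five]; ring

theorem freq_out (L : ℕ) (p : Fin 5 → ℤ) : freq L (out p) = ∑ l, sgn l * freq L (p l) := by
  unfold freq
  rw [cast_out, Finset.mul_sum, Finset.sum_div]
  exact Finset.sum_congr rfl fun l _ => by ring

theorem phase_eq (L : ℕ) (p : Fin 5 → ℤ) (n : ℤ) :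
    phase L p n = ∑ l, sgn l * freq L (p l) ^ 2 - freq L n ^ 2 := by
  simp [phase, sgn, Fin.sum_univ_five]; ring

/-- Eliminating `z'` by the momentum relation, the change of the phase factors as `x - x'` times, up
to sign, `(x - z) + (x' - z')` for equal signs or `2 (x - z)` for opposite signs. Both factors are
at least `2 D`. -/
theorem two_slots_separation {e e' x z x' z' D : ℝ} (he : e = 1 ∨ e = -1) (he' : e' = 1 ∨ e' = -1)
    (hD : 0 < D) (h : e * x + e' * z = e * x' + e' * z') (hxz : D ≤ x - z) (hxz' : D ≤ x' - z') :
    2 * D * |x - x'| ≤ |e * x ^ 2 + e' * z ^ 2 - (e * x' ^ 2 + e' * z' ^ 2)| := by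
  have key : ∀ w : ℝ, 2 * D ≤ w → 2 * D * |x - x'| ≤ |w * (x - x')| := fun w hw => by
    rw [abs_mul, abs_of_pos (by linarith : 0 < w)]
    gcongr
  have key' : ∀ w : ℝ, 2 * D ≤ w → 2 * D * |x - x'| ≤ |-(w * (x - x'))| := fun w hw => by
    rw [abs_neg]; exact key w hw
  rcases he with rfl | rfl <;> rcases he' with rfl | rfl
  · obtain rfl : z' = x + z - x' := by linarith
    convert key ((x - z) + (x' - (x + z - x'))) (by linarith) using 2
    ring
  · obtain rfl : z' = x' - x + z := by linarith
    convert key (2 * (x - z)) (by linarith) using 2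
    ring
  · obtain rfl : z' = x' - x + z := by linarith
    convert key' (2 * (x - z)) (by linarith) using 2
    ring
  · obtain rfl : z' = x + z - x' := by linarith
    convert key' ((x - z) + (x' - (x + z - x'))) (by linarith) using 2
    ring

theorem phase_separation {L : ℕ} (i : Fin 5) (j : Fin 4) {p p' : Fin 5 → ℤ} {n : ℤ}
    (ho : out p = out p') (hq : j.removeNth (i.removeNth p) = j.removeNth (i.removeNth p'))
    {D : ℝ} (hD : 0 < D)
    (h : (D ≤ freq L (p i) - freq L (p (i.succAbove j)) ∧
          D ≤ freq L (p' i) - freq L (p' (i.succAbove j))) ∨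
        (D ≤ freq L (p (i.succAbove j)) - freq L (p i) ∧
          D ≤ freq L (p' (i.succAbove j)) - freq L (p' i))) :
    2 * D * |freq L (p i) - freq L (p' i)| ≤ |phase L p n - phase L p' n| := by
  have hq' : ∀ l, p (i.succAbove (j.succAbove l)) = p' (i.succAbove (j.succAbove l)) :=
    fun l => congrFun hq l
  have hm : sgn i * freq L (p i) + sgn (i.succAbove j) * freq L (p (i.succAbove j))
      = sgn i * freq L (p' i) + sgn (i.succAbove j) * freq L (p' (i.succAbove j)) := by
    have h1 := freq_out L p
    rw [ho, freq_out L p', Fin.sum_univ_succAbove _ i, Fin.sum_univ_succAbove _ i,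
      Fin.sum_univ_succAbove _ j, Fin.sum_univ_succAbove (n := 3) _ j] at h1
    simp only [hq'] at h1
    linarith
  have hp : phase L p n - phase L p' n
      = sgn i * freq L (p i) ^ 2 + sgn (i.succAbove j) * freq L (p (i.succAbove j)) ^ 2
      - (sgn i * freq L (p' i) ^ 2 + sgn (i.succAbove j) * freq L (p' (i.succAbove j)) ^ 2) := by
    rw [phase_eq, phase_eq, Fin.sum_univ_succAbove _ i, Fin.sum_univ_succAbove _ i,
      Fin.sum_univ_succAbove _ j, Fin.sum_univ_succAbove (n := 3) _ j]
    simp only [hq']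
    ring
  rw [hp]
  rcases h with ⟨h1, h2⟩ | ⟨h1, h2⟩
  · exact two_slots_separation (sgn_eq _) (sgn_eq _) hD hm h1 h2
  · have := two_slots_separation (x := -freq L (p i)) (x' := -freq L (p' i))
      (z := -freq L (p (i.succAbove j))) (z' := -freq L (p' (i.succAbove j)))
      (sgn_eq i) (sgn_eq (i.succAbove j)) hD (by linarith) (by linarith) (by linarith)
    simpa [abs_sub_comm, neg_add_eq_sub] using this

/-- The position `n/L = ξ/2π` of a frequency. -/
noncomputable def pos (L : ℕ) (n : ℤ) : ℝ := (n : ℝ) / L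

theorem freq_eq_pos (L : ℕ) (n : ℤ) : freq L n = 2 * Real.pi * pos L n := by
  unfold freq pos; ring

/-- Frequencies have spacing proportional to `1/L` and the phase varies along the fibre at rate at
least of order `δ`, so about `L k / δ` points have phase of size at most `k`. -/
theorem tsum_fiber_le {L : ℕ} (hL : 0 < L) (i : Fin 5) (j : Fin 4) (n : ℤ) (q : Fin 3 → ℤ)
    {δ k : ℝ} (hδ : 0 < δ) (hk : 0 < k) (hδk : δ ≤ k) (P : (Fin 5 → ℤ) → Prop) [DecidablePred P]
    (hP : ∀ p, out p = n → P p → δ ≤ |pos L (p i) - pos L (p (i.succAbove j))|) :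
    ∑' p : {p : hyperplane n // j.removeNth (i.removeNth (p : Fin 5 → ℤ)) = q},
      (if P p then ENNReal.ofReal (1 / (1 + (phase L p n / k) ^ 2)) else 0)
      ≤ ENNReal.ofReal (10 * (L * k / δ)) := by
  have hL' : (1 : ℝ) ≤ L := by exact_mod_cast hL
  have hpi : 3 < Real.pi := Real.pi_gt_three
  let X := {p : hyperplane n // j.removeNth (i.removeNth (p : Fin 5 → ℤ)) = q}
  let g : X → ℝ := fun p => pos L ((p : Fin 5 → ℤ) i) - pos L ((p : Fin 5 → ℤ) (i.succAbove j))
  -- The separation estimate needs the same ordering of the two slots at both points, hence one half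
  -- of the fibre for each sign of `g`; each contributes `5 L k / δ`.
  have key : ∀ S : Set X, (∀ x ∈ S, ∀ y ∈ S, (δ ≤ g x ∧ δ ≤ g y) ∨ (δ ≤ - g x ∧ δ ≤ - g y)) →
      ∑' p : S, ENNReal.ofReal (1 / (1 + (phase L (p : X) n / k) ^ 2))
        ≤ ENNReal.ofReal (5 * (L * k / δ)) := by
    intro S hS
    -- The true rate per index step is `8 π² δ / L`; the smaller `2 δ / L` is enough.
    refine (tsum_separated_le (fun p : S => ((p : X) : Fin 5 → ℤ) i)
      (fun p : S => phase L (p : X) n) (b := 2 * δ / L) (k := k) (by positivity) hk ?_ ?_).trans ?_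
    · intro x y hxy
      refine Subtype.ext (Subtype.ext (Subtype.ext ?_))
      have ho := (out_of_mem x.1.1).trans (out_of_mem y.1.1).symm
      refine eq_of_out_eq (i.succAbove j) ho ?_
      have hq := x.1.2.trans y.1.2.symm
      funext l
      by_cases hl : (i.succAbove j).succAbove l = i
      · simp only [Fin.removeNth, hl]; exact hxy
      · obtain ⟨l', hl'⟩ := Fin.exists_succAbove_eq hl
        have hlj : l' ≠ j := by
          rintro rfl
          exact Fin.succAbove_ne _ _ hl'.symm
        obtain ⟨l'', rfl⟩ := Fin.exists_succAbove_eq hlj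
        simp only [Fin.removeNth, ← hl']
        exact congrFun hq l''
    · intro x y
      have ho := (out_of_mem x.1.1).trans (out_of_mem y.1.1).symm
      have hq := x.1.2.trans y.1.2.symm
      have h := phase_separation (n := n) i j ho hq (D := 2 * Real.pi * δ) (by positivity) (by
        have := hS x.1 x.2 y.1 y.2
        simp only [g] at this
        simp only [freq_eq_pos, ← mul_sub]
        rcases this with ⟨h1, h2⟩ | ⟨h1, h2⟩
        · left; constructor <;> gcongr
        · right; constructor <;> gcongr <;> linarith)
      refine le_trans ?_ h
      have h0 : freq L (((x : X) : Fin 5 → ℤ) i) - freq L (((y : X) : Fin 5 → ℤ) i)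
          = 2 * Real.pi / L * ((((x : X) : Fin 5 → ℤ) i : ℝ) - (((y : X) : Fin 5 → ℤ) i : ℝ)) := by
        unfold freq; ring
      rw [h0, abs_mul, abs_of_pos (by positivity : 0 < 2 * Real.pi / L), ← mul_assoc]
      refine mul_le_mul_of_nonneg_right ?_ (abs_nonneg _)
      rw [div_le_iff₀ (by positivity)]
      have h3 : 2 * (2 * Real.pi * δ) * (2 * Real.pi / L) * L = 8 * Real.pi ^ 2 * δ := by
        field_simp; ring
      rw [h3]
      nlinarith [mul_pos hδ (by nlinarith : (0 : ℝ) < Real.pi ^ 2 - 9)]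
    · refine ENNReal.ofReal_le_ofReal ?_
      have h1 : 1 ≤ L * k / δ := by
        rw [le_div_iff₀ hδ]; nlinarith
      have h2 : 8 * k / (2 * δ / L) = 4 * (L * k / δ) := by field_simp; ring
      rw [h2]; linarith
  have hp := key {x | δ ≤ g x} (fun x hx y hy => Or.inl ⟨hx, hy⟩)
  have hm := key {x | δ ≤ -g x} (fun x hx y hy => Or.inr ⟨hx, hy⟩)
  rw [tsum_subtype {x | δ ≤ g x} fun x : X => ENNReal.ofReal (1 / (1 + (phase L x n / k) ^ 2))] at hp
  rw [tsum_subtype {x | δ ≤ -g x} fun x : X => ENNReal.ofReal (1 / (1 + (phase L x n / k) ^ 2))]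
    at hm
  calc _ ≤ ∑' x : X, (Set.indicator {x | δ ≤ g x}
          (fun x : X => ENNReal.ofReal (1 / (1 + (phase L x n / k) ^ 2))) x
        + Set.indicator {x | δ ≤ -g x}
          (fun x : X => ENNReal.ofReal (1 / (1 + (phase L x n / k) ^ 2))) x) := by
        refine ENNReal.tsum_le_tsum fun x => ?_
        split_ifs with hx
        · rcases le_abs.1 (hP _ (out_of_mem x.1) hx) with h | h
          · rw [Set.indicator_of_mem (show x ∈ {x | δ ≤ g x} from h)]
            exact le_self_add
          · rw [Set.indicator_of_mem (show x ∈ {x | δ ≤ -g x} from h)]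
            exact le_add_self
        · exact zero_le
    _ ≤ _ := by
        rw [ENNReal.tsum_add]
        refine (add_le_add hp hm).trans ?_
        rw [← ENNReal.ofReal_add (by positivity) (by positivity)]
        exact ENNReal.ofReal_le_ofReal (le_of_eq (by ring))

end QuinticNLS

namespace QuinticNLS

/-! ### The multiplier -/

theorem one_le_bracket (x : ℝ) : 1 ≤ bracket x := by
  unfold bracket; rw [Real.one_le_sqrt]; nlinarith [sq_nonneg x]

theorem bracket_pos (x : ℝ) : 0 < bracket x := zero_lt_one.trans_le (one_le_bracket x)

theorem abs_le_bracket (x : ℝ) : |x| ≤ bracket x :=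
  Real.abs_le_sqrt (by linarith)

theorem bracket_le (x : ℝ) : bracket x ≤ 1 + |x| := by
  unfold bracket
  refine Real.sqrt_le_iff.2 ⟨by positivity, ?_⟩
  nlinarith [abs_nonneg x, sq_abs x]

theorem bracket_le_bracket {x z : ℝ} (h : |x| ≤ |z|) : bracket x ≤ bracket z :=
  Real.sqrt_le_sqrt (by have := sq_le_sq.2 h; linarith)

theorem rpow_le_mul_rpow {A x z e : ℝ} (hA : 1 ≤ A) (hx : 0 ≤ x) (hz : 0 ≤ z) (h : x ≤ A * z)
    (he : 0 ≤ e) (he1 : e ≤ 1) : x ^ e ≤ A * z ^ e := by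
  calc x ^ e ≤ (A * z) ^ e := Real.rpow_le_rpow hx h he
    _ = A ^ e * z ^ e := Real.mul_rpow (by linarith) hz
    _ ≤ A * z ^ e := by
      gcongr
      calc A ^ e ≤ A ^ (1 : ℝ) := Real.rpow_le_rpow_of_exponent_le hA he1
        _ = A := Real.rpow_one A

theorem rpow_le_sq_mul_rpow {A x z e : ℝ} (hA : 1 ≤ A) (hx : 0 ≤ x) (hz : 0 ≤ z) (h : x ≤ A * z)
    (he : 0 ≤ e) (he1 : e ≤ 2) : x ^ e ≤ A ^ 2 * z ^ e := by
  calc x ^ e ≤ (A * z) ^ e := Real.rpow_le_rpow hx h he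
    _ = A ^ e * z ^ e := Real.mul_rpow (by linarith) hz
    _ ≤ A ^ 2 * z ^ e := by
      gcongr
      calc A ^ e ≤ A ^ (2 : ℝ) := Real.rpow_le_rpow_of_exponent_le hA he1
        _ = A ^ 2 := Real.rpow_two A

theorem tau_bounds {L : ℕ} (hL : 0 < L) (κ : ℕ) (η n : ℤ) :
    (tau L κ η n : ℝ) ≤ pos L n - waveNumber L κ * η ∧
      pos L n - waveNumber L κ * η < tau L κ η n + 1 := by
  have hL' : (0 : ℝ) < L := by exact_mod_cast hL
  obtain ⟨j, h0, h1, h2⟩ := (tau_eq_iff hL κ η n _).1 rfl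
  have h2' : (n : ℝ) = κ * η + L * tau L κ η n + j := by exact_mod_cast h2
  have e : pos L n - waveNumber L κ * η = tau L κ η n + j / L := by
    unfold pos waveNumber; rw [h2']; field_simp; ring
  have h0' : (0 : ℝ) ≤ j := by exact_mod_cast h0
  have h1' : (j : ℝ) < L := by exact_mod_cast h1
  rw [e]
  constructor
  · have : 0 ≤ (j : ℝ) / L := by positivity
    linarith
  · have : (j : ℝ) / L < 1 := by rwa [div_lt_one hL']
    linarith

theorem le_tau_of_le {L : ℕ} (hL : 0 < L) {κ : ℕ} {η n τ : ℤ}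
    (h : (τ : ℝ) ≤ pos L n - waveNumber L κ * η) : τ ≤ tau L κ η n := by
  have := (tau_bounds hL κ η n).2
  have h2 : (τ : ℝ) < (tau L κ η n : ℝ) + 1 := by linarith
  exact Int.lt_add_one_iff.1 (by exact_mod_cast h2)

theorem stdAt_of_pos {L : ℕ} (hL : 0 < L) {κ : ℕ} {η n : ℤ}
    (h0 : waveNumber L κ * η ≤ pos L n) (h1 : pos L n < waveNumber L κ * (η + 1)) :
    StdAt L κ η n := by
  have h2 := tau_bounds hL κ η n
  exact ⟨le_tau_of_le hL (by push_cast; linarith), by linarith⟩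

variable {s : ℝ} {L κ : ℕ} {n : ℤ}

theorem one_le_mult (hs : 1 < s) : 1 ≤ mult s L κ n := by
  have h : ∀ x e : ℝ, 0 ≤ e → 1 ≤ bracket x ^ e := fun x e he =>
    Real.one_le_rpow (one_le_bracket x) he
  unfold mult
  split_ifs
  · exact h _ _ (by linarith)
  · exact h _ _ (by linarith)
  · exact one_le_mul_of_one_le_of_one_le (h _ _ (by linarith)) (h _ _ (by norm_num))
  · exact one_le_mul_of_one_le_of_one_le (h _ _ (by linarith)) (h _ _ (by norm_num))
  · exact h _ _ (by linarith)

theorem mult_pos (hs : 1 < s) : 0 < mult s L κ n := zero_lt_one.trans_le (one_le_mult hs)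

theorem centeredAt_etaTilde (hn : n ∈ nearModes L κ) :
    CenteredAt L κ (etaTilde L κ n) n ∧
      (etaTilde L κ n = 0 ∨ etaTilde L κ n = 1 ∨ etaTilde L κ n = 3 ∨ etaTilde L κ n = 4) := by
  unfold etaTilde
  split_ifs with h0 h1 h3
  · simp [h0]
  · simp [h1]
  · simp [h3]
  · rcases hn with h | h | h | h
    · exact absurd h h0
    · exact absurd h h1
    · exact absurd h h3
    · simp [h]

theorem mult_of_near (hn : n ∈ nearModes L κ) :
    mult s L κ n = bracket (tau L κ (etaTilde L κ n) n) ^ (s - 1 / 2) := by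
  simp only [mult, if_pos hn]

theorem abs_pos_le_of_near (hL : 0 < L) (hn : n ∈ nearModes L κ) :
    |pos L n| ≤ 9 / 2 * waveNumber L κ + 1 := by
  obtain ⟨⟨h1, h2⟩, h3⟩ := centeredAt_etaTilde hn
  have hk : 0 ≤ waveNumber L κ := by unfold waveNumber; positivity
  have h4 := tau_bounds hL κ (etaTilde L κ n) n
  have h5 : (0 : ℝ) ≤ etaTilde L κ n ∧ (etaTilde L κ n : ℝ) ≤ 4 := by
    rcases h3 with h | h | h | h <;> simp only [h] <;> norm_num
  rw [abs_le]
  constructor <;> nlinarith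

theorem abs_pos_le_of_low (hL : 0 < L) (hn : n ∈ lowModes L κ) :
    |pos L n| ≤ 99 * waveNumber L κ + 1 ∧ - (99 * waveNumber L κ) ≤ pos L n := by
  obtain ⟨η, h1, h2, h3, h4⟩ := hn
  have hk : 0 ≤ waveNumber L κ := by unfold waveNumber; positivity
  have h5 := tau_bounds hL κ η n
  have h1' : (-99 : ℝ) ≤ η := by exact_mod_cast h1
  have h2' : (η : ℝ) ≤ 98 := by exact_mod_cast h2
  have h3' : (0 : ℝ) ≤ tau L κ η n := by exact_mod_cast h3
  rw [abs_le]
  refine ⟨⟨?_, ?_⟩, ?_⟩ <;> nlinarith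

theorem abs_pos_le_of_mid (hL : 0 < L) (hn : n ∈ midModes L κ) :
    |pos L n| ≤ 100 * waveNumber L κ + 1 := by
  have hk : 0 ≤ waveNumber L κ := by unfold waveNumber; positivity
  rw [abs_le]
  rcases hn with ⟨h3, h4⟩ | ⟨h3, h4⟩
  · have h5 := tau_bounds hL κ 99 n
    have h3' : (0 : ℝ) ≤ tau L κ 99 n := by exact_mod_cast h3
    push_cast at h5
    constructor <;> linarith
  · have h5 := tau_bounds hL κ (-100) n
    have h3' : (0 : ℝ) ≤ tau L κ (-100) n := by exact_mod_cast h3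
    push_cast at h5
    constructor <;> linarith

theorem mult_of_high (hL : 0 < L) (hn : 100 * waveNumber L κ + 2 ≤ |pos L n|) :
    mult s L κ n = bracket (freq L n) ^ s := by
  have hk : 0 ≤ waveNumber L κ := by unfold waveNumber; positivity
  have h1 : n ∉ nearModes L κ := fun h => by
    have := abs_pos_le_of_near hL h; linarith
  have h2 : n ∉ lowModes L κ := fun h => by
    have := (abs_pos_le_of_low hL h).1; linarith
  have h3 : n ∉ midModes L κ := fun h => by
    have := abs_pos_le_of_mid hL h; linarith
  simp only [mult, if_neg h1, if_neg h2, if_neg h3]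

theorem mem_low_or_mid (hL : 0 < L) (hk : 0 < waveNumber L κ)
    (hn : |pos L n| < 100 * waveNumber L κ) : n ∈ lowModes L κ ∨ n ∈ midModes L κ := by
  have h1 := Int.floor_le (pos L n / waveNumber L κ)
  have h2 := Int.lt_floor_add_one (pos L n / waveNumber L κ)
  set η := ⌊pos L n / waveNumber L κ⌋
  rw [le_div_iff₀ hk] at h1
  rw [div_lt_iff₀ hk] at h2
  have hst : StdAt L κ η n := stdAt_of_pos hL (by linarith) (by linarith)
  rw [abs_lt] at hn
  have h3 : (η : ℝ) < 100 := by
    by_contra h; push Not at h; nlinarith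
  have h4 : (-100 : ℝ) < η + 1 := by
    by_contra h; push Not at h; nlinarith
  have h3' : η < 100 := by exact_mod_cast h3
  have h4' : -100 < η + 1 := by exact_mod_cast h4
  by_cases h5 : η = 99
  · right; left; rwa [h5] at hst
  by_cases h6 : η = -100
  · right; right; rwa [h6] at hst
  · left; exact ⟨η, by omega, by omega, hst⟩

/-- The distance (in units of `2π`) by which a frequency exceeds `99k` in modulus. -/
noncomputable def excess (L κ : ℕ) (n : ℤ) : ℝ := max (|pos L n| - 99 * waveNumber L κ) 0

theorem excess_nonneg (L κ : ℕ) (n : ℤ) : 0 ≤ excess L κ n := le_max_right _ _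

theorem abs_freq (L : ℕ) (n : ℤ) : |freq L n| = 2 * Real.pi * |pos L n| := by
  rw [freq_eq_pos, abs_mul, abs_of_pos (by positivity)]

theorem pos_pos_iff (hL : 0 < L) : 0 < pos L n ↔ 0 < n := by
  have hL' : (0 : ℝ) < L := by exact_mod_cast hL
  unfold pos
  rw [div_pos_iff_of_pos_right hL']
  exact_mod_cast Iff.rfl

/-- The cases of `n ∈ 𝓝_m`. -/
theorem mid_cases (hL : 0 < L) (hk : 1 ≤ waveNumber L κ) (hn : n ∈ midModes L κ) :
    (0 < n ∧ StdAt L κ 99 n) ∨ (¬ 0 < n ∧ StdAt L κ (-100) n) := by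
  rcases hn with h | h
  · left
    refine ⟨?_, h⟩
    rw [← pos_pos_iff hL]
    have h5 := tau_bounds hL κ 99 n
    have h3' : (0 : ℝ) ≤ tau L κ 99 n := by exact_mod_cast h.1
    push_cast at h5
    linarith
  · right
    refine ⟨?_, h⟩
    rw [← pos_pos_iff hL]
    have h5 := tau_bounds hL κ (-100) n
    have := h.2
    push_cast at h5
    linarith

/-- Away from the four centers the multiplier behaves like the single profile `⟨k⟩^(s-1/2) (1 +
excess)^(1/2)`, whichever of the regions low, mid or high contains the frequency. For high
frequencies `⟨ξ⟩` dominates both `⟨k⟩` and `1 + excess`. -/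
theorem le_mult_of_not_near (hs : 1 < s) (hs' : s ≤ 3 / 2) (hL : 0 < L)
    (hk : 1 ≤ waveNumber L κ) (hn : n ∉ nearModes L κ) :
    bracket (waveNumber L κ) ^ (s - 1 / 2) * (1 + excess L κ n) ^ (1 / 2 : ℝ)
      ≤ 4 * mult s L κ n := by
  have hK := bracket_pos (waveNumber L κ)
  have hd := excess_nonneg L κ n
  have hKs : 0 ≤ bracket (waveNumber L κ) ^ (s - 1 / 2) := by positivity
  have key : ∀ x : ℝ, 1 ≤ x → 1 + excess L κ n ≤ 4 * x →
      bracket (waveNumber L κ) ^ (s - 1 / 2) * (1 + excess L κ n) ^ (1 / 2 : ℝ)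
        ≤ 4 * (bracket (waveNumber L κ) ^ (s - 1 / 2) * x ^ (1 / 2 : ℝ)) := fun x hx h => by
    have := rpow_le_mul_rpow (e := 1 / 2) (by norm_num) (by linarith) (by linarith) h (by norm_num)
      (by norm_num)
    nlinarith
  by_cases hlow : n ∈ lowModes L κ
  · have := abs_pos_le_of_low hL hlow
    have he : excess L κ n ≤ 1 := max_le (by linarith) (by norm_num)
    have := key 1 le_rfl (by linarith)
    simpa only [mult, if_neg hn, if_pos hlow, Real.one_rpow, mul_one] using this
  by_cases hmid : n ∈ midModes L κ
  · rcases mid_cases hL hk hmid with ⟨h, h'⟩ | ⟨h, h'⟩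
    · simp only [mult, if_neg hn, if_neg hlow, if_pos hmid, if_pos h]
      refine key _ (one_le_bracket _) ?_
      have h5 := tau_bounds hL κ 99 n
      have h6 := abs_le_bracket (tau L κ 99 n)
      have h7 := one_le_bracket (tau L κ 99 n)
      rw [abs_of_nonneg (by exact_mod_cast h'.1)] at h6
      have h8 := (pos_pos_iff hL).2 h
      push_cast at h5
      have : excess L κ n ≤ tau L κ 99 n + 1 := by
        have : (0 : ℝ) ≤ tau L κ 99 n := by exact_mod_cast h'.1
        unfold excess
        rw [abs_of_pos h8]
        exact max_le (by linarith) (by linarith)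
      linarith
    · simp only [mult, if_neg hn, if_neg hlow, if_pos hmid, if_neg h]
      refine key _ (one_le_bracket _) ?_
      have h5 := tau_bounds hL κ (-100) n
      have h6 := abs_le_bracket (waveNumber L κ - tau L κ (-100) n)
      have h7 := one_le_bracket (waveNumber L κ - tau L κ (-100) n)
      rw [abs_of_nonneg (by linarith [h'.2])] at h6
      rw [← pos_pos_iff hL] at h
      push_cast at h5
      have : excess L κ n ≤ waveNumber L κ - tau L κ (-100) n := by
        unfold excess
        rw [abs_of_nonpos (by linarith)]
        exact max_le (by linarith) (by linarith [h'.2])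
      linarith
  · simp only [mult, if_neg hn, if_neg hlow, if_neg hmid]
    have h1 : 100 * waveNumber L κ ≤ |pos L n| := by
      by_contra h
      push Not at h
      rcases mem_low_or_mid hL (by linarith) h with h | h <;> contradiction
    have hpi := Real.pi_gt_three
    have h2 : 6 * |pos L n| ≤ bracket (freq L n) := by
      refine le_trans ?_ (abs_le_bracket _)
      rw [abs_freq]; nlinarith [abs_nonneg (pos L n)]
    have h3 : bracket (waveNumber L κ) ≤ bracket (freq L n) := by
      refine (bracket_le _).trans ?_
      rw [abs_of_nonneg (by linarith)]; linarith
    have h4 : 1 + excess L κ n ≤ bracket (freq L n) := by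
      have : excess L κ n ≤ |pos L n| := max_le (by linarith) (abs_nonneg _)
      linarith
    calc _ ≤ bracket (freq L n) ^ (s - 1 / 2) * bracket (freq L n) ^ (1 / 2 : ℝ) := by
          gcongr <;> first | linarith | exact Real.rpow_nonneg (bracket_pos _).le _
      _ = bracket (freq L n) ^ s := by
          rw [← Real.rpow_add (bracket_pos _)]; congr 1; ring
      _ ≤ _ := by
          have : 0 ≤ bracket (freq L n) ^ s := Real.rpow_nonneg (bracket_pos _).le _
          linarith

theorem mult_le_rpow (hs : 1 < s) (hs' : s ≤ 3 / 2) (hL : 0 < L) {B : ℝ}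
    (hB : bracket (waveNumber L κ) ≤ B) (hB' : bracket (pos L n) ≤ B) :
    mult s L κ n ≤ 1000000 * B ^ s := by
  have hk : 0 ≤ waveNumber L κ := by unfold waveNumber; positivity
  have hB1 : 1 ≤ B := (one_le_bracket _).trans hB
  have hkB : waveNumber L κ ≤ B := (le_abs_self _).trans ((abs_le_bracket _).trans hB)
  have hyB : |pos L n| ≤ B := (abs_le_bracket _).trans hB'
  have htau : ∀ η : ℤ, |(η : ℝ)| ≤ 100 → |(tau L κ η n : ℝ)| ≤ 102 * B := fun η hη => by
    have h := tau_bounds hL κ η n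
    have h1 : |waveNumber L κ * η| ≤ 100 * B := by
      rw [abs_mul, abs_of_nonneg hk]
      have := abs_nonneg (η : ℝ)
      nlinarith
    rw [abs_le] at h1 hyB ⊢
    constructor <;> linarith
  have hA : ∀ x e : ℝ, |x| ≤ 103 * B → 0 ≤ e → e ≤ 1 → bracket x ^ e ≤ 104 * B ^ e :=
    fun x e hx h0 h1 => rpow_le_mul_rpow (by norm_num) (bracket_pos _).le (by linarith)
      ((bracket_le x).trans (by linarith)) h0 h1
  have hBs : B ^ (s - 1 / 2) ≤ B ^ s := Real.rpow_le_rpow_of_exponent_le hB1 (by linarith)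
  have hB0 : 0 ≤ B ^ (s - 1 / 2) := by positivity
  have hBm : B ^ (s - 1 / 2) * B ^ (1 / 2 : ℝ) = B ^ s := by
    rw [← Real.rpow_add (by linarith)]; congr 1; ring
  have hmid : ∀ x : ℝ, |x| ≤ 103 * B →
      bracket (waveNumber L κ) ^ (s - 1 / 2) * bracket x ^ (1 / 2 : ℝ) ≤ 1000000 * B ^ s := by
    intro x hx
    have h1 := hA (waveNumber L κ) (s - 1 / 2) (by rw [abs_of_nonneg hk]; linarith) (by linarith)
      (by linarith)
    have h2 := hA x (1 / 2) hx (by norm_num) (by norm_num)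
    calc _ ≤ (104 * B ^ (s - 1 / 2)) * (104 * B ^ (1 / 2 : ℝ)) := by
          gcongr
          exact Real.rpow_nonneg (bracket_pos _).le _
      _ = 10816 * B ^ s := by rw [← hBm]; ring
      _ ≤ _ := by nlinarith
  by_cases hn : n ∈ nearModes L κ
  · rw [mult_of_near hn]
    have h3 := (centeredAt_etaTilde hn).2
    have h5 : |(etaTilde L κ n : ℝ)| ≤ 100 := by
      rcases h3 with h | h | h | h <;> simp only [h] <;> norm_num
    have := htau _ h5
    exact (hA _ _ (by linarith) (by linarith) (by linarith)).trans (by nlinarith)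
  unfold mult
  rw [if_neg hn]
  split_ifs
  · exact (hA _ _ (by rw [abs_of_nonneg hk]; linarith) (by linarith) (by linarith)).trans
      (by nlinarith)
  · exact hmid _ (by have := htau 99 (by norm_num); linarith)
  · refine hmid _ ?_
    have := htau (-100) (by norm_num)
    rw [abs_le] at this ⊢
    constructor <;> linarith
  · have hpi := Real.pi_lt_d2
    refine (rpow_le_sq_mul_rpow (A := 8) (z := B) (by norm_num) (bracket_pos _).le (by linarith) ?_
      (by linarith) (by linarith)).trans (by nlinarith)
    refine (bracket_le _).trans ?_
    rw [abs_freq]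
    nlinarith [abs_nonneg (pos L n)]

/-- The matching upper bound, also valid at near modes. The range `500 k` is what five inputs below
`100 k` can produce. -/
theorem mult_le_of_le (hs : 1 < s) (hs' : s ≤ 3 / 2) (hL : 0 < L)
    (hk : 1 ≤ waveNumber L κ) (hn : |pos L n| ≤ 500 * waveNumber L κ) :
    mult s L κ n ≤ 100000000 *
      (bracket (waveNumber L κ) ^ (s - 1 / 2) * (1 + excess L κ n) ^ (1 / 2 : ℝ)) := by
  have hK := one_le_bracket (waveNumber L κ)
  have hkK : waveNumber L κ ≤ bracket (waveNumber L κ) :=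
    (le_abs_self _).trans (abs_le_bracket _)
  have hd := excess_nonneg L κ n
  have hKs : 0 ≤ bracket (waveNumber L κ) ^ (s - 1 / 2) := by positivity
  have hd1 : 1 ≤ (1 + excess L κ n) ^ (1 / 2 : ℝ) := Real.one_le_rpow (by linarith) (by norm_num)
  have hlow' : bracket (waveNumber L κ) ^ (s - 1 / 2) ≤ 100000000 *
      (bracket (waveNumber L κ) ^ (s - 1 / 2) * (1 + excess L κ n) ^ (1 / 2 : ℝ)) := by
    nlinarith [mul_nonneg hKs (by linarith : 0 ≤ (1 + excess L κ n) ^ (1 / 2 : ℝ) - 1)]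
  have key : ∀ x : ℝ, 1 ≤ x → x ≤ 4 * (1 + excess L κ n) →
      bracket (waveNumber L κ) ^ (s - 1 / 2) * x ^ (1 / 2 : ℝ)
      ≤ 100000000 *
      (bracket (waveNumber L κ) ^ (s - 1 / 2) * (1 + excess L κ n) ^ (1 / 2 : ℝ)) :=
    fun x hx h => by
      have := rpow_le_mul_rpow (e := 1 / 2) (by norm_num) (by linarith) (by linarith) h
        (by norm_num) (by norm_num)
      have h0 : 0 ≤ (1 + excess L κ n) ^ (1 / 2 : ℝ) := by positivity
      calc _ ≤ bracket (waveNumber L κ) ^ (s - 1 / 2) * (4 * (1 + excess L κ n) ^ (1 / 2 : ℝ)) := by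
            gcongr
        _ ≤ _ := by nlinarith [mul_nonneg hKs h0]
  by_cases hn' : n ∈ nearModes L κ
  · rw [mult_of_near hn']
    refine le_trans ?_ hlow'
    refine Real.rpow_le_rpow (bracket_pos _).le (bracket_le_bracket ?_) (by linarith)
    obtain ⟨h1, h2⟩ := (centeredAt_etaTilde hn').1
    rw [abs_of_nonneg (by linarith : 0 ≤ waveNumber L κ), abs_le]
    constructor <;> linarith
  by_cases hlow : n ∈ lowModes L κ
  · simpa only [mult, if_neg hn', if_pos hlow] using hlow'
  by_cases hmid : n ∈ midModes L κ
  · rcases mid_cases hL hk hmid with ⟨h, h'⟩ | ⟨h, h'⟩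
    · simp only [mult, if_neg hn', if_neg hlow, if_pos hmid, if_pos h]
      refine key _ (one_le_bracket _) ?_
      have h5 := tau_bounds hL κ 99 n
      have h6 := bracket_le (tau L κ 99 n)
      rw [abs_of_nonneg (by exact_mod_cast h'.1)] at h6
      push_cast at h5
      have : |pos L n| - 99 * waveNumber L κ ≤ excess L κ n := le_max_left _ _
      have := le_abs_self (pos L n)
      linarith
    · simp only [mult, if_neg hn', if_neg hlow, if_pos hmid, if_neg h]
      refine key _ (one_le_bracket _) ?_
      have h5 := tau_bounds hL κ (-100) n
      have h6 := bracket_le (waveNumber L κ - tau L κ (-100) n)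
      rw [abs_of_nonneg (by linarith [h'.2])] at h6
      push_cast at h5
      have : |pos L n| - 99 * waveNumber L κ ≤ excess L κ n := le_max_left _ _
      have := neg_abs_le (pos L n)
      linarith
  · have h1 : 100 * waveNumber L κ ≤ |pos L n| := by
      by_contra h
      push Not at h
      rcases mem_low_or_mid hL (by linarith) h with h | h <;> contradiction
    have h2 : |pos L n| - 99 * waveNumber L κ ≤ excess L κ n := le_max_left _ _
    simp only [mult, if_neg hn', if_neg hlow, if_neg hmid]
    have hpi := Real.pi_lt_d2
    have h3 : bracket (freq L n) ≤ 4000 * waveNumber L κ := by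
      refine (bracket_le _).trans ?_
      rw [abs_freq]
      nlinarith [abs_nonneg (pos L n)]
    calc bracket (freq L n) ^ s = bracket (freq L n) ^ (s - 1 / 2) * bracket (freq L n) ^ (1 / 2 : ℝ)
        := by rw [← Real.rpow_add (bracket_pos _)]; congr 1; ring
      _ ≤ (4000 * bracket (waveNumber L κ) ^ (s - 1 / 2))
          * (4000 * (1 + excess L κ n) ^ (1 / 2 : ℝ)) := by
          gcongr
          · exact Real.rpow_nonneg (bracket_pos _).le _
          · exact rpow_le_mul_rpow (by norm_num) (bracket_pos _).le (by linarith) (by linarith)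
              (by linarith) (by linarith)
          · exact rpow_le_mul_rpow (by norm_num) (bracket_pos _).le (by linarith) (by linarith)
              (by linarith) (by linarith)
      _ ≤ _ := by
          have h0 : 0 ≤ (1 + excess L κ n) ^ (1 / 2 : ℝ) := by positivity
          nlinarith [mul_nonneg hKs h0]

end QuinticNLS

namespace QuinticNLS

open scoped ENNReal

variable {s : ℝ} {L κ : ℕ} {n : ℤ}

theorem waveNumber_nonneg (L κ : ℕ) : 0 ≤ waveNumber L κ := by unfold waveNumber; positivity

theorem bracket_pos_le_bracket_freq (L : ℕ) (n : ℤ) : bracket (pos L n) ≤ bracket (freq L n) := by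
  refine bracket_le_bracket ?_
  rw [abs_freq]
  nlinarith [Real.pi_gt_three, abs_nonneg (pos L n)]

/-- Beyond `100 k` the excess is at least `k`, so already at the inner edge the profile has the full
Sobolev size `⟨k⟩^s`. Hence an input of this size dominates every output it can contribute to as the
largest input. -/
theorem rpow_bracket_le_mult (hs : 1 < s) (hs' : s ≤ 3 / 2) (hL : 0 < L)
    (hk : 1 ≤ waveNumber L κ) (hn : 100 * waveNumber L κ ≤ |pos L n|) :
    bracket (pos L n) ^ s ≤ 1000000 * mult s L κ n := by
  have hm := one_le_mult (s := s) (L := L) (κ := κ) (n := n) hs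
  have hkK : waveNumber L κ ≤ bracket (waveNumber L κ) :=
    (le_abs_self _).trans (abs_le_bracket _)
  rcases le_total (|pos L n|) (200 * waveNumber L κ) with h | h
  · have hnear : n ∉ nearModes L κ := fun h => by
      have := abs_pos_le_of_near hL h; linarith
    have h1 := le_mult_of_not_near hs hs' hL hk hnear
    have h2 : |pos L n| - 99 * waveNumber L κ ≤ excess L κ n := le_max_left _ _
    have h3 := bracket_le (pos L n)
    calc bracket (pos L n) ^ s
        = bracket (pos L n) ^ (s - 1 / 2) * bracket (pos L n) ^ (1 / 2 : ℝ) := by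
          rw [← Real.rpow_add (bracket_pos _)]; congr 1; ring
      _ ≤ (201 * bracket (waveNumber L κ) ^ (s - 1 / 2))
          * (201 * (1 + excess L κ n) ^ (1 / 2 : ℝ)) := by
          have hK := bracket_pos (waveNumber L κ)
          exact mul_le_mul (rpow_le_mul_rpow (by norm_num) (bracket_pos _).le (bracket_pos _).le
              (by linarith) (by linarith) (by linarith))
            (rpow_le_mul_rpow (by norm_num) (bracket_pos _).le (by linarith)
              (by linarith) (by norm_num) (by norm_num))
            (Real.rpow_nonneg (bracket_pos _).le _) (by positivity)
      _ ≤ _ := by linarith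
  · rw [mult_of_high hL (by linarith)]
    have h1 : bracket (pos L n) ^ s ≤ bracket (freq L n) ^ s :=
      Real.rpow_le_rpow (bracket_pos _).le (bracket_pos_le_bracket_freq L n) (by linarith)
    have h2 : 0 ≤ bracket (freq L n) ^ s := Real.rpow_nonneg (bracket_pos _).le _
    linarith

theorem rpow_bracket_le_mult_of_bounded (hs : 1 < s) (hs' : s ≤ 3 / 2) (hL : 0 < L) {K₀ : ℝ}
    (hK₀ : 1 ≤ K₀) (hk : waveNumber L κ ≤ K₀) :
    bracket (pos L n) ^ s ≤ (103 * K₀) ^ 2 * mult s L κ n := by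
  have hm := one_le_mult (s := s) (L := L) (κ := κ) (n := n) hs
  rcases le_total (|pos L n|) (100 * waveNumber L κ + 2) with h | h
  · have h3 := bracket_le (pos L n)
    have h4 := rpow_le_sq_mul_rpow (A := 103 * K₀) (x := bracket (pos L n)) (z := 1) (e := s)
      (by linarith) (bracket_pos _).le zero_le_one (by linarith) (by linarith) (by linarith)
    rw [Real.one_rpow] at h4
    exact h4.trans (by gcongr)
  · rw [mult_of_high hL h]
    have h1 : bracket (pos L n) ^ s ≤ bracket (freq L n) ^ s :=
      Real.rpow_le_rpow (bracket_pos _).le (bracket_pos_le_bracket_freq L n) (by linarith)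
    have h2 : 0 ≤ bracket (freq L n) ^ s := Real.rpow_nonneg (bracket_pos _).le _
    have h3 : 1 ≤ (103 * K₀) ^ 2 := by nlinarith
    nlinarith [mul_le_mul_of_nonneg_right h3 h2]

/-- A frequency close to one of the four centers has the multiplier of that center. -/
theorem mult_le_of_close (hs : 1 < s) (hs' : s ≤ 3 / 2) (hL : 0 < L) (hk : 10 ≤ waveNumber L κ)
    {η : ℤ} (hη : η = 0 ∨ η = 1 ∨ η = 3 ∨ η = 4)
    (hn : |pos L n - waveNumber L κ * η| ≤ waveNumber L κ / 10) :
    mult s L κ n ≤ (2 + |pos L n - waveNumber L κ * η|) ^ (s - 1 / 2) := by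
  have h1 := tau_bounds hL κ η n
  have h2 := abs_le.1 hn
  have hc : CenteredAt L κ η n := ⟨by linarith, by linarith⟩
  have hnear : n ∈ nearModes L κ := by
    rcases hη with rfl | rfl | rfl | rfl
    · exact Or.inl hc
    · exact Or.inr (Or.inl hc)
    · exact Or.inr (Or.inr (Or.inl hc))
    · exact Or.inr (Or.inr (Or.inr hc))
  obtain ⟨⟨h3, h4⟩, -⟩ := centeredAt_etaTilde hnear
  have h5 := tau_bounds hL κ (etaTilde L κ n) n
  -- Centers are at least `k` apart, while the frequency is within `k/10` of one and within `k/2 +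
  -- 1` of the other. For `k ≥ 10` they coincide.
  have h6 : etaTilde L κ n = η := by
    have h7 : (etaTilde L κ n : ℝ) - η < 1 := by
      by_contra h; push Not at h; nlinarith
    have h8 : (-1 : ℝ) < etaTilde L κ n - η := by
      by_contra h; push Not at h; nlinarith
    have h7' : etaTilde L κ n - η < 1 := by exact_mod_cast h7
    have h8' : -1 < etaTilde L κ n - η := by exact_mod_cast h8
    omega
  rw [mult_of_near hnear, h6]
  refine Real.rpow_le_rpow (bracket_pos _).le ((bracket_le _).trans ?_) (by linarith)
  have : |(tau L κ η n : ℝ)| ≤ 1 + |pos L n - waveNumber L κ * η| := by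
    rw [abs_le]
    constructor
    · linarith [neg_abs_le (pos L n - waveNumber L κ * η)]
    · linarith [le_abs_self (pos L n - waveNumber L κ * η)]
  linarith

/-- The real distance to the center replaces the integer `tau`, which loses at most `1` and hence
the factor `3`; the momentum relation can be applied to real distances. -/
theorem near_data (hL : 0 < L) (hs : 1 < s) (hn : n ∈ nearModes L κ) :
    ∃ η : ℤ, (η = 0 ∨ η = 1 ∨ η = 3 ∨ η = 4) ∧
      |pos L n - waveNumber L κ * η| ≤ waveNumber L κ / 2 + 1 ∧
      (1 + |pos L n - waveNumber L κ * η|) ^ (s - 1 / 2) ≤ 3 ^ (s - 1 / 2) * mult s L κ n := by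
  obtain ⟨⟨h1, h2⟩, h3⟩ := centeredAt_etaTilde hn
  have h4 := tau_bounds hL κ (etaTilde L κ n) n
  refine ⟨etaTilde L κ n, h3, ?_, ?_⟩
  · rw [abs_le]; constructor <;> linarith
  · rw [mult_of_near hn, ← Real.mul_rpow (by norm_num) (bracket_pos _).le]
    refine Real.rpow_le_rpow (by positivity) ?_ (by linarith)
    have h5 := abs_le_bracket (tau L κ (etaTilde L κ n) n)
    have h6 := one_le_bracket (tau L κ (etaTilde L κ n) n)
    have : |pos L n - waveNumber L κ * (etaTilde L κ n)| ≤ |(tau L κ (etaTilde L κ n) n : ℝ)| + 1 := by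
      rw [abs_le]
      constructor
      · linarith [neg_abs_le (tau L κ (etaTilde L κ n) n : ℝ)]
      · linarith [le_abs_self (tau L κ (etaTilde L κ n) n : ℝ)]
    linarith

/-! ### Summability of the inverse squares of the multiplier -/

theorem tsum_tau (hL : 0 < L) (η : ℤ) (g : ℤ → ℝ≥0∞) :
    ∑' n : ℤ, g (tau L κ η n) = L * ∑' τ, g τ := by
  have : NeZero L := ⟨hL.ne'⟩
  rw [← (Equiv.addRight ((κ : ℤ) * η)).tsum_eq]
  rw [← (Int.divModEquiv L).symm.tsum_eq, ENNReal.tsum_prod', ← ENNReal.tsum_mul_left]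
  refine tsum_congr fun τ => ?_
  have : ∀ j : Fin L, tau L κ η (Equiv.addRight ((κ : ℤ) * η) ((Int.divModEquiv L).symm (τ, j)))
      = τ := fun j => by
    rw [tau_eq_iff hL]
    refine ⟨j, by positivity, by exact_mod_cast j.2, ?_⟩
    simp [Int.divModEquiv]
    ring
  simp only [this, tsum_fintype, Finset.sum_const, Finset.card_univ, Fintype.card_fin, nsmul_eq_mul]

theorem tsum_bracket_ne_top (hs : 1 < s) :
    ∑' τ : ℤ, ENNReal.ofReal (bracket τ ^ (1 - 2 * s)) ≠ ∞ := by
  -- Convergence needs `2 s - 1 > 1`. A negative real power of `0` is `0` here, so the term `τ = 0`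
  -- is supplied by an indicator.
  have h1 : Summable fun τ : ℤ => |(τ : ℝ)| ^ (-(2 * s - 1)) + if τ = 0 then 1 else 0 :=
    (Real.summable_abs_int_rpow (by linarith)).add
      (summable_of_hasFiniteSupport (Set.Finite.subset (Set.finite_singleton 0) fun τ hτ => by
        by_contra h
        exact hτ (by simpa using h)))
  refine ne_top_of_le_ne_top h1.tsum_ofReal_ne_top (ENNReal.tsum_le_tsum fun τ =>
    ENNReal.ofReal_le_ofReal ?_)
  rw [show (1 - 2 * s) = -(2 * s - 1) by ring]
  by_cases h : τ = 0
  · subst h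
    simp only [Int.cast_zero, if_pos]
    have : bracket 0 = 1 := by simp [bracket]
    rw [this, Real.one_rpow]
    have : (0 : ℝ) ≤ |0| ^ (-(2 * s - 1)) := by positivity
    linarith
  · rw [if_neg h, add_zero]
    refine Real.rpow_le_rpow_of_nonpos ?_ (abs_le_bracket _) (by linarith)
    exact abs_pos.2 (by exact_mod_cast h)

theorem tsum_count_le (hL : 0 < L) {R : ℝ} (hR : 0 ≤ R) :
    ∑' n : ℤ, (if |pos L n| ≤ R then 1 else 0 : ℝ≥0∞) ≤ L * ENNReal.ofReal (2 * R + 1) := by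
  have hL' : (1 : ℝ) ≤ L := by exact_mod_cast hL
  have hN : (⌊L * R⌋₊ : ℝ) ≤ L * R := Nat.floor_le (by positivity)
  set N : ℕ := ⌊L * R⌋₊ with hNdef
  calc ∑' n : ℤ, (if |pos L n| ≤ R then 1 else 0 : ℝ≥0∞)
      ≤ ∑' n : ℤ, (if n ∈ Finset.Icc (-(N : ℤ)) N then 1 else 0 : ℝ≥0∞) := by
        refine ENNReal.tsum_le_tsum fun n => ?_
        by_cases h : |pos L n| ≤ R
        · rw [if_pos h, if_pos]
          have h1 : |(n : ℝ)| ≤ L * R := by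
            unfold pos at h
            rw [abs_div, abs_of_pos (by linarith : (0 : ℝ) < L), div_le_iff₀ (by linarith)] at h
            linarith
          have h2 : n.natAbs ≤ N := by
            rw [hNdef, Nat.le_floor_iff (by positivity)]
            rwa [Nat.cast_natAbs, Int.cast_abs]
          rw [Finset.mem_Icc]
          omega
        · rw [if_neg h]; exact zero_le
    _ = ((Finset.Icc (-(N : ℤ)) N).card : ℝ≥0∞) := by
        rw [tsum_eq_sum (s := Finset.Icc (-(N : ℤ)) N) (fun n hn => if_neg hn)]
        rw [Finset.sum_congr rfl fun n hn => if_pos hn]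
        simp
    _ ≤ _ := by
        rw [Int.card_Icc, ← ENNReal.ofReal_natCast, ← ENNReal.ofReal_natCast,
          ← ENNReal.ofReal_mul (by positivity)]
        refine ENNReal.ofReal_le_ofReal ?_
        have : ((((N : ℤ) + 1 - -(N : ℤ)).toNat : ℕ) : ℝ) = 2 * N + 1 := by
          have : ((N : ℤ) + 1 - -(N : ℤ)).toNat = 2 * N + 1 := by omega
          rw [this]; push_cast; ring
        rw [this]
        nlinarith

/-- Near modes give a summable power of `⟨τ⟩` at one of the centers. The remaining modes up to `100
k` have `m² ≳ ⟨k⟩`, as `2 s - 1 ≥ 1`, which balances their number `O(L ⟨k⟩)`. High modes are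
absorbed by the term of the center `0`. -/
theorem inv_mult_sq_le (hs : 1 < s) (hs' : s ≤ 3 / 2) (hL : 0 < L) (n : ℤ) :
    1 / mult s L κ n ^ 2 ≤
      (bracket (tau L κ 0 n) ^ (1 - 2 * s) + bracket (tau L κ 1 n) ^ (1 - 2 * s)
        + bracket (tau L κ 3 n) ^ (1 - 2 * s) + bracket (tau L κ 4 n) ^ (1 - 2 * s))
      + (16 / bracket (waveNumber L κ)) *
        (if |pos L n| ≤ 100 * waveNumber L κ + 2 then 1 else 0) := by
  have hb : ∀ η : ℤ, 0 ≤ bracket (tau L κ η n) ^ (1 - 2 * s) := fun η =>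
    Real.rpow_nonneg (bracket_pos _).le _
  have h0 := hb 0
  have h1 := hb 1
  have h3 := hb 3
  have h4 := hb 4
  have hK := one_le_bracket (waveNumber L κ)
  have hr : 0 ≤ (16 / bracket (waveNumber L κ)) *
        (if |pos L n| ≤ 100 * waveNumber L κ + 2 then 1 else 0) := by
    split_ifs <;> positivity
  have hsq : ∀ x e : ℝ, 0 < x → 1 / (x ^ e) ^ 2 = x ^ (-(2 * e)) := fun x e hx => by
    rw [Real.rpow_neg hx.le, one_div, ← Real.rpow_natCast, ← Real.rpow_mul hx.le]
    congr 2; push_cast; ring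
  by_cases hn : n ∈ nearModes L κ
  · rw [mult_of_near hn, hsq _ _ (bracket_pos _), show -(2 * (s - 1 / 2)) = 1 - 2 * s by ring]
    rcases (centeredAt_etaTilde hn).2 with h | h | h | h <;> rw [h] <;> linarith
  by_cases hy : |pos L n| ≤ 100 * waveNumber L κ + 2
  · rw [if_pos hy, mul_one]
    refine le_trans ?_ (le_add_of_nonneg_left (by linarith))
    have hm := one_le_mult (s := s) (L := L) (κ := κ) (n := n) hs
    rw [div_le_div_iff₀ (by positivity) (by positivity), one_mul]
    rcases le_total 1 (waveNumber L κ) with hk | hk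
    · have := le_mult_of_not_near hs hs' hL hk hn
      have h5 : bracket (waveNumber L κ) ^ (1 / 2 : ℝ) ≤ 4 * mult s L κ n := by
        refine le_trans ?_ this
        calc _ ≤ bracket (waveNumber L κ) ^ (s - 1 / 2) * 1 := by
              rw [mul_one]
              exact Real.rpow_le_rpow_of_exponent_le hK (by linarith)
          _ ≤ _ := by
              gcongr
              exact Real.one_le_rpow (by linarith [excess_nonneg L κ n]) (by norm_num)
      have h6 : bracket (waveNumber L κ) = (bracket (waveNumber L κ) ^ (1 / 2 : ℝ)) ^ 2 := by
        rw [← Real.rpow_natCast, ← Real.rpow_mul (by linarith)]; norm_num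
      have h7 : 0 ≤ bracket (waveNumber L κ) ^ (1 / 2 : ℝ) := by positivity
      nlinarith
    · have := bracket_le (waveNumber L κ)
      rw [abs_of_nonneg (waveNumber_nonneg L κ)] at this
      nlinarith
  · push Not at hy
    rw [mult_of_high hL hy.le, hsq _ _ (bracket_pos _)]
    have h5 := tau_bounds hL κ 0 n
    have h6 : bracket (tau L κ 0 n) ≤ bracket (freq L n) := by
      refine bracket_le_bracket ?_
      rw [abs_freq]
      have h7 : |(tau L κ 0 n : ℝ)| ≤ |pos L n| + 1 := by
        push_cast at h5
        rw [abs_le]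
        constructor
        · linarith [neg_abs_le (pos L n)]
        · linarith [le_abs_self (pos L n)]
      nlinarith [Real.pi_gt_three, waveNumber_nonneg L κ]
    have h7 : bracket (freq L n) ^ (-(2 * s)) ≤ bracket (tau L κ 0 n) ^ (1 - 2 * s) :=
      calc _ ≤ bracket (freq L n) ^ (1 - 2 * s) :=
            Real.rpow_le_rpow_of_exponent_le (one_le_bracket _) (by linarith)
        _ ≤ _ := Real.rpow_le_rpow_of_nonpos (bracket_pos _) h6 (by linarith)
    linarith

theorem exists_tsum_inv_mult_sq_le (hs : 1 < s) (hs' : s ≤ 3 / 2) :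
    ∃ Z : ℝ, 0 < Z ∧ ∀ L κ : ℕ, 0 < L →
      ∑' n : ℤ, ENNReal.ofReal (1 / mult s L κ n ^ 2) ≤ L * ENNReal.ofReal Z := by
  set z := ∑' τ : ℤ, ENNReal.ofReal (bracket τ ^ (1 - 2 * s)) with hz
  have hzt : z ≠ ∞ := tsum_bracket_ne_top hs
  -- The count contributes `16 (200 k + 5) / ⟨k⟩ ≤ 16 · 205 = 3280`.
  refine ⟨4 * z.toReal + 3280, by positivity, fun L κ hL => ?_⟩
  have hK := bracket_pos (waveNumber L κ)
  have hK1 := one_le_bracket (waveNumber L κ)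
  have hkK : waveNumber L κ ≤ bracket (waveNumber L κ) :=
    (le_abs_self _).trans (abs_le_bracket _)
  have hk := waveNumber_nonneg L κ
  have hb : ∀ η n : ℤ, 0 ≤ bracket (tau L κ η n) ^ (1 - 2 * s) := fun η n =>
    Real.rpow_nonneg (bracket_pos _).le _
  calc ∑' n : ℤ, ENNReal.ofReal (1 / mult s L κ n ^ 2)
      ≤ ∑' n : ℤ, ((ENNReal.ofReal (bracket (tau L κ 0 n) ^ (1 - 2 * s))
          + ENNReal.ofReal (bracket (tau L κ 1 n) ^ (1 - 2 * s))
          + ENNReal.ofReal (bracket (tau L κ 3 n) ^ (1 - 2 * s))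
          + ENNReal.ofReal (bracket (tau L κ 4 n) ^ (1 - 2 * s)))
          + ENNReal.ofReal (16 / bracket (waveNumber L κ))
            * (if |pos L n| ≤ 100 * waveNumber L κ + 2 then 1 else 0)) := by
        refine ENNReal.tsum_le_tsum fun n => ?_
        refine (ENNReal.ofReal_le_ofReal (inv_mult_sq_le hs hs' hL n)).trans ?_
        have h0 := hb 0 n
        have h1 := hb 1 n
        have h3 := hb 3 n
        have h4 := hb 4 n
        refine ENNReal.ofReal_add_le.trans (add_le_add ?_ ?_)
        · rw [ENNReal.ofReal_add (by positivity) h4, ENNReal.ofReal_add (by positivity) h3,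
            ENNReal.ofReal_add h0 h1]
        · rw [ENNReal.ofReal_mul (by positivity)]
          gcongr
          split_ifs <;> simp
    _ = L * z + L * z + L * z + L * z + ENNReal.ofReal (16 / bracket (waveNumber L κ))
        * ∑' n : ℤ, (if |pos L n| ≤ 100 * waveNumber L κ + 2 then 1 else 0) := by
        simp only [ENNReal.tsum_add, ENNReal.tsum_mul_left]
        have := fun η => tsum_tau (κ := κ) hL η fun τ => ENNReal.ofReal (bracket τ ^ (1 - 2 * s))
        rw [this, this, this, this]
    _ ≤ L * z + L * z + L * z + L * z + ENNReal.ofReal (16 / bracket (waveNumber L κ))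
        * (L * ENNReal.ofReal (2 * (100 * waveNumber L κ + 2) + 1)) := by
        gcongr
        exact tsum_count_le hL (by linarith)
    _ = L * (4 * z + ENNReal.ofReal (16 / bracket (waveNumber L κ)
          * (2 * (100 * waveNumber L κ + 2) + 1))) := by
        rw [ENNReal.ofReal_mul (by positivity)]; ring
    _ ≤ L * (4 * z + ENNReal.ofReal 3280) := by
        gcongr
        rw [div_mul_eq_mul_div, div_le_iff₀ hK]
        linarith
    _ = _ := by
        rw [ENNReal.ofReal_add (by positivity) (by norm_num), ENNReal.ofReal_mul (by norm_num),
          ENNReal.ofReal_toReal hzt]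
        norm_num

end QuinticNLS

namespace QuinticNLS

/-! ### Lower bounds for the phase -/

-- This is the arithmetic reason for the choice of `0, 1, 3, 4`: an exact resonance with five inputs
-- at the centers has its output at a center. The finitely many cases are checked by evaluation.
set_option maxRecDepth 100000 in
theorem centers_closed : ∀ a ∈ ({0, 1, 3, 4} : Finset ℤ), ∀ b ∈ ({0, 1, 3, 4} : Finset ℤ),
    ∀ c ∈ ({0, 1, 3, 4} : Finset ℤ), ∀ d ∈ ({0, 1, 3, 4} : Finset ℤ),
    ∀ e ∈ ({0, 1, 3, 4} : Finset ℤ), a - b + c - d + e ∉ ({0, 1, 3, 4} : Finset ℤ) →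
      a ^ 2 - b ^ 2 + c ^ 2 - d ^ 2 + e ^ 2 ≠ (a - b + c - d + e) ^ 2 := by
  decide +kernel

theorem sum_sgn (f : Fin 5 → ℝ) : ∑ l, sgn l * f l = f 0 - f 1 + f 2 - f 3 + f 4 := by
  simp [sgn, Fin.sum_univ_five]; ring

theorem abs_sum_sgn_le (f : Fin 5 → ℝ) {D : ℝ} (h : ∀ l, |f l| ≤ D) :
    |∑ l, sgn l * f l| ≤ 5 * D := by
  refine (Finset.abs_sum_le_sum_abs _ _).trans ?_
  have : ∀ l, |sgn l * f l| ≤ D := fun l => by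
    rcases sgn_eq l with h' | h' <;> simpa [h'] using h l
  refine (Finset.sum_le_sum fun l _ => this l).trans ?_
  simp

theorem pos_out (L : ℕ) (p : Fin 5 → ℤ) : pos L (out p) = ∑ l, sgn l * pos L (p l) := by
  unfold pos
  rw [cast_out, Finset.sum_div]
  exact Finset.sum_congr rfl fun l _ => by ring

theorem phase_out (L : ℕ) (p : Fin 5 → ℤ) : phase L p (out p)
    = 4 * Real.pi ^ 2 * (∑ l, sgn l * pos L (p l) ^ 2 - pos L (out p) ^ 2) := by
  rw [phase_eq, mul_sub, Finset.mul_sum]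
  simp only [freq_eq_pos]
  congr 1
  · exact Finset.sum_congr rfl fun l _ => by ring
  · ring

/-- The phase is `4 π² k²` times the energy defect of the rescaled frequencies. Replacing these by a
model configuration `v` changes the defect by less than `1/2`, so a defect of modulus at least `1`
in the model survives. -/
theorem le_abs_phase {L : ℕ} (p : Fin 5 → ℤ) (v : Fin 5 → ℝ) {k : ℝ} (hk : 0 < k)
    (hv : ∀ l, |v l| ≤ 100) (he : ∀ l, |pos L (p l) - k * v l| ≤ k / 100000)
    (hE : 1 ≤ |∑ l, sgn l * v l ^ 2 - (∑ l, sgn l * v l) ^ 2|) :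
    k ^ 2 ≤ |phase L p (out p)| := by
  have h1 : |∑ l, sgn l * (pos L (p l) ^ 2 - k ^ 2 * v l ^ 2)| ≤ 5 * (k ^ 2 / 400) := by
    refine abs_sum_sgn_le _ fun l => ?_
    have e : pos L (p l) ^ 2 - k ^ 2 * v l ^ 2
        = (pos L (p l) - k * v l) * ((pos L (p l) - k * v l) + 2 * (k * v l)) := by ring
    have h2 : |(pos L (p l) - k * v l) + 2 * (k * v l)| ≤ k / 100000 + 200 * k := by
      refine (abs_add_le _ _).trans (add_le_add (he l) ?_)
      rw [abs_mul, abs_mul, abs_of_pos hk, abs_two]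
      nlinarith [hv l]
    rw [e, abs_mul]
    refine (mul_le_mul (he l) h2 (abs_nonneg _) (by positivity)).trans ?_
    nlinarith [sq_nonneg k]
  have h3 : |pos L (out p) - k * ∑ l, sgn l * v l| ≤ 5 * (k / 100000) := by
    have := abs_sum_sgn_le (fun l => pos L (p l) - k * v l) he
    convert this using 2
    rw [pos_out, Finset.mul_sum, ← Finset.sum_sub_distrib]
    exact Finset.sum_congr rfl fun l _ => by ring
  have h4 : |∑ l, sgn l * v l| ≤ 5 * 100 := abs_sum_sgn_le v hv
  have h5 : |pos L (out p) ^ 2 - k ^ 2 * (∑ l, sgn l * v l) ^ 2| ≤ k ^ 2 / 10 := by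
    have e : pos L (out p) ^ 2 - k ^ 2 * (∑ l, sgn l * v l) ^ 2
        = (pos L (out p) - k * ∑ l, sgn l * v l) * ((pos L (out p) - k * ∑ l, sgn l * v l)
          + 2 * (k * ∑ l, sgn l * v l)) := by ring
    have h2 : |(pos L (out p) - k * ∑ l, sgn l * v l) + 2 * (k * ∑ l, sgn l * v l)|
        ≤ 5 * (k / 100000) + 1000 * k := by
      refine (abs_add_le _ _).trans (add_le_add h3 ?_)
      rw [abs_mul, abs_mul, abs_of_pos hk, abs_two]
      nlinarith
    rw [e, abs_mul]
    refine (mul_le_mul h3 h2 (abs_nonneg _) (by positivity)).trans ?_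
    nlinarith [sq_nonneg k]
  have h6 : ∑ l, sgn l * (pos L (p l) ^ 2 - k ^ 2 * v l ^ 2)
      = ∑ l, sgn l * pos L (p l) ^ 2 - k ^ 2 * ∑ l, sgn l * v l ^ 2 := by
    rw [Finset.mul_sum, ← Finset.sum_sub_distrib]
    exact Finset.sum_congr rfl fun l _ => by ring
  rw [h6] at h1
  rw [phase_out, abs_mul, abs_of_pos (by positivity)]
  have h7 : k ^ 2 / 2 ≤ |∑ l, sgn l * pos L (p l) ^ 2 - pos L (out p) ^ 2| := by
    have h8 : k ^ 2 * 1 ≤ |k ^ 2 * (∑ l, sgn l * v l ^ 2 - (∑ l, sgn l * v l) ^ 2)| := by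
      rw [abs_mul, abs_of_pos (by positivity)]
      gcongr
    rw [abs_le] at h1 h5
    have hk2 : 0 < k ^ 2 := by positivity
    rcases le_abs.1 h8 with h | h
    · exact le_abs.2 (Or.inl (by linarith))
    · exact le_abs.2 (Or.inr (by linarith))
  have hpi := Real.pi_gt_three
  calc k ^ 2 ≤ 36 * (k ^ 2 / 2) := by nlinarith [sq_nonneg k]
    _ ≤ _ := mul_le_mul (by nlinarith) h7 (by positivity) (by positivity)

/-- The model has slots at a common position `ρ` or at centers: `P` is the signed number of the
former, `η` and `Q` are the signed sums of the latter and of their squares. Write `V = P ρ + η`. `P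
= 0` contradicts `|V| ≥ 98`; for `P = 1` the defect is `Q - 2 V η + η²`, dominated by `2 V η` as `η
≠ 0`; for the other values the term `-V²` is not compensated by `P ρ²`. -/
theorem cluster_energy {P η Q : ℤ} {ρ : ℝ} (hP : -2 ≤ P) (hP' : P ≤ 3) (hη : -12 ≤ η)
    (hη' : η ≤ 12) (hQ : -48 ≤ Q) (hQ' : Q ≤ 48) (hV : 98 ≤ |P * ρ + η|)
    (h1 : ¬ (P = 1 ∧ η = 0)) : 1 ≤ |P * ρ ^ 2 + Q - (P * ρ + η) ^ 2| := by
  have hη1 : (-12 : ℝ) ≤ η := by exact_mod_cast hη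
  have hη2 : (η : ℝ) ≤ 12 := by exact_mod_cast hη'
  have hQ1 : (-48 : ℝ) ≤ Q := by exact_mod_cast hQ
  have hQ2 : (Q : ℝ) ≤ 48 := by exact_mod_cast hQ'
  have hP0 : P ≠ 0 := by
    rintro rfl
    simp only [Int.cast_zero, zero_mul, zero_add] at hV
    rcases le_abs.1 hV with h | h <;> linarith
  by_cases hP1 : P = 1
  · subst hP1
    have hη0 : η ≠ 0 := fun h => h1 ⟨rfl, h⟩
    obtain ⟨V, hVd⟩ : ∃ V, V = ρ + η := ⟨_, rfl⟩
    have e : ((1 : ℤ) : ℝ) * ρ ^ 2 + Q - (((1 : ℤ) : ℝ) * ρ + η) ^ 2 = Q - 2 * V * η + η ^ 2 := by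
      rw [hVd]; push_cast; ring
    rw [e]
    rw [Int.cast_one, one_mul, ← hVd] at hV
    rcases lt_or_gt_of_ne hη0 with h | h
    · have h' : (η : ℝ) ≤ -1 := by exact_mod_cast Int.le_sub_one_of_lt h
      rcases le_abs.1 hV with h2 | h2
      · exact le_abs.2 (Or.inl (by nlinarith))
      · exact le_abs.2 (Or.inr (by nlinarith))
    · have h' : (1 : ℝ) ≤ η := by exact_mod_cast h
      rcases le_abs.1 hV with h2 | h2
      · exact le_abs.2 (Or.inr (by nlinarith))
      · exact le_abs.2 (Or.inl (by nlinarith))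
  · obtain ⟨V, hVd⟩ : ∃ V, V = P * ρ + η := ⟨_, rfl⟩
    rw [← hVd] at hV ⊢
    refine le_abs.2 (Or.inr ?_)
    have hρ : P * ρ = V - η := by linarith
    have hP2 : P = -2 ∨ P = -1 ∨ P = 2 ∨ P = 3 := by omega
    have hV2 : 98 * |V| ≤ V ^ 2 := by rw [← sq_abs V]; nlinarith
    have hVη : |V * η| ≤ 12 * |V| := by
      rw [abs_mul, mul_comm]
      gcongr
      rw [abs_le]; constructor <;> linarith
    have hVη' := abs_le.1 hVη
    have hη3 : (η : ℝ) ^ 2 ≤ 144 := by nlinarith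
    rcases hP2 with rfl | rfl | rfl | rfl
    · push_cast at hρ ⊢
      nlinarith [sq_nonneg ρ]
    · push_cast at hρ ⊢
      nlinarith [sq_nonneg ρ]
    · push_cast at hρ ⊢
      obtain rfl : ρ = (V - η) / 2 := by linarith
      nlinarith
    · push_cast at hρ ⊢
      obtain rfl : ρ = (V - η) / 3 := by linarith
      nlinarith

end QuinticNLS

namespace QuinticNLS

/-! ### The trichotomy for quintuples -/

/-- A pair of slots with separated frequencies whose multipliers make up for that of the output. -/
def PairCond (s C : ℝ) (L κ : ℕ) (δ β : ℝ) (p : Fin 5 → ℤ) (i j : Fin 5) : Prop :=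
  (1 ≤ δ ∧ δ ≤ waveNumber L κ ∧ 1 ≤ β ∧ β ≤ waveNumber L κ ^ (s - 1 / 2)) ∧
  waveNumber L κ ^ (s - 1 / 2) ≤ C * mult s L κ (p i) ∧ β ≤ C * mult s L κ (p j) ∧
  δ ≤ C * |pos L (p i) - pos L (p j)| ∧
  mult s L κ (out p) * (waveNumber L κ / δ) ^ (1 / 2 : ℝ)
    ≤ C * (waveNumber L κ ^ (s - 1 / 2) * β)

/-- The excess of a frequency, capped at `k`. -/
noncomputable def cappedExcess (L κ : ℕ) (n : ℤ) : ℝ := min (waveNumber L κ) (excess L κ n)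

variable {s : ℝ} {L κ : ℕ} {p : Fin 5 → ℤ}

theorem exists_max_slot (L : ℕ) (p : Fin 5 → ℤ) :
    ∃ i, (∀ l, |pos L (p l)| ≤ |pos L (p i)|) ∧ |pos L (out p)| ≤ 5 * |pos L (p i)| := by
  obtain ⟨i, -, hi⟩ := Finset.univ.exists_max_image (fun l => |pos L (p l)|) ⟨0, Finset.mem_univ _⟩
  refine ⟨i, fun l => hi l (Finset.mem_univ _), ?_⟩
  rw [pos_out]
  exact abs_sum_sgn_le _ fun l => hi l (Finset.mem_univ _)

/-- Everywhere `m` is at most of Sobolev size, so the output is controlled by a largest input as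
soon as the multiplier of that input attains the Sobolev size. -/
theorem mult_out_le_of_dominated (hs : 1 < s) (hs' : s ≤ 3 / 2) (hL : 0 < L) {i : Fin 5}
    (hi : |pos L (out p)| ≤ 5 * |pos L (p i)|) {K₀ A : ℝ} (hK₀ : 1 ≤ K₀)
    (hk : bracket (waveNumber L κ) ≤ K₀ * bracket (pos L (p i)))
    (hA : bracket (pos L (p i)) ^ s ≤ A * mult s L κ (p i)) :
    mult s L κ (out p) ≤ 1000000 * (5 * K₀) ^ 2 * A * mult s L κ (p i) := by
  have hb := one_le_bracket (pos L (p i))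
  have h1 := mult_le_rpow (s := s) (κ := κ) (n := out p) hs hs' hL
    (B := 5 * K₀ * bracket (pos L (p i))) (by nlinarith) (by
      have h2 := bracket_le (pos L (out p))
      have h3 := abs_le_bracket (pos L (p i))
      have h4 : bracket (pos L (out p)) ≤ 5 * bracket (pos L (p i)) := by
        unfold bracket
        have h5 : (pos L (out p)) ^ 2 ≤ 25 * (pos L (p i)) ^ 2 := by
          have := sq_le_sq' (by linarith [abs_nonneg (pos L (out p)), abs_nonneg (pos L (p i))]) hi
          rw [sq_abs, mul_pow, sq_abs] at this
          linarith
        rw [Real.sqrt_le_left (by positivity), mul_pow, Real.sq_sqrt (by positivity)]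
        linarith
      nlinarith)
  have h2 := rpow_le_sq_mul_rpow (A := 5 * K₀) (x := 5 * K₀ * bracket (pos L (p i)))
    (z := bracket (pos L (p i))) (e := s) (by linarith) (by positivity) (by linarith) le_rfl
    (by linarith) (by linarith)
  calc _ ≤ 1000000 * ((5 * K₀) ^ 2 * (A * mult s L κ (p i))) := by
        refine h1.trans ?_
        gcongr
        exact h2.trans (by gcongr)
    _ = _ := by ring

theorem bracket_waveNumber_le (hk : 1 ≤ waveNumber L κ) :
    bracket (waveNumber L κ) ≤ 2 * waveNumber L κ := by
  have := bracket_le (waveNumber L κ)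
  rw [abs_of_nonneg (by linarith)] at this
  linarith

theorem le_bracket_waveNumber (L κ : ℕ) : waveNumber L κ ≤ bracket (waveNumber L κ) :=
  (le_abs_self _).trans (abs_le_bracket _)

theorem rpow_le_mult_of_not_near (hs : 1 < s) (hs' : s ≤ 3 / 2) (hL : 0 < L)
    (hk : 1 ≤ waveNumber L κ) {n : ℤ} (hn : n ∉ nearModes L κ) :
    waveNumber L κ ^ (s - 1 / 2) ≤ 4 * mult s L κ n := by
  refine le_trans ?_ (le_mult_of_not_near hs hs' hL hk hn)
  calc waveNumber L κ ^ (s - 1 / 2) ≤ bracket (waveNumber L κ) ^ (s - 1 / 2) * 1 := by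
        rw [mul_one]
        exact Real.rpow_le_rpow (by linarith) (le_bracket_waveNumber L κ) (by linarith)
    _ ≤ _ := by
        have := bracket_pos (waveNumber L κ)
        gcongr
        exact Real.one_le_rpow (by linarith [excess_nonneg L κ n]) (by norm_num)

theorem three_rpow_le (hs' : s ≤ 3 / 2) : (3 : ℝ) ^ (s - 1 / 2) ≤ 3 := by
  calc (3 : ℝ) ^ (s - 1 / 2) ≤ 3 ^ (1 : ℝ) :=
        Real.rpow_le_rpow_of_exponent_le (by norm_num) (by linarith)
    _ = 3 := Real.rpow_one 3

/-- Outputs that exceed `99k` by at most a constant. -/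
theorem trichotomy_of_small_excess (hs : 1 < s) (hs' : s ≤ 3 / 2) (hL : 0 < L)
    (hk : 100 ≤ waveNumber L κ)
    (hout : mult s L κ (out p) ≤ 10000000000 * waveNumber L κ ^ (s - 1 / 2)) :
    (∃ i, mult s L κ (out p) ≤ 100000000000000000000 * mult s L κ (p i)) ∨
      waveNumber L κ ^ 2 ≤ |phase L p (out p)| := by
  have hk0 : 0 < waveNumber L κ := by linarith
  have hm := fun l => one_le_mult (s := s) (L := L) (κ := κ) (n := p l) hs
  by_cases h1 : ∃ i, p i ∉ nearModes L κ
  · obtain ⟨i, hi⟩ := h1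
    have := rpow_le_mult_of_not_near hs hs' hL (by linarith) hi
    exact Or.inl ⟨i, by linarith [hm i]⟩
  push Not at h1
  choose η hη hτ hητ using fun l => near_data (s := s) hL hs (h1 l)
  have h3 := three_rpow_le hs'
  have hητ' : ∀ l, (1 + |pos L (p l) - waveNumber L κ * η l|) ^ (s - 1 / 2)
      ≤ 3 * mult s L κ (p l) := fun l => (hητ l).trans (by gcongr; linarith [hm l])
  -- All inputs are near modes. One that is offset from its center by a fixed fraction of `k` has a
  -- multiplier of order `k^(s-1/2)`, which is enough.
  by_cases h2 : ∃ i, waveNumber L κ / 100000 < |pos L (p i) - waveNumber L κ * η i|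
  · obtain ⟨i, hi⟩ := h2
    left
    refine ⟨i, ?_⟩
    have h4 : waveNumber L κ ^ (s - 1 / 2) ≤ 100000 *
        (1 + |pos L (p i) - waveNumber L κ * η i|) ^ (s - 1 / 2) :=
      rpow_le_mul_rpow (by norm_num) hk0.le (by positivity) (by linarith) (by linarith)
        (by linarith)
    linarith [hητ' i, hm i]
  push Not at h2
  have hd : |pos L (out p) - waveNumber L κ * ∑ l, sgn l * η l|
      = |∑ l, sgn l * (pos L (p l) - waveNumber L κ * η l)| := by
    rw [pos_out, Finset.mul_sum, ← Finset.sum_sub_distrib]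
    congr 1
    exact Finset.sum_congr rfl fun l _ => by ring
  have hmem : ∀ l, η l ∈ ({0, 1, 3, 4} : Finset ℤ) := fun l => by simpa using hη l
  -- If the centers combine to a center, the offset of the output is at most five times the largest
  -- input offset. Otherwise the integer energy defect is nonzero.
  by_cases h5 : η 0 - η 1 + η 2 - η 3 + η 4 ∈ ({0, 1, 3, 4} : Finset ℤ)
  · left
    obtain ⟨i, -, hi⟩ := Finset.univ.exists_max_image
      (fun l => |pos L (p l) - waveNumber L κ * η l|) ⟨0, Finset.mem_univ _⟩
    have hle : |pos L (out p) - waveNumber L κ * ∑ l, sgn l * η l|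
        ≤ 5 * |pos L (p i) - waveNumber L κ * η i| := by
      rw [hd]
      exact abs_sum_sgn_le _ fun l => hi l (Finset.mem_univ _)
    have hsum : ∑ l, sgn l * (η l : ℝ) = ((η 0 - η 1 + η 2 - η 3 + η 4 : ℤ) : ℝ) := by
      rw [sum_sgn]; push_cast; ring
    rw [hsum] at hle
    refine ⟨i, (mult_le_of_close hs hs' hL (by linarith) (by simpa using h5)
      (hle.trans (by linarith [h2 i]))).trans ?_⟩
    refine (rpow_le_mul_rpow (A := 5) (z := 1 + |pos L (p i) - waveNumber L κ * η i|) (by norm_num)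
      (by positivity) (by positivity) (by linarith) (by linarith) (by linarith)).trans ?_
    linarith [hητ' i, hm i]
  · right
    refine le_abs_phase p (fun l => η l) hk0 (fun l => ?_) h2 ?_
    · rcases hη l with h | h | h | h <;> norm_num [h]
    · have := centers_closed _ (hmem 0) _ (hmem 1) _ (hmem 2) _ (hmem 3) _ (hmem 4) h5
      rw [sum_sgn, sum_sgn]
      have h6 : (η 0 ^ 2 - η 1 ^ 2 + η 2 ^ 2 - η 3 ^ 2 + η 4 ^ 2
          - (η 0 - η 1 + η 2 - η 3 + η 4) ^ 2) ≠ 0 := sub_ne_zero.2 this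
      exact_mod_cast Int.one_le_abs h6

/-- Quintuples whose slots are close to a single frequency or to one of the four centers. -/
theorem le_abs_phase_of_cluster {k ρ D : ℝ} (hk : 0 < k) (hD : 100 ≤ D) (hDk : D ≤ k)
    (hρ : |ρ| ≤ 100 * k)
    (hp : ∀ l, |pos L (p l) - ρ| ≤ D / 100000 ∨
      ∃ η : ℤ, (η = 0 ∨ η = 1 ∨ η = 3 ∨ η = 4) ∧ |pos L (p l) - k * η| ≤ D / 100000)
    (hy : 99 * k ≤ |pos L (out p)|) (hd : 9 / 10 * D ≤ |pos L (out p) - ρ|) :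
    k ^ 2 ≤ |phase L p (out p)| := by
  -- Each slot has the form `k (b ρ/k + h)` up to a small error, with `b = 1, h = 0` for the cluster
  -- and `b = 0` for a center. Since `b h = 0`, the squares have no mixed terms.
  have hp' : ∀ l, ∃ b h : ℤ, (b = 0 ∨ b = 1) ∧ (h = 0 ∨ h = 1 ∨ h = 3 ∨ h = 4) ∧ b * h = 0 ∧
      |pos L (p l) - k * (b * (ρ / k) + h)| ≤ D / 100000 := by
    intro l
    rcases hp l with h | ⟨η, hη, h⟩
    · refine ⟨1, 0, by simp, by simp, by simp, ?_⟩
      convert h using 2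
      push_cast
      field_simp
      ring
    · exact ⟨0, η, by simp, hη, by simp, by simpa using h⟩
  choose b h hb hh hbh hbhp using hp'
  have hv2 : ∀ l, ((b l : ℝ) * (ρ / k) + h l) ^ 2 = b l * (ρ / k) ^ 2 + (h l : ℝ) ^ 2 := by
    intro l
    have h0 : (b l : ℝ) * h l = 0 := by exact_mod_cast hbh l
    have h1 : (b l : ℝ) ^ 2 = b l := by rcases hb l with h | h <;> simp [h]
    linear_combination (ρ / k) ^ 2 * h1 + 2 * (ρ / k) * h0
  obtain ⟨P, hP⟩ : ∃ P, P = b 0 - b 1 + b 2 - b 3 + b 4 := ⟨_, rfl⟩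
  obtain ⟨η, hη⟩ : ∃ η, η = h 0 - h 1 + h 2 - h 3 + h 4 := ⟨_, rfl⟩
  obtain ⟨Q, hQ⟩ : ∃ Q, Q = h 0 ^ 2 - h 1 ^ 2 + h 2 ^ 2 - h 3 ^ 2 + h 4 ^ 2 := ⟨_, rfl⟩
  have hV : ∑ l, sgn l * ((b l : ℝ) * (ρ / k) + h l) = P * (ρ / k) + η := by
    rw [sum_sgn, hP, hη]; push_cast; ring
  have hE : ∑ l, sgn l * ((b l : ℝ) * (ρ / k) + h l) ^ 2 = P * (ρ / k) ^ 2 + Q := by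
    simp only [hv2]
    rw [sum_sgn, hP, hQ]; push_cast; ring
  have hout : |pos L (out p) - k * (P * (ρ / k) + η)| ≤ 5 * (D / 100000) := by
    have := abs_sum_sgn_le (fun l => pos L (p l) - k * (b l * (ρ / k) + h l)) hbhp
    convert this using 2
    rw [pos_out, ← hV, Finset.mul_sum, ← Finset.sum_sub_distrib]
    exact Finset.sum_congr rfl fun l _ => by ring
  have hb' : ∀ l, 0 ≤ b l ∧ b l ≤ 1 := fun l => by rcases hb l with h | h <;> simp [h]
  have hh' : ∀ l, 0 ≤ h l ∧ h l ≤ 4 := fun l => by rcases hh l with h | h | h | h <;> simp [h]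
  have hh2 : ∀ l, 0 ≤ h l ^ 2 ∧ h l ^ 2 ≤ 16 := fun l => by
    rcases hh l with h | h | h | h <;> simp [h]
  have b0 := hb' 0
  have b1 := hb' 1
  have b2 := hb' 2
  have b3 := hb' 3
  have b4 := hb' 4
  have h0 := hh' 0
  have h1 := hh' 1
  have h2 := hh' 2
  have h3 := hh' 3
  have h4 := hh' 4
  have q0 := hh2 0
  have q1 := hh2 1
  have q2 := hh2 2
  have q3 := hh2 3
  have q4 := hh2 4
  refine le_abs_phase p (fun l => b l * (ρ / k) + h l) hk (fun l => ?_)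
    (fun l => (hbhp l).trans (by linarith)) ?_
  · rcases hb l with hbl | hbl
    · have : (h l : ℝ) ≤ 4 := by exact_mod_cast (hh' l).2
      have : (0 : ℝ) ≤ h l := by exact_mod_cast (hh' l).1
      rw [hbl, abs_le]
      push_cast
      constructor <;> linarith
    · have : h l = 0 := by simpa [hbl] using hbh l
      rw [hbl, this]
      push_cast
      rw [one_mul, add_zero, abs_div, abs_of_pos hk, div_le_iff₀ hk]
      exact hρ
  · rw [hV, hE]
    refine cluster_energy (by omega) (by omega) (by omega) (by omega) (by omega) (by omega) ?_ ?_
    · have h5 : |k * (P * (ρ / k) + η)| = k * |P * (ρ / k) + η| := by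
        rw [abs_mul, abs_of_pos hk]
      have h6 := abs_sub_abs_le_abs_sub (pos L (out p)) (k * (P * (ρ / k) + η))
      rw [h5] at h6
      by_contra hcon
      push Not at hcon
      nlinarith
    -- For `P = 1, η = 0` the output would be within `5 D / 100000` of `ρ`, against the assumed
    -- distance.
    · rintro ⟨rfl, rfl⟩
      have h7 : k * (((1 : ℤ) : ℝ) * (ρ / k) + ((0 : ℤ) : ℝ)) = ρ := by
        push_cast; field_simp; ring
      rw [h7] at hout
      linarith

end QuinticNLS

namespace QuinticNLS

variable {s : ℝ} {L κ : ℕ} {p : Fin 5 → ℤ}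

/-- Outputs that exceed `99k` by a large amount, all inputs being below `100k`. -/
theorem trichotomy_of_large_excess (hs : 1 < s) (hs' : s ≤ 3 / 2) (hL : 0 < L)
    (hk : 100 ≤ waveNumber L κ) (hin : ∀ l, |pos L (p l)| < 100 * waveNumber L κ)
    (hex : 100 ≤ excess L κ (out p))
    (hout : mult s L κ (out p) ≤ 200000000000 *
      (waveNumber L κ ^ (s - 1 / 2) * cappedExcess L κ (out p) ^ (1 / 2 : ℝ))) :
    (∃ i, mult s L κ (out p) ≤ 100000000000000000000 * mult s L κ (p i)) ∨
      waveNumber L κ ^ 2 ≤ |phase L p (out p)| ∨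
      ∃ i j, i ≠ j ∧
        (PairCond s 100000000000000000000 L κ (cappedExcess L κ (out p))
            (waveNumber L κ ^ (s - 1 / 2)) p i j ∨
          PairCond s 100000000000000000000 L κ (waveNumber L κ)
            (cappedExcess L κ (out p) ^ (1 / 2 : ℝ)) p i j) := by
  have hk0 : 0 < waveNumber L κ := by linarith
  have hm := fun l => one_le_mult (s := s) (L := L) (κ := κ) (n := p l) hs
  set k := waveNumber L κ with hkdef
  set D := cappedExcess L κ (out p) with hD
  have hDk : D ≤ k := min_le_left _ _
  have hDd : D ≤ excess L κ (out p) := min_le_right _ _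
  have hD100 : 100 ≤ D := le_min hk hex
  have hy : |pos L (out p)| = 99 * k + excess L κ (out p) := by
    have : excess L κ (out p) = |pos L (out p)| - 99 * k := by
      unfold excess at hex ⊢
      rcases max_cases (|pos L (out p)| - 99 * waveNumber L κ) 0 with ⟨h, -⟩ | ⟨h, -⟩
      · exact h
      · rw [h] at hex; norm_num at hex
    linarith
  have hks : 0 < k ^ (s - 1 / 2) := by positivity
  have hD2 : D ^ (1 / 2 : ℝ) ≤ k ^ (1 / 2 : ℝ) :=
    Real.rpow_le_rpow (by linarith) hDk (by norm_num)
  have hk2 : k ^ (1 / 2 : ℝ) ≤ k ^ (s - 1 / 2) :=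
    Real.rpow_le_rpow_of_exponent_le (by linarith) (by linarith)
  have hD1 : 1 ≤ D ^ (1 / 2 : ℝ) := Real.one_le_rpow (by linarith) (by norm_num)
  -- An input with a comparable excess dominates. Otherwise every input stays at distance at least
  -- `9/10 D` from the output.
  by_cases h1 : ∃ i, excess L κ (out p) / 10 ≤ excess L κ (p i)
  · obtain ⟨i, hi⟩ := h1
    left
    refine ⟨i, ?_⟩
    have hnear : p i ∉ nearModes L κ := fun h => by
      have h2 := abs_pos_le_of_near hL h
      have h3 : excess L κ (p i) ≤ 0 := max_le (by linarith) le_rfl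
      linarith
    have h4 := le_mult_of_not_near hs hs' hL (by linarith) hnear
    have h5 : D ^ (1 / 2 : ℝ) ≤ 10 * (1 + excess L κ (p i)) ^ (1 / 2 : ℝ) :=
      rpow_le_mul_rpow (by norm_num) (by linarith) (by linarith [excess_nonneg L κ (p i)])
        (by linarith) (by norm_num) (by norm_num)
    have h6 : k ^ (s - 1 / 2) ≤ bracket k ^ (s - 1 / 2) :=
      Real.rpow_le_rpow hk0.le (le_bracket_waveNumber L κ) (by linarith)
    have h7 : k ^ (s - 1 / 2) * D ^ (1 / 2 : ℝ)
        ≤ bracket k ^ (s - 1 / 2) * (10 * (1 + excess L κ (p i)) ^ (1 / 2 : ℝ)) :=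
      mul_le_mul h6 h5 (by linarith) (hks.le.trans h6)
    linarith [hm i]
  push Not at h1
  have hdist : ∀ l, 9 / 10 * D ≤ |pos L (out p) - pos L (p l)| := fun l => by
    have h2 : |pos L (p l)| - 99 * k ≤ excess L κ (p l) := le_max_left _ _
    have h3 := abs_sub_abs_le_abs_sub (pos L (out p)) (pos L (p l))
    linarith [h1 l]
  -- The output exceeds `99 k`, so the largest input exceeds `99 k / 5`, beyond all near modes,
  -- which reach only `9 k / 2 + 1`. It serves as first slot of the pair and as cluster position.
  obtain ⟨i, -, hi⟩ := exists_max_slot L p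
  have hinear : p i ∉ nearModes L κ := fun h => by
    have h2 := abs_pos_le_of_near hL h
    linarith
  have him := rpow_le_mult_of_not_near hs hs' hL (by linarith) hinear
  have hiC : k ^ (s - 1 / 2) ≤ 100000000000000000000 * mult s L κ (p i) := by linarith [hm i]
  -- Two separated inputs that are not near: a pair with `δ = D` and `β = k^(s-1/2)`. The loss
  -- `(k/D)^(1/2)` turns `D^(1/2)` into `k^(1/2) ≤ k^(s-1/2)`, by `s > 1`.
  by_cases h2 : ∃ j, p j ∉ nearModes L κ ∧ D / 100000 < |pos L (p j) - pos L (p i)|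
  · obtain ⟨j, hj, hj'⟩ := h2
    right; right
    refine ⟨i, j, ?_, Or.inl ⟨⟨by linarith, hDk, hD1.trans (hD2.trans hk2), le_rfl⟩, hiC, ?_, ?_, ?_⟩⟩
    · rintro rfl
      simp only [sub_self, abs_zero] at hj'
      linarith
    · have := rpow_le_mult_of_not_near hs hs' hL (by linarith) hj
      linarith [hm j]
    · rw [abs_sub_comm]; linarith
    · have h3 : D ^ (1 / 2 : ℝ) * (k / D) ^ (1 / 2 : ℝ) = k ^ (1 / 2 : ℝ) := by
        rw [← Real.mul_rpow (by linarith) (by positivity)]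
        congr 1; field_simp
      calc mult s L κ (out p) * (k / D) ^ (1 / 2 : ℝ)
          ≤ (200000000000 * (k ^ (s - 1 / 2) * D ^ (1 / 2 : ℝ))) * (k / D) ^ (1 / 2 : ℝ) := by
            gcongr
        _ = 200000000000 * (k ^ (s - 1 / 2) * k ^ (1 / 2 : ℝ)) := by rw [← h3]; ring
        _ ≤ 100000000000000000000 * (k ^ (s - 1 / 2) * k ^ (s - 1 / 2)) := by
            gcongr
            norm_num
  push Not at h2
  have h3 := three_rpow_le hs'
  -- Now all inputs that are not near cluster at the largest one. If the near ones cluster at the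
  -- centers, the phase is large.
  by_cases h4 : ∀ j, p j ∈ nearModes L κ →
      ∃ η : ℤ, (η = 0 ∨ η = 1 ∨ η = 3 ∨ η = 4) ∧ |pos L (p j) - k * η| ≤ D / 100000
  · right; left
    refine le_abs_phase_of_cluster hk0 hD100 hDk (hin i).le (fun l => ?_)
      (by rw [hy]; linarith) (hdist i)
    by_cases hl : p l ∈ nearModes L κ
    · exact Or.inr (h4 l hl)
    · exact Or.inl (h2 l hl)
  -- A near input off all centers by more than `D / 100000` has `m ≳ D^(s-1/2) ≥ D^(1/2)` and lies
  -- at distance of order `k` from slot `i`: a pair with `δ = k` and no loss.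
  · push Not at h4
    obtain ⟨j, hj, hj'⟩ := h4
    obtain ⟨η, hη, hτ, hητ⟩ := near_data (s := s) hL hs hj
    right; right
    refine ⟨i, j, ?_, Or.inr ⟨⟨by linarith, le_rfl, hD1, hD2.trans hk2⟩, hiC, ?_, ?_, ?_⟩⟩
    · rintro rfl; exact hinear hj
    · have h5 : D ^ (s - 1 / 2) ≤ 100000 * (1 + |pos L (p j) - k * η|) ^ (s - 1 / 2) :=
        rpow_le_mul_rpow (by norm_num) (by linarith) (by positivity) (by linarith [hj' η hη])
          (by linarith) (by linarith)
      have h6 : D ^ (1 / 2 : ℝ) ≤ D ^ (s - 1 / 2) :=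
        Real.rpow_le_rpow_of_exponent_le (by linarith) (by linarith)
      have h7 : (1 + |pos L (p j) - k * η|) ^ (s - 1 / 2) ≤ 3 * mult s L κ (p j) :=
        hητ.trans (by gcongr; linarith [hm j])
      linarith [hm j]
    · have h5 := abs_pos_le_of_near hL hj
      have h6 := abs_sub_abs_le_abs_sub (pos L (p i)) (pos L (p j))
      linarith
    · rw [div_self hk0.ne', Real.one_rpow, mul_one]
      refine hout.trans ?_
      have : 0 ≤ k ^ (s - 1 / 2) * D ^ (1 / 2 : ℝ) := by positivity
      linarith

/-- Either the multiplier of the output is dominated by that of an input, or the phase is large, or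
there is a good pair of slots. -/
theorem exists_trichotomy (hs : 1 < s) (hs' : s ≤ 3 / 2) :
    ∃ C : ℝ, 1 ≤ C ∧ ∀ (L κ : ℕ), 0 < L → ∀ p : Fin 5 → ℤ,
      (∃ i, mult s L κ (out p) ≤ C * mult s L κ (p i)) ∨
      (100 ≤ waveNumber L κ ∧
        ((waveNumber L κ ^ 2 ≤ |phase L p (out p)| ∧
            mult s L κ (out p) ≤ C * waveNumber L κ ^ s) ∨
          ∃ i j, i ≠ j ∧
            (PairCond s C L κ (cappedExcess L κ (out p)) (waveNumber L κ ^ (s - 1 / 2)) p i j ∨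
              PairCond s C L κ (waveNumber L κ)
                (cappedExcess L κ (out p) ^ (1 / 2 : ℝ)) p i j))) := by
  refine ⟨100000000000000000000, by norm_num, fun L κ hL p => ?_⟩
  obtain ⟨i, hi, hi5⟩ := exists_max_slot L p
  have hm := fun l => one_le_mult (s := s) (L := L) (κ := κ) (n := p l) hs
  have hb := one_le_bracket (pos L (p i))
  have hk0 := waveNumber_nonneg L κ
  -- For bounded `k` the multiplier is comparable to the Sobolev weight, and a largest input
  -- dominates.
  rcases lt_or_ge (waveNumber L κ) 100 with hk | hk
  · left
    refine ⟨i, ?_⟩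
    have h1 := rpow_bracket_le_mult_of_bounded (n := p i) hs hs' hL (by norm_num) hk.le
    have h2 := mult_out_le_of_dominated hs hs' hL hi5 (K₀ := 101) (by norm_num) (by
      have := bracket_le (waveNumber L κ)
      rw [abs_of_nonneg hk0] at this
      nlinarith) h1
    refine h2.trans ?_
    have := hm i
    gcongr
    norm_num
  by_cases hhigh : 100 * waveNumber L κ ≤ |pos L (p i)|
  · left
    refine ⟨i, ?_⟩
    have h1 := rpow_bracket_le_mult (n := p i) hs hs' hL (by linarith) hhigh
    have h2 := mult_out_le_of_dominated hs hs' hL hi5 (K₀ := 2) (by norm_num) (by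
      have := bracket_waveNumber_le (L := L) (κ := κ) (by linarith)
      have := abs_le_bracket (pos L (p i))
      linarith) h1
    refine h2.trans ?_
    have := hm i
    gcongr
    norm_num
  push Not at hhigh
  have hin : ∀ l, |pos L (p l)| < 100 * waveNumber L κ := fun l => (hi l).trans_lt hhigh
  have hup := mult_le_of_le (n := out p) hs hs' hL (by linarith) (by linarith)
  have hKk : bracket (waveNumber L κ) ^ (s - 1 / 2) ≤ 2 * waveNumber L κ ^ (s - 1 / 2) :=
    rpow_le_mul_rpow (by norm_num) (bracket_pos _).le hk0 (bracket_waveNumber_le (by linarith))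
      (by linarith) (by linarith)
  have hks : 0 < waveNumber L κ ^ (s - 1 / 2) := Real.rpow_pos_of_pos (by linarith) _
  have hkk : waveNumber L κ ^ (s - 1 / 2) * waveNumber L κ ^ (1 / 2 : ℝ) = waveNumber L κ ^ s := by
    rw [← Real.rpow_add (by linarith)]; congr 1; ring
  have hk2 : 1 ≤ waveNumber L κ ^ (1 / 2 : ℝ) := Real.one_le_rpow (by linarith) (by norm_num)
  have hd := excess_nonneg L κ (out p)
  rcases lt_or_ge (excess L κ (out p)) 100 with hex | hex
  · have h1 : mult s L κ (out p) ≤ 10000000000 * waveNumber L κ ^ (s - 1 / 2) := by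
      refine hup.trans ?_
      have h2 : (1 + excess L κ (out p)) ^ (1 / 2 : ℝ) ≤ 11 := by
        rw [← Real.sqrt_eq_rpow]
        exact Real.sqrt_le_iff.2 ⟨by norm_num, by linarith⟩
      have h3 := mul_le_mul hKk h2 (by positivity) (by positivity)
      linarith
    rcases trichotomy_of_small_excess hs hs' hL hk h1 with h | h
    · exact Or.inl h
    · refine Or.inr ⟨hk, Or.inl ⟨h, h1.trans ?_⟩⟩
      rw [← hkk]
      have := mul_le_mul_of_nonneg_left hk2 hks.le
      linarith
  · have hc : excess L κ (out p) ≤ 500 * cappedExcess L κ (out p) := by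
      unfold cappedExcess
      have h2 : excess L κ (out p) ≤ 500 * waveNumber L κ := max_le (by linarith) (by linarith)
      rcases min_cases (waveNumber L κ) (excess L κ (out p)) with ⟨h, -⟩ | ⟨h, -⟩ <;> rw [h] <;>
        linarith
    have hc1 : 100 ≤ cappedExcess L κ (out p) := le_min hk hex
    have hc0 : 0 ≤ cappedExcess L κ (out p) := by linarith
    have h1 : mult s L κ (out p) ≤ 200000000000 *
        (waveNumber L κ ^ (s - 1 / 2) * cappedExcess L κ (out p) ^ (1 / 2 : ℝ)) := by
      have h2 : (1 + excess L κ (out p)) ^ (1 / 2 : ℝ)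
          ≤ 501 * cappedExcess L κ (out p) ^ (1 / 2 : ℝ) :=
        rpow_le_mul_rpow (by norm_num) (by linarith) hc0 (by linarith) (by norm_num) (by norm_num)
      have h3 := mul_le_mul hKk h2 (by positivity) (by positivity)
      have h4 : 0 ≤ waveNumber L κ ^ (s - 1 / 2) * cappedExcess L κ (out p) ^ (1 / 2 : ℝ) := by
        positivity
      linarith
    rcases trichotomy_of_large_excess hs hs' hL hk hin hex h1 with h | h | h
    · exact Or.inl h
    · refine Or.inr ⟨hk, Or.inl ⟨h, h1.trans ?_⟩⟩
      have h2 : cappedExcess L κ (out p) ^ (1 / 2 : ℝ) ≤ waveNumber L κ ^ (1 / 2 : ℝ) :=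
        Real.rpow_le_rpow hc0 (min_le_left _ _) (by norm_num)
      have := mul_le_mul_of_nonneg_left h2 hks.le
      have : 0 ≤ waveNumber L κ ^ s := by positivity
      rw [← hkk] at *
      linarith
    · exact Or.inr ⟨hk, Or.inr h⟩

end QuinticNLS

namespace QuinticNLS

open scoped ENNReal

/-! ### Estimates for the resonant and the non-resonant sums -/

/-- The separation of the frequencies in the two kinds of good pairs. -/
noncomputable def gap (e : Bool) (L κ : ℕ) (n : ℤ) : ℝ :=
  if e then cappedExcess L κ n else waveNumber L κ

/-- The lower bound for the second multiplier in the two kinds of good pairs. -/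
noncomputable def gain (e : Bool) (s : ℝ) (L κ : ℕ) (n : ℤ) : ℝ :=
  if e then waveNumber L κ ^ (s - 1 / 2) else cappedExcess L κ n ^ (1 / 2 : ℝ)

/-- Quintuples with a good pair of slots. -/
def GoodPair (s C : ℝ) (L κ : ℕ) (x : Fin 5 × Fin 4 × Bool) (p : Fin 5 → ℤ) : Prop :=
  PairCond s C L κ (gap x.2.2 L κ (out p)) (gain x.2.2 s L κ (out p)) p x.1 (x.1.succAbove x.2.1)

/-- The statement of the trichotomy with constant `C`. -/
def Trichotomy (s C : ℝ) : Prop :=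
  1 ≤ C ∧ ∀ (L κ : ℕ), 0 < L → ∀ p : Fin 5 → ℤ,
      (∃ i, mult s L κ (out p) ≤ C * mult s L κ (p i)) ∨
      (100 ≤ waveNumber L κ ∧
        ((waveNumber L κ ^ 2 ≤ |phase L p (out p)| ∧
            mult s L κ (out p) ≤ C * waveNumber L κ ^ s) ∨ ∃ x, GoodPair s C L κ x p))

theorem exists_trichotomy_constant {s : ℝ} (hs : 1 < s) (hs' : s ≤ 3 / 2) :
    ∃ C, Trichotomy s C := by
  obtain ⟨C, hC, h⟩ := exists_trichotomy hs hs'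
  refine ⟨C, hC, fun L κ hL p => ?_⟩
  rcases h L κ hL p with h | ⟨hk, h | ⟨i, j, hij, h⟩⟩
  · exact Or.inl h
  · exact Or.inr ⟨hk, Or.inl h⟩
  · obtain ⟨j', rfl⟩ := Fin.exists_succAbove_eq hij.symm
    rcases h with h | h
    · exact Or.inr ⟨hk, Or.inr ⟨(i, j', true), h⟩⟩
    · exact Or.inr ⟨hk, Or.inr ⟨(i, j', false), h⟩⟩

/-- Quintuples whose contribution is estimated without integrating by parts. -/
def Tame (s C : ℝ) (L κ : ℕ) (p : Fin 5 → ℤ) : Prop :=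
  (∃ i, mult s L κ (out p) ≤ C * mult s L κ (p i)) ∨
    (100 ≤ waveNumber L κ ∧ (∃ x, GoodPair s C L κ x p) ∧
      |phase L p (out p)| ≤ waveNumber L κ)

/-- The multiplier capped at `k^{s-1/2}`. -/
noncomputable def cappedMult (s : ℝ) (L κ : ℕ) (n : ℤ) : ℝ :=
  min (mult s L κ n) (waveNumber L κ ^ (s - 1 / 2))

open Classical in
/-- The kernel of a good pair. -/
noncomputable def pairKernel (s C : ℝ) (L κ : ℕ) (x : Fin 5 × Fin 4 × Bool) (p : Fin 5 → ℤ) : ℝ :=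
  if GoodPair s C L κ x p then
    C ^ 3 * (Real.sqrt (gap x.2.2 L κ (out p) / waveNumber L κ)
      * Real.sqrt (2 / (1 + (phase L p (out p) / waveNumber L κ) ^ 2)))
  else 0

variable {s C : ℝ} {L κ : ℕ}

theorem pairKernel_nonneg (hC : 1 ≤ C) (x : Fin 5 × Fin 4 × Bool) (p : Fin 5 → ℤ) :
    0 ≤ pairKernel s C L κ x p := by
  unfold pairKernel; split_ifs <;> positivity

/-- Both lower bounds in a good pair are at most of order `k^(s-1/2)`, so they survive the cap. The
cap matters later: a differentiated factor is controlled in `ℓ²` only without the full weight. -/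
theorem mult_le_of_goodPair (hC : 1 ≤ C) (hk : 0 < waveNumber L κ)
    {x : Fin 5 × Fin 4 × Bool} {p : Fin 5 → ℤ} (h : GoodPair s C L κ x p) :
    mult s L κ (out p) ≤ C ^ 3 * Real.sqrt (gap x.2.2 L κ (out p) / waveNumber L κ)
      * (cappedMult s L κ (p x.1) * cappedMult s L κ (p (x.1.succAbove x.2.1))) := by
  obtain ⟨⟨hδ1, hδk, hβ1, hβ⟩, hi, hj, -, hm⟩ := h
  set k := waveNumber L κ
  set δ := gap x.2.2 L κ (out p)
  set β := gain x.2.2 s L κ (out p)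
  have hks : 0 < k ^ (s - 1 / 2) := by positivity
  have hi' : k ^ (s - 1 / 2) ≤ C * cappedMult s L κ (p x.1) := by
    unfold cappedMult
    rw [mul_min_of_nonneg _ _ (by linarith)]
    exact le_min hi (by nlinarith)
  have hj' : β ≤ C * cappedMult s L κ (p (x.1.succAbove x.2.1)) := by
    unfold cappedMult
    rw [mul_min_of_nonneg _ _ (by linarith)]
    exact le_min hj (hβ.trans (by nlinarith))
  have h1 : k ^ (s - 1 / 2) * β ≤ (C * cappedMult s L κ (p x.1))
      * (C * cappedMult s L κ (p (x.1.succAbove x.2.1))) :=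
    mul_le_mul hi' hj' (by linarith) (hks.le.trans hi')
  have hδ0 : 0 < δ := by linarith
  have h2 : Real.sqrt (δ / k) * (k / δ) ^ (1 / 2 : ℝ) = 1 := by
    rw [← Real.sqrt_eq_rpow, ← Real.sqrt_mul (by positivity)]
    rw [show δ / k * (k / δ) = 1 by field_simp, Real.sqrt_one]
  have h3 : 0 ≤ Real.sqrt (δ / k) := Real.sqrt_nonneg _
  calc mult s L κ (out p)
      = (mult s L κ (out p) * (k / δ) ^ (1 / 2 : ℝ)) * Real.sqrt (δ / k) := by
        rw [mul_assoc, mul_comm _ (Real.sqrt _), h2, mul_one]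
    _ ≤ (C * ((C * cappedMult s L κ (p x.1))
      * (C * cappedMult s L κ (p (x.1.succAbove x.2.1))))) * Real.sqrt (δ / k) := by
        refine mul_le_mul_of_nonneg_right (hm.trans ?_) h3
        gcongr
    _ = _ := by ring

/-- For phase at most `k` the factor `2 / (1 + (φ/k)²)` in the kernel is at least `1`, so it can be
inserted for free. -/
theorem tame_mult_le (hT : Trichotomy s C) (hs : 1 < s) {p : Fin 5 → ℤ} (h : Tame s C L κ p) :
    mult s L κ (out p) ≤ ∑ i, C * mult s L κ (p i) + ∑ x : Fin 5 × Fin 4 × Bool,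
      pairKernel s C L κ x p
        * (cappedMult s L κ (p x.1) * cappedMult s L κ (p (x.1.succAbove x.2.1))) := by
  have hC := hT.1
  have hw : ∀ n, 0 ≤ cappedMult s L κ n := fun n =>
    le_min (mult_pos hs).le (Real.rpow_nonneg (waveNumber_nonneg L κ) _)
  have h1 : ∀ i, 0 ≤ C * mult s L κ (p i) := fun i => mul_nonneg (by linarith) (mult_pos hs).le
  have h2 : ∀ x : Fin 5 × Fin 4 × Bool, 0 ≤ pairKernel s C L κ x p
        * (cappedMult s L κ (p x.1) * cappedMult s L κ (p (x.1.succAbove x.2.1))) := fun x =>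
    mul_nonneg (pairKernel_nonneg hC x p) (mul_nonneg (hw _) (hw _))
  rcases h with ⟨i, hi⟩ | ⟨hk, ⟨x, hx⟩, hp⟩
  · refine (hi.trans ?_).trans (le_add_of_nonneg_right (Finset.sum_nonneg fun x _ => h2 x))
    exact Finset.single_le_sum (f := fun i => C * mult s L κ (p i)) (fun i _ => h1 i)
      (Finset.mem_univ i)
  · refine le_trans ?_ (le_add_of_nonneg_left (Finset.sum_nonneg fun i _ => h1 i))
    refine le_trans ?_ (Finset.single_le_sum (fun x _ => h2 x) (Finset.mem_univ x))
    refine (mult_le_of_goodPair hC (by linarith) hx).trans ?_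
    refine mul_le_mul_of_nonneg_right ?_ (mul_nonneg (hw _) (hw _))
    rw [pairKernel, if_pos hx]
    have : 1 ≤ Real.sqrt (2 / (1 + (phase L p (out p) / waveNumber L κ) ^ 2)) := by
      rw [Real.one_le_sqrt, one_le_div (by positivity)]
      have : (phase L p (out p) / waveNumber L κ) ^ 2 ≤ 1 := by
        rw [sq_le_one_iff_abs_le_one, abs_div, abs_of_pos (by linarith : 0 < waveNumber L κ)]
        exact (div_le_one (by linarith)).2 hp
      linarith
    gcongr
    exact le_mul_of_one_le_right (Real.sqrt_nonneg _) this

theorem not_tame_data (hT : Trichotomy s C) (hL : 0 < L) {p : Fin 5 → ℤ}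
    (h : ¬ Tame s C L κ p) : 100 ≤ waveNumber L κ ∧ waveNumber L κ < |phase L p (out p)| := by
  rcases hT.2 L κ hL p with h1 | ⟨hk, ⟨h1, -⟩ | h1⟩
  · exact absurd (Or.inl h1) h
  · exact ⟨hk, by nlinarith⟩
  · refine ⟨hk, ?_⟩
    by_contra h2
    exact h (Or.inr ⟨hk, h1, not_lt.1 h2⟩)

/-- Phase at least `k²` gives `k^s / k²`. For a good pair `|φ| > k`, and then `1/|φ|` is at most
`1/k` times the square root in the kernel; hence the numerator `2`. -/
theorem not_tame_mult_le (hT : Trichotomy s C) (hs : 1 < s) (hL : 0 < L) {p : Fin 5 → ℤ}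
    (h : ¬ Tame s C L κ p) :
    mult s L κ (out p) / |phase L p (out p)| ≤ C * waveNumber L κ ^ (s - 2)
      + ∑ x : Fin 5 × Fin 4 × Bool, 1 / waveNumber L κ * pairKernel s C L κ x p
        * (cappedMult s L κ (p x.1) * cappedMult s L κ (p (x.1.succAbove x.2.1))) := by
  have hC := hT.1
  have hw : ∀ n, 0 ≤ cappedMult s L κ n := fun n =>
    le_min (mult_pos hs).le (Real.rpow_nonneg (waveNumber_nonneg L κ) _)
  obtain ⟨hk, hp⟩ := not_tame_data hT hL h
  have hk0 : 0 < waveNumber L κ := by linarith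
  have h2 : ∀ x : Fin 5 × Fin 4 × Bool, 0 ≤ 1 / waveNumber L κ * pairKernel s C L κ x p
        * (cappedMult s L κ (p x.1) * cappedMult s L κ (p (x.1.succAbove x.2.1))) := fun x =>
    mul_nonneg (mul_nonneg (by positivity) (pairKernel_nonneg hC x p)) (mul_nonneg (hw _) (hw _))
  rcases hT.2 L κ hL p with h1 | ⟨-, ⟨h1, h3⟩ | ⟨x, hx⟩⟩
  · exact absurd (Or.inl h1) h
  · refine le_trans ?_ (le_add_of_nonneg_right (Finset.sum_nonneg fun x _ => h2 x))
    calc mult s L κ (out p) / |phase L p (out p)|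
        ≤ C * waveNumber L κ ^ s / waveNumber L κ ^ 2 := by gcongr
      _ = _ := by
        rw [mul_div_assoc, ← Real.rpow_natCast, ← Real.rpow_sub hk0]; norm_num
  · refine le_trans ?_ (le_add_of_nonneg_left (by positivity))
    refine le_trans ?_ (Finset.single_le_sum (fun x _ => h2 x) (Finset.mem_univ x))
    rw [div_le_iff₀ (hk0.trans hp)]
    refine (mult_le_of_goodPair hC hk0 hx).trans ?_
    rw [pairKernel, if_pos hx]
    have h4 : 1 ≤ 1 / waveNumber L κ * |phase L p (out p)|
        * Real.sqrt (2 / (1 + (phase L p (out p) / waveNumber L κ) ^ 2)) := by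
      obtain ⟨z, hz⟩ : ∃ z, z = |phase L p (out p)| / waveNumber L κ := ⟨_, rfl⟩
      have hz1 : 1 < z := by rw [hz]; exact (one_lt_div hk0).2 hp
      have hz2 : (phase L p (out p) / waveNumber L κ) ^ 2 = z ^ 2 := by
        rw [hz, div_pow, div_pow, sq_abs]
      rw [hz2, one_div_mul_eq_div, ← hz]
      calc 1 ≤ Real.sqrt (z ^ 2 * (2 / (1 + z ^ 2))) := by
            rw [Real.one_le_sqrt, mul_div_assoc', le_div_iff₀ (by positivity)]
            nlinarith
        _ = _ := by rw [Real.sqrt_mul (by positivity), Real.sqrt_sq (by linarith)]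
    have h5 : 0 ≤ C ^ 3 * Real.sqrt (gap x.2.2 L κ (out p) / waveNumber L κ)
      * (cappedMult s L κ (p x.1) * cappedMult s L κ (p (x.1.succAbove x.2.1))) :=
      mul_nonneg (by positivity) (mul_nonneg (hw _) (hw _))
    calc _ ≤ C ^ 3 * Real.sqrt (gap x.2.2 L κ (out p) / waveNumber L κ)
      * (cappedMult s L κ (p x.1) * cappedMult s L κ (p (x.1.succAbove x.2.1)))
        * (1 / waveNumber L κ * |phase L p (out p)|
        * Real.sqrt (2 / (1 + (phase L p (out p) / waveNumber L κ) ^ 2))) :=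
          le_mul_of_one_le_right h5 h4
      _ = _ := by ring

/-- The squared kernel carries `δ/k` and the fibre sum contributes `L k / δ` up to constants, so the
dependence on `δ` and `k` cancels. On a fibre the output is fixed, hence so is `δ`. -/
theorem pairKernel_fiber (hC : 1 ≤ C) (hL : 0 < L) (hk : 0 < waveNumber L κ)
    (x : Fin 5 × Fin 4 × Bool) (n : ℤ) (q : Fin 3 → ℤ) :
    ∑' p : {p : hyperplane n // x.2.1.removeNth (x.1.removeNth (p : Fin 5 → ℤ)) = q},
      ENNReal.ofReal (pairKernel s C L κ x p) ^ 2 ≤ ENNReal.ofReal (20 * C ^ 7 * L) := by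
  classical
  by_cases hgap : 1 ≤ gap x.2.2 L κ n ∧ gap x.2.2 L κ n ≤ waveNumber L κ
  · obtain ⟨hg1, hgk⟩ := hgap
    have h := tsum_fiber_le hL x.1 x.2.1 n q (δ := gap x.2.2 L κ n / C) (k := waveNumber L κ)
      (by positivity) hk ((div_le_self (by linarith) hC).trans hgk) (GoodPair s C L κ x)
      (fun p hp hP => by
        rw [div_le_iff₀ (by linarith), mul_comm, ← hp]
        exact hP.2.2.2.1)
    calc ∑' p : {p : hyperplane n // x.2.1.removeNth (x.1.removeNth (p : Fin 5 → ℤ)) = q},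
          ENNReal.ofReal (pairKernel s C L κ x p) ^ 2
        ≤ ∑' p : {p : hyperplane n // x.2.1.removeNth (x.1.removeNth (p : Fin 5 → ℤ)) = q},
          ENNReal.ofReal (2 * C ^ 6 * (gap x.2.2 L κ n / waveNumber L κ))
          * (if GoodPair s C L κ x p then
            ENNReal.ofReal (1 / (1 + (phase L p n / waveNumber L κ) ^ 2)) else 0) := by
          refine ENNReal.tsum_le_tsum fun p => ?_
          rw [← ENNReal.ofReal_pow (pairKernel_nonneg hC _ _)]
          split_ifs with hp
          · rw [← ENNReal.ofReal_mul (by positivity), pairKernel, if_pos hp, out_of_mem p.1]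
            refine ENNReal.ofReal_le_ofReal (le_of_eq ?_)
            rw [mul_pow, mul_pow, Real.sq_sqrt (by positivity), Real.sq_sqrt (by positivity)]
            ring
          · simp [pairKernel, if_neg hp]
      _ ≤ ENNReal.ofReal (2 * C ^ 6 * (gap x.2.2 L κ n / waveNumber L κ))
          * ENNReal.ofReal (10 * (L * waveNumber L κ / (gap x.2.2 L κ n / C))) := by
          rw [ENNReal.tsum_mul_left]
          gcongr
      _ = _ := by
          rw [← ENNReal.ofReal_mul (by positivity)]
          congr 1
          field_simp
          ring
  · refine le_trans (le_of_eq ?_) zero_le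
    rw [ENNReal.tsum_eq_zero]
    intro p
    have : ¬ GoodPair s C L κ x p := fun h => hgap (by
      have := h.1
      rw [out_of_mem p.1] at this
      exact ⟨this.1, this.2.1⟩)
    simp [pairKernel, if_neg this]

end QuinticNLS

namespace QuinticNLS

open scoped ENNReal

variable {s C : ℝ} {L κ : ℕ}

/-! ### Weighted multilinear bounds for tame and non-tame sums -/

theorem sum_sq_le_card_mul {ι : Type*} [Fintype ι] (y : ι → ℝ≥0∞) :
    (∑ x, y x) ^ 2 ≤ Fintype.card ι * ∑ x, y x ^ 2 := by
  have := tsum_mul_sq_le (fun _ : ι => 1) y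
  simpa [tsum_fintype] using this

theorem tsum_sq_sum_le {ι : Type*} [Fintype ι] (F : ι → ℤ → ℝ≥0∞) (B : ℝ≥0∞)
    (h : ∀ x, ∑' n, F x n ^ 2 ≤ B) :
    ∑' n, (∑ x, F x n) ^ 2 ≤ (Fintype.card ι : ℝ≥0∞) ^ 2 * B := by
  calc ∑' n, (∑ x, F x n) ^ 2 ≤ ∑' n, (Fintype.card ι : ℝ≥0∞) * ∑ x, F x n ^ 2 :=
        ENNReal.tsum_le_tsum fun n => sum_sq_le_card_mul _
    _ = Fintype.card ι * ∑ x, ∑' n, F x n ^ 2 := by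
        rw [ENNReal.tsum_mul_left, Summable.tsum_finsetSum fun _ _ => ENNReal.summable]
    _ ≤ Fintype.card ι * ∑ _x : ι, B := by gcongr; exact h _
    _ = _ := by simp; ring

theorem add_sq_le_two_mul (a b : ℝ≥0∞) : (a + b) ^ 2 ≤ 2 * (a ^ 2 + b ^ 2) := by
  have := sum_sq_le_card_mul ![a, b]
  simpa using this

theorem tsum_add_sq_le (F G : ℤ → ℝ≥0∞) :
    ∑' n, (F n + G n) ^ 2 ≤ 2 * (∑' n, F n ^ 2 + ∑' n, G n ^ 2) := by
  rw [← ENNReal.tsum_add, ← ENNReal.tsum_mul_left]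
  exact ENNReal.tsum_le_tsum fun n => add_sq_le_two_mul _ _

/-- The estimate with one slot in `ℓ²` and four in `ℓ¹`, in terms of normalized bounds. -/
theorem one_slot_bound (i : Fin 5) (f : Fin 5 → ℤ → ℝ≥0∞) (v : ℤ → ℝ≥0∞) (A : ℝ≥0∞)
    (X : Fin 5 → ℝ≥0∞) (h1 : ∀ l, (∑' m, f l m) ^ 2 ≤ L ^ 2 * X l)
    (h2 : ∑' m, (v m * f i m) ^ 2 ≤ L * X i) :
    ∑' n : ℤ, (∑' p : hyperplane n, A * (v ((p : Fin 5 → ℤ) i) * ∏ l, f l ((p : Fin 5 → ℤ) l))) ^ 2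
      ≤ A ^ 2 * (L ^ 9 * ∏ l, X l) := by
  have h := tsum_sq_le_one_slot i (fun l n => (if l = i then v n else 1) * f l n)
    (fun _ => A) (A ^ 2) (fun _ => le_rfl)
  simp only [Finset.prod_mul_distrib, Finset.prod_ite_eq', Finset.mem_univ, if_true,
    Fin.succAbove_ne, if_false, one_mul] at h
  refine h.trans ?_
  have h3 : (∏ l : Fin 4, ∑' m, f (i.succAbove l) m) ^ 2
      ≤ ∏ l : Fin 4, (L ^ 2 * X (i.succAbove l)) := by
    rw [← Finset.prod_pow]
    exact Finset.prod_le_prod' fun l _ => h1 _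
  calc _ ≤ A ^ 2 * (L * X i) * ∏ l : Fin 4, (L ^ 2 * X (i.succAbove l)) := by gcongr
    _ = _ := by
      rw [Fin.prod_univ_succAbove X i, Finset.prod_mul_distrib]
      simp
      ring

/-- The estimate with two slots in `ℓ²` and three in `ℓ¹`, in terms of normalized bounds. -/
theorem two_slot_bound (i : Fin 5) (j : Fin 4) (f : Fin 5 → ℤ → ℝ≥0∞) (v : ℤ → ℝ≥0∞)
    (K : (Fin 5 → ℤ) → ℝ≥0∞) (A : ℝ≥0∞)
    (hK : ∀ (n : ℤ) (q : Fin 3 → ℤ),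
      ∑' p : {p : hyperplane n // j.removeNth (i.removeNth (p : Fin 5 → ℤ)) = q}, K p ^ 2 ≤ A * L)
    (X Λ : Fin 5 → ℝ≥0∞) (h1 : ∀ l, (∑' m, f l m) ^ 2 ≤ L ^ 2 * X l)
    (h2 : ∀ l, ∑' m, (v m * f l m) ^ 2 ≤ L * (X l * Λ l)) :
    ∑' n : ℤ, (∑' p : hyperplane n, K p * (v ((p : Fin 5 → ℤ) i)
        * v ((p : Fin 5 → ℤ) (i.succAbove j)) * ∏ l, f l ((p : Fin 5 → ℤ) l))) ^ 2
      ≤ A * (L ^ 9 * ∏ l, X l) * (Λ i * Λ (i.succAbove j)) := by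
  have h := tsum_sq_le_two_slots i j
    (fun l n => (if l = i then v n else 1) * (if l = i.succAbove j then v n else 1) * f l n)
    K (A * L) hK
  have e1 : ∀ l : Fin 3, i.succAbove (j.succAbove l) ≠ i.succAbove j := fun l h =>
    Fin.succAbove_ne _ _ (Fin.succAbove_right_injective h)
  have e2 : i ≠ i.succAbove j := (Fin.succAbove_ne _ _).symm
  simp only [Finset.prod_mul_distrib, Finset.prod_ite_eq', Finset.mem_univ, if_true,
    Fin.succAbove_ne, if_false, one_mul, mul_one, e1, e2] at h
  refine h.trans ?_
  have h3 : (∏ l : Fin 3, ∑' m, f (i.succAbove (j.succAbove l)) m) ^ 2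
      ≤ ∏ l : Fin 3, (L ^ 2 * X (i.succAbove (j.succAbove l))) := by
    rw [← Finset.prod_pow]
    exact Finset.prod_le_prod' fun l _ => h1 _
  calc _ ≤ A * L * (L * (X i * Λ i)) * (L * (X (i.succAbove j) * Λ (i.succAbove j)))
        * ∏ l : Fin 3, (L ^ 2 * X (i.succAbove (j.succAbove l))) := by
        gcongr
        · exact h2 _
        · exact h2 _
    _ = _ := by
      rw [Fin.prod_univ_succAbove X i, Fin.prod_univ_succAbove _ j, Finset.prod_mul_distrib]
      simp
      ring

/-- The multiplier as an extended non-negative real. -/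
noncomputable def emult (s : ℝ) (L κ : ℕ) (n : ℤ) : ℝ≥0∞ := ENNReal.ofReal (mult s L κ n)

/-- The capped multiplier as an extended non-negative real. -/
noncomputable def ecapped (s : ℝ) (L κ : ℕ) (n : ℤ) : ℝ≥0∞ := ENNReal.ofReal (cappedMult s L κ n)

theorem ecapped_le_emult (n : ℤ) : ecapped s L κ n ≤ emult s L κ n :=
  ENNReal.ofReal_le_ofReal (min_le_left _ _)

theorem tsum_mul_sum {ι α : Type*} [Fintype ι] (g : ι → α → ℝ≥0∞) :
    ∑' p, ∑ x, g x p = ∑ x, ∑' p, g x p :=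
  Summable.tsum_finsetSum fun _ _ => ENNReal.summable

theorem cappedMult_nonneg (hs : 1 < s) (n : ℤ) : 0 ≤ cappedMult s L κ n :=
  le_min (mult_pos hs).le (Real.rpow_nonneg (waveNumber_nonneg L κ) _)

theorem pair_sum_bound (hC : 1 ≤ C) (hL : 0 < L) (hk : 0 < waveNumber L κ)
    (x : Fin 5 × Fin 4 × Bool) (f : Fin 5 → ℤ → ℝ≥0∞) (b : ℝ≥0∞)
    (X Λ : Fin 5 → ℝ≥0∞) (h1 : ∀ l, (∑' m, f l m) ^ 2 ≤ L ^ 2 * X l)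
    (h2 : ∀ l, ∑' m, (ecapped s L κ m * f l m) ^ 2 ≤ L * (X l * Λ l)) (Λ' : ℝ≥0∞)
    (hΛ : ∀ i j, i ≠ j → Λ i * Λ j ≤ Λ') :
    ∑' n : ℤ, (∑' p : hyperplane n, b * ENNReal.ofReal (pairKernel s C L κ x p)
        * (ecapped s L κ ((p : Fin 5 → ℤ) x.1)
        * ecapped s L κ ((p : Fin 5 → ℤ) (x.1.succAbove x.2.1)) * ∏ l, f l ((p : Fin 5 → ℤ) l))) ^ 2
      ≤ b ^ 2 * ENNReal.ofReal (20 * C ^ 7) * (L ^ 9 * ∏ l, X l) * Λ' := by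
  refine (two_slot_bound x.1 x.2.1 f (ecapped s L κ)
    (fun p => b * ENNReal.ofReal (pairKernel s C L κ x p))
    (b ^ 2 * ENNReal.ofReal (20 * C ^ 7)) (fun n q => ?_) X Λ h1 h2).trans ?_
  · simp only [mul_pow, ENNReal.tsum_mul_left, mul_assoc (b ^ 2)]
    gcongr
    refine (pairKernel_fiber hC hL hk x n q).trans (le_of_eq ?_)
    rw [ENNReal.ofReal_mul (by positivity), ENNReal.ofReal_natCast]
  · gcongr
    exact hΛ _ _ (Fin.succAbove_ne _ _).symm

-- The pointwise bound of the multiplier splits the sum into terms where one input carries `m`,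
-- estimated by Young's inequality, and terms where a pair carries the capped multipliers. The power
-- `L^9` comes from four `ℓ¹` slots and one `ℓ²` slot in the first kind, and from three and two plus
-- the fibre factor `L` in the second.
open Classical in
theorem tame_bound (hT : Trichotomy s C) (hs : 1 < s) (hL : 0 < L) (hκ : 0 < κ)
    (A : ℤ → ℝ≥0∞) (X : ℝ≥0∞) (h1 : (∑' m, A m) ^ 2 ≤ L ^ 2 * X)
    (h2 : ∑' m, (emult s L κ m * A m) ^ 2 ≤ L * X) :
    ∑' n : ℤ, (emult s L κ n * ∑' p : hyperplane n,
        if Tame s C L κ p then ∏ l, A ((p : Fin 5 → ℤ) l) else 0) ^ 2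
      ≤ ENNReal.ofReal (100000 * C ^ 7) * (L ^ 9 * X ^ 5) := by
  have hC := hT.1
  have hk : 0 < waveNumber L κ := by unfold waveNumber; positivity
  have hX : ∏ _l : Fin 5, X = X ^ 5 := by simp
  have key : ∀ n : ℤ, emult s L κ n * ∑' p : hyperplane n,
        (if Tame s C L κ p then ∏ l, A ((p : Fin 5 → ℤ) l) else 0)
      ≤ (∑ i, ∑' p : hyperplane n, ENNReal.ofReal C * (emult s L κ ((p : Fin 5 → ℤ) i)
          * ∏ l, A ((p : Fin 5 → ℤ) l)))
        + ∑ x : Fin 5 × Fin 4 × Bool, ∑' p : hyperplane n,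
          1 * ENNReal.ofReal (pairKernel s C L κ x p) * (ecapped s L κ ((p : Fin 5 → ℤ) x.1)
          * ecapped s L κ ((p : Fin 5 → ℤ) (x.1.succAbove x.2.1))
          * ∏ l, A ((p : Fin 5 → ℤ) l)) := by
    intro n
    rw [← ENNReal.tsum_mul_left, ← tsum_mul_sum, ← tsum_mul_sum, ← ENNReal.tsum_add]
    refine ENNReal.tsum_le_tsum fun p => ?_
    split_ifs with hp
    · have h := ENNReal.ofReal_le_ofReal (tame_mult_le hT hs hp)
      rw [ENNReal.ofReal_add (Finset.sum_nonneg fun i _ => mul_nonneg (by linarith) (mult_pos hs).le)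
        (Finset.sum_nonneg fun x _ => mul_nonneg (pairKernel_nonneg hC x p)
          (mul_nonneg (cappedMult_nonneg hs _) (cappedMult_nonneg hs _))),
        ENNReal.ofReal_sum_of_nonneg fun i _ => mul_nonneg (by linarith) (mult_pos hs).le,
        ENNReal.ofReal_sum_of_nonneg fun x _ => mul_nonneg (pairKernel_nonneg hC x p)
          (mul_nonneg (cappedMult_nonneg hs _) (cappedMult_nonneg hs _)), out_of_mem p] at h
      refine (mul_le_mul_left h _).trans (le_of_eq ?_)
      rw [add_mul, Finset.sum_mul, Finset.sum_mul]
      congr 1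
      · refine Finset.sum_congr rfl fun i _ => ?_
        rw [ENNReal.ofReal_mul (by linarith), emult, mul_assoc]
      · refine Finset.sum_congr rfl fun x _ => ?_
        rw [ENNReal.ofReal_mul (pairKernel_nonneg hC x p),
          ENNReal.ofReal_mul (cappedMult_nonneg hs _), ecapped, ecapped]
        ring
    · rw [mul_zero]; exact zero_le
  have hw : ∑' m, (ecapped s L κ m * A m) ^ 2 ≤ L * (X * 1) := by
    rw [mul_one]
    refine le_trans (ENNReal.tsum_le_tsum fun m => ?_) h2
    gcongr
    exact ecapped_le_emult m
  calc _ ≤ ∑' n : ℤ, (_ + _) ^ 2 := ENNReal.tsum_le_tsum fun n => pow_le_pow_left' (key n) 2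
    _ ≤ 2 * (_ + _) := tsum_add_sq_le _ _
    _ ≤ 2 * ((Fintype.card (Fin 5) : ℝ≥0∞) ^ 2 * (ENNReal.ofReal C ^ 2 * (L ^ 9 * X ^ 5))
        + (Fintype.card (Fin 5 × Fin 4 × Bool) : ℝ≥0∞) ^ 2
          * (ENNReal.ofReal (20 * C ^ 7) * (L ^ 9 * X ^ 5))) := by
        gcongr
        · refine tsum_sq_sum_le _ _ fun i => ?_
          have := one_slot_bound (L := L) i (fun _ => A) (emult s L κ) (ENNReal.ofReal C)
            (fun _ => X) (fun _ => h1) h2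
          rwa [hX] at this
        · refine tsum_sq_sum_le _ _ fun x => ?_
          have := pair_sum_bound hC hL hk x (fun _ => A) 1 (fun _ => X) (fun _ => 1) (fun _ => h1)
            (fun _ => hw) 1 (by simp)
          simpa only [hX, one_pow, one_mul, mul_one] using this
    _ = ENNReal.ofReal (2 * (25 * C ^ 2 + 1600 * (20 * C ^ 7))) * (L ^ 9 * X ^ 5) := by
        have e : ENNReal.ofReal (2 * (25 * C ^ 2 + 1600 * (20 * C ^ 7)))
            = 2 * (25 * ENNReal.ofReal C ^ 2 + 1600 * ENNReal.ofReal (20 * C ^ 7)) := by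
          rw [ENNReal.ofReal_mul (p := 2) (by norm_num),
            ENNReal.ofReal_add (by positivity) (by positivity),
            ENNReal.ofReal_mul (p := 25) (by norm_num), ENNReal.ofReal_mul (p := 1600) (by norm_num),
            ENNReal.ofReal_pow (by linarith)]
          norm_num
        rw [e]
        simp only [Fintype.card_prod, Fintype.card_fin, Fintype.card_bool]
        push_cast
        ring
    _ ≤ _ := by
        have : C ^ 2 ≤ C ^ 7 := pow_le_pow_right₀ hC (by norm_num)
        have : 0 ≤ C ^ 2 := by positivity
        exact mul_le_mul' (ENNReal.ofReal_le_ofReal (by linarith)) le_rfl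

-- The slots have separate bounds because the estimate is used both with five coefficients and with
-- one of them replaced by the right-hand side. `Λ` records the extra cost of the capped weight in a
-- slot; only products over two distinct slots occur.
open Classical in
theorem not_tame_bound (hT : Trichotomy s C) (hs : 1 < s) (hL : 0 < L) (hκ : 0 < κ)
    (f : Fin 5 → ℤ → ℝ≥0∞) (X Λ : Fin 5 → ℝ≥0∞) (h1 : ∀ l, (∑' m, f l m) ^ 2 ≤ L ^ 2 * X l)
    (h0 : ∀ l, ∑' m, f l m ^ 2 ≤ L * X l)
    (h2 : ∀ l, ∑' m, (ecapped s L κ m * f l m) ^ 2 ≤ L * (X l * Λ l)) (Λ' : ℝ≥0∞)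
    (hΛ : ∀ i j, i ≠ j → Λ i * Λ j ≤ Λ') :
    ∑' n : ℤ, (emult s L κ n * ∑' p : hyperplane n,
        if Tame s C L κ p then 0
        else ENNReal.ofReal (1 / |phase L p n|) * ∏ l, f l ((p : Fin 5 → ℤ) l)) ^ 2
      ≤ ENNReal.ofReal (100000 * C ^ 7) * (L ^ 9 * ∏ l, X l) *
        (ENNReal.ofReal (waveNumber L κ ^ (s - 2)) ^ 2
          + ENNReal.ofReal (1 / waveNumber L κ) ^ 2 * Λ') := by
  have hC := hT.1
  have hk : 0 < waveNumber L κ := by unfold waveNumber; positivity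
  have key : ∀ n : ℤ, emult s L κ n * ∑' p : hyperplane n,
        (if Tame s C L κ p then 0
        else ENNReal.ofReal (1 / |phase L p n|) * ∏ l, f l ((p : Fin 5 → ℤ) l))
      ≤ (∑' p : hyperplane n, ENNReal.ofReal (C * waveNumber L κ ^ (s - 2)) *
          ((1 : ℤ → ℝ≥0∞) ((p : Fin 5 → ℤ) 0) * ∏ l, f l ((p : Fin 5 → ℤ) l)))
        + ∑ x : Fin 5 × Fin 4 × Bool, ∑' p : hyperplane n,
          ENNReal.ofReal (1 / waveNumber L κ) * ENNReal.ofReal (pairKernel s C L κ x p)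
          * (ecapped s L κ ((p : Fin 5 → ℤ) x.1)
          * ecapped s L κ ((p : Fin 5 → ℤ) (x.1.succAbove x.2.1))
          * ∏ l, f l ((p : Fin 5 → ℤ) l)) := by
    intro n
    rw [← ENNReal.tsum_mul_left, ← tsum_mul_sum, ← ENNReal.tsum_add]
    refine ENNReal.tsum_le_tsum fun p => ?_
    split_ifs with hp
    · rw [mul_zero]; exact zero_le
    · have h := ENNReal.ofReal_le_ofReal (not_tame_mult_le hT hs hL hp)
      rw [ENNReal.ofReal_add (by positivity)
        (Finset.sum_nonneg fun x _ => mul_nonneg (mul_nonneg (by positivity)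
          (pairKernel_nonneg hC x p))
          (mul_nonneg (cappedMult_nonneg hs _) (cappedMult_nonneg hs _))),
        ENNReal.ofReal_sum_of_nonneg fun x _ => mul_nonneg (mul_nonneg (by positivity)
          (pairKernel_nonneg hC x p))
          (mul_nonneg (cappedMult_nonneg hs _) (cappedMult_nonneg hs _)), out_of_mem p,
        div_eq_mul_one_div, ENNReal.ofReal_mul (mult_pos hs).le] at h
      rw [← mul_assoc, emult]
      refine (mul_le_mul_left h _).trans (le_of_eq ?_)
      rw [add_mul, Finset.sum_mul]
      congr 1
      · simp
      · refine Finset.sum_congr rfl fun x _ => ?_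
        rw [ENNReal.ofReal_mul (mul_nonneg (by positivity) (pairKernel_nonneg hC x p)),
          ENNReal.ofReal_mul (by positivity),
          ENNReal.ofReal_mul (cappedMult_nonneg hs _), ecapped, ecapped]
        ring
  calc _ ≤ ∑' n : ℤ, (_ + _) ^ 2 := ENNReal.tsum_le_tsum fun n => pow_le_pow_left' (key n) 2
    _ ≤ 2 * (_ + _) := tsum_add_sq_le _ _
    _ ≤ 2 * (ENNReal.ofReal (C * waveNumber L κ ^ (s - 2)) ^ 2 * (L ^ 9 * ∏ l, X l)
        + (Fintype.card (Fin 5 × Fin 4 × Bool) : ℝ≥0∞) ^ 2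
          * (ENNReal.ofReal (1 / waveNumber L κ) ^ 2 * ENNReal.ofReal (20 * C ^ 7)
            * (L ^ 9 * ∏ l, X l) * Λ')) := by
        gcongr
        · exact one_slot_bound (L := L) 0 f 1 _ X h1 (by simpa using h0 0)
        · exact tsum_sq_sum_le _ _ fun x => pair_sum_bound hC hL hk x f _ X Λ h1 h2 Λ' hΛ
    _ = (L ^ 9 * ∏ l, X l) * (ENNReal.ofReal (2 * C ^ 2) * ENNReal.ofReal (waveNumber L κ ^ (s - 2)) ^ 2
          + ENNReal.ofReal (2 * 1600 * (20 * C ^ 7))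
            * (ENNReal.ofReal (1 / waveNumber L κ) ^ 2 * Λ')) := by
        have e1 : ENNReal.ofReal (2 * C ^ 2) = 2 * ENNReal.ofReal C ^ 2 := by
          rw [ENNReal.ofReal_mul (p := 2) (by norm_num), ENNReal.ofReal_pow (by linarith)]
          norm_num
        have e2 : ENNReal.ofReal (2 * 1600 * (20 * C ^ 7))
            = 3200 * ENNReal.ofReal (20 * C ^ 7) := by
          rw [ENNReal.ofReal_mul (p := 2 * 1600) (by norm_num)]
          norm_num
        rw [e1, e2, ENNReal.ofReal_mul (p := C) (by linarith)]
        simp only [Fintype.card_prod, Fintype.card_fin, Fintype.card_bool]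
        push_cast
        ring
    _ ≤ (L ^ 9 * ∏ l, X l) * (ENNReal.ofReal (100000 * C ^ 7) * ENNReal.ofReal (waveNumber L κ ^ (s - 2)) ^ 2
          + ENNReal.ofReal (100000 * C ^ 7)
            * (ENNReal.ofReal (1 / waveNumber L κ) ^ 2 * Λ')) := by
        have : C ^ 2 ≤ C ^ 7 := pow_le_pow_right₀ hC (by norm_num)
        have : 0 ≤ C ^ 2 := by positivity
        exact mul_le_mul' le_rfl (add_le_add
          (mul_le_mul' (ENNReal.ofReal_le_ofReal (by linarith)) le_rfl)
          (mul_le_mul' (ENNReal.ofReal_le_ofReal (by linarith)) le_rfl))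
    _ = _ := by ring

end QuinticNLS

namespace QuinticNLS

open scoped ENNReal
open MeasureTheory

/-! ### Integration by parts in time -/

/-- With a bound valued in `[0, ∞]` no integrability has to be assumed: either the right side is
infinite, or it makes the derivative integrable. -/
theorem enorm_sub_le_lintegral_of_hasDerivWithinAt {f f' : ℝ → ℂ} {b : ℝ → ℝ≥0∞} {T t : ℝ}
    (ht : t ∈ Set.Icc (0 : ℝ) T)
    (hf : ∀ x ∈ Set.Icc (0 : ℝ) T, HasDerivWithinAt f (f' x) (Set.Icc (0 : ℝ) T) x)
    (hb : ∀ x ∈ Set.Icc (0 : ℝ) T, ‖f' x‖ₑ ≤ b x) :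
    ‖f t - f 0‖ₑ ≤ ∫⁻ x in Set.Icc 0 t, b x := by
  by_cases hfin : ∫⁻ x in Set.Icc 0 t, b x = ∞
  · rw [hfin]; exact le_top
  have hd : ∀ x ∈ Set.Ioo (0 : ℝ) t, HasDerivAt f (f' x) x := fun x hx =>
    (hf x ⟨hx.1.le, hx.2.le.trans ht.2⟩).hasDerivAt (Icc_mem_nhds hx.1 (hx.2.trans_le ht.2))
  have hle : ∫⁻ x in Set.Ioo 0 t, ‖deriv f x‖ₑ ≤ ∫⁻ x in Set.Icc 0 t, b x := by
    refine le_trans (setLIntegral_mono' measurableSet_Ioo fun x hx => ?_)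
      (lintegral_mono_set Set.Ioo_subset_Icc_self)
    rw [(hd x hx).deriv]
    exact hb x ⟨hx.1.le, hx.2.le.trans ht.2⟩
  have hint : IntegrableOn (deriv f) (Set.Ioo 0 t) := by
    refine ⟨(measurable_deriv f).aestronglyMeasurable, ?_⟩
    exact lt_of_le_of_lt hle (lt_top_iff_ne_top.2 hfin)
  have hint' : IntervalIntegrable (deriv f) volume 0 t := by
    rw [intervalIntegrable_iff_integrableOn_Ioo_of_le ht.1]; exact hint
  have hcont : ContinuousOn f (Set.Icc 0 t) := fun x hx =>
    (hf x ⟨hx.1, hx.2.trans ht.2⟩).continuousWithinAt.mono (Set.Icc_subset_Icc_right ht.2)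
  have h := intervalIntegral.integral_eq_sub_of_hasDerivAt_of_le ht.1 hcont
    (fun x hx => (hd x hx).differentiableAt.hasDerivAt) hint'
  rw [← h, intervalIntegral.integral_of_le ht.1, integral_Ioc_eq_integral_Ioo]
  exact (enorm_integral_le_lintegral_enorm _).trans hle

theorem hasDerivWithinAt_quintic {a : ℝ → ℤ → ℂ} {d : ℤ → ℂ} {S : Set ℝ} {t : ℝ}
    (h : ∀ m, HasDerivWithinAt (fun τ => a τ m) (d m) S t) (p : Fin 5 → ℤ) :
    ∃ q', HasDerivWithinAt (fun τ => quintic (a τ) p) q' S t ∧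
      ‖q'‖ₑ ≤ ∑ i : Fin 5, ∏ l : Fin 5, if l = i then ‖d (p l)‖ₑ else ‖a t (p l)‖ₑ := by
  have hd := (((h (p 0)).mul (h (p 1)).star).mul (h (p 2))).mul (h (p 3)).star |>.mul (h (p 4))
  refine ⟨d (p 0) * star (a t (p 1)) * a t (p 2) * star (a t (p 3)) * a t (p 4)
    + a t (p 0) * star (d (p 1)) * a t (p 2) * star (a t (p 3)) * a t (p 4)
    + a t (p 0) * star (a t (p 1)) * d (p 2) * star (a t (p 3)) * a t (p 4)
    + a t (p 0) * star (a t (p 1)) * a t (p 2) * star (d (p 3)) * a t (p 4)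
    + a t (p 0) * star (a t (p 1)) * a t (p 2) * star (a t (p 3)) * d (p 4),
    hd.congr_deriv (by simp only [Pi.mul_apply]; ring), ?_⟩
  rw [Fin.sum_univ_five]
  refine (enorm_add_le _ _).trans (add_le_add ((enorm_add_le _ _).trans (add_le_add
    ((enorm_add_le _ _).trans (add_le_add ((enorm_add_le _ _).trans (add_le_add ?_ ?_)) ?_)) ?_)) ?_)
  all_goals
    rw [Fin.prod_univ_five]
    simp [enorm_mul]

variable {L κ : ℕ} {T : ℝ} {a : ℝ → ℤ → ℂ}

/-- The product of the moduli in a quintic term. -/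
noncomputable def absQuintic (a : ℝ → ℤ → ℂ) (τ : ℝ) (p : Fin 5 → ℤ) : ℝ≥0∞ :=
  ∏ l, ‖a τ (p l)‖ₑ

/-- A bound for the modulus of the right-hand side of the full system. -/
noncomputable def absRhs (L : ℕ) (a : ℝ → ℤ → ℂ) (τ : ℝ) (n : ℤ) : ℝ≥0∞ :=
  ((L : ℝ≥0∞) ^ 4)⁻¹ * ∑' p : hyperplane n, absQuintic a τ p

/-- A bound for the derivative of the `i`-th factor in a quintic term. -/
noncomputable def absQuinticDeriv (L : ℕ) (a : ℝ → ℤ → ℂ) (i : Fin 5) (τ : ℝ) (p : Fin 5 → ℤ) :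
    ℝ≥0∞ :=
  ∏ l, (if l = i then absRhs L a τ (p l) else ‖a τ (p l)‖ₑ)

theorem enorm_quintic (a : ℝ → ℤ → ℂ) (τ : ℝ) (p : Fin 5 → ℤ) :
    ‖quintic (a τ) p‖ₑ = absQuintic a τ p := by
  have hs : ∀ z : ℂ, ‖star z‖ₑ = ‖z‖ₑ := fun z => by
    rw [← ofReal_norm, ← ofReal_norm, norm_star]
  simp only [quintic, absQuintic, enorm_mul, hs, Fin.prod_univ_five]

theorem enorm_exp_phase (τ φ : ℝ) : ‖Complex.exp (-Complex.I * (τ : ℂ) * (φ : ℂ))‖ₑ = 1 := by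
  rw [← ofReal_norm, show -Complex.I * (τ : ℂ) * (φ : ℂ) = ((-(τ * φ) : ℝ) : ℂ) * Complex.I by
    push_cast; ring, Complex.norm_exp_ofReal_mul_I, ENNReal.ofReal_one]

theorem enorm_fullTerm (a : ℝ → ℤ → ℂ) (τ : ℝ) (n : ℤ) (p : Fin 5 → ℤ) :
    ‖fullTerm L (a τ) τ n p‖ₑ = absQuintic a τ p := by
  rw [fullTerm, enorm_mul, enorm_exp_phase, mul_one, enorm_quintic]

theorem enorm_tsum_le {α : Type*} {f : α → ℂ} (hf : Summable f) : ‖∑' x, f x‖ₑ ≤ ∑' x, ‖f x‖ₑ := by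
  have hn : Summable fun x => ‖f x‖ := hf.norm
  simp only [← ofReal_norm]
  rw [← ENNReal.ofReal_tsum_of_nonneg (fun _ => norm_nonneg _) hn]
  exact ENNReal.ofReal_le_ofReal (norm_tsum_le_tsum_norm hn)

theorem enorm_inv_pow (L : ℕ) (hL : 0 < L) : ‖(1 / (L : ℂ) ^ 4)‖ₑ = ((L : ℝ≥0∞) ^ 4)⁻¹ := by
  have hL' : (0 : ℝ) < L := by exact_mod_cast hL
  rw [← ofReal_norm, norm_div, norm_one, norm_pow, Complex.norm_natCast, one_div,
    ENNReal.ofReal_inv_of_pos (by positivity), ENNReal.ofReal_pow hL'.le, ENNReal.ofReal_natCast]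

theorem enorm_neg_I : ‖-Complex.I‖ₑ = 1 := by
  rw [← ofReal_norm, norm_neg, Complex.norm_I, ENNReal.ofReal_one]

theorem enorm_rhs_le (ha : IsFullSolution L T a) (hL : 0 < L) {τ : ℝ}
    (hτ : τ ∈ Set.Icc (0 : ℝ) T) (n : ℤ) :
    ‖(-Complex.I * ((1 / (L : ℂ) ^ 4) * ∑' p : hyperplane n, fullTerm L (a τ) τ n p))‖ₑ
      ≤ absRhs L a τ n := by
  rw [enorm_mul, enorm_mul, enorm_neg_I, enorm_inv_pow L hL, one_mul, absRhs]
  gcongr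
  refine (enorm_tsum_le (ha τ hτ n).1).trans (le_of_eq (tsum_congr fun p => ?_))
  exact enorm_fullTerm a τ n p

theorem continuousOn_coeff (ha : IsFullSolution L T a) (n : ℤ) :
    ContinuousOn (fun τ => a τ n) (Set.Icc 0 T) := fun τ hτ =>
  ((ha τ hτ n).2).continuousWithinAt

theorem aemeasurable_coeff (ha : ∀ n, ContinuousOn (fun τ => a τ n) (Set.Icc 0 T)) {t : ℝ}
    (ht : t ≤ T) (n : ℤ) :
    AEMeasurable (fun τ => ‖a τ n‖ₑ) (volume.restrict (Set.Icc 0 t)) :=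
  (((ha n).mono (Set.Icc_subset_Icc_right ht)).aestronglyMeasurable
    measurableSet_Icc).enorm

theorem aemeasurable_absQuintic (ha : ∀ n, ContinuousOn (fun τ => a τ n) (Set.Icc 0 T)) {t : ℝ}
    (ht : t ≤ T)
    (p : Fin 5 → ℤ) :
    AEMeasurable (fun τ => absQuintic a τ p) (volume.restrict (Set.Icc 0 t)) :=
  Finset.aemeasurable_fun_prod _ fun l _ => aemeasurable_coeff ha ht (p l)

theorem aemeasurable_absRhs (ha : ∀ n, ContinuousOn (fun τ => a τ n) (Set.Icc 0 T)) {t : ℝ}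
    (ht : t ≤ T) (n : ℤ) :
    AEMeasurable (fun τ => absRhs L a τ n) (volume.restrict (Set.Icc 0 t)) :=
  (AEMeasurable.tsum fun _ => aemeasurable_absQuintic ha ht _).const_mul _

theorem aemeasurable_absQuinticDeriv (ha : ∀ n, ContinuousOn (fun τ => a τ n) (Set.Icc 0 T)) {t : ℝ}
    (ht : t ≤ T) (i : Fin 5)
    (p : Fin 5 → ℤ) :
    AEMeasurable (fun τ => absQuinticDeriv L a i τ p) (volume.restrict (Set.Icc 0 t)) := by
  refine Finset.aemeasurable_fun_prod _ fun l _ => ?_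
  by_cases h : l = i
  · simpa [h] using aemeasurable_absRhs ha ht (p i)
  · simpa [h] using aemeasurable_coeff ha ht (p l)

end QuinticNLS

namespace QuinticNLS

open scoped ENNReal
open MeasureTheory

variable {L κ : ℕ} {T : ℝ} {a : ℝ → ℤ → ℂ}

-- Integration by parts is done for finitely many quintuples only, since termwise differentiation of
-- the infinite sum is not available. The remaining terms stay under the integral.
open Classical in
theorem enorm_sub_le_of_finset (ha : IsFullSolution L T a) (hL : 0 < L) {t : ℝ}
    (ht : t ∈ Set.Icc (0 : ℝ) T) (n : ℤ) (F : Finset (hyperplane n))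
    (hF : ∀ p ∈ F, phase L p n ≠ 0) :
    (L : ℝ≥0∞) ^ 4 * ‖a t n - a 0 n‖ₑ ≤
      (∫⁻ τ in Set.Icc 0 t, ((∑' p : hyperplane n, if p ∈ F then 0 else absQuintic a τ p)
        + ∑ p ∈ F, ENNReal.ofReal (1 / |phase L p n|) * ∑ i, absQuinticDeriv L a i τ p))
      + ∑ p ∈ F, ENNReal.ofReal (1 / |phase L p n|) * (absQuintic a t p + absQuintic a 0 p) := by
  have hLC : (L : ℂ) ≠ 0 := by exact_mod_cast hL.ne'
  have hce : ∀ p : hyperplane n, ‖(-1 / (phase L p n : ℂ))‖ₑ = ENNReal.ofReal (1 / |phase L p n|) :=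
    fun p => by
      rw [← ofReal_norm, norm_div, norm_neg, norm_one, Complex.norm_real, Real.norm_eq_abs]
  -- the corrected coefficient
  let g : ℝ → ℂ := fun τ => (L : ℂ) ^ 4 * a τ n
    + ∑ p ∈ F, -1 / (phase L p n : ℂ) * (quintic (a τ) p *
      Complex.exp (-Complex.I * (τ : ℂ) * (phase L p n : ℂ)))
  have hq : ∀ τ, ∃ q' : hyperplane n → ℂ, τ ∈ Set.Icc (0 : ℝ) T → ∀ p : hyperplane n,
      HasDerivWithinAt (fun τ => quintic (a τ) p) (q' p) (Set.Icc 0 T) τ ∧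
        ‖q' p‖ₑ ≤ ∑ i, absQuinticDeriv L a i τ p := by
    intro τ
    by_cases hτ : τ ∈ Set.Icc (0 : ℝ) T
    · have h := fun p : hyperplane n =>
        hasDerivWithinAt_quintic (fun m => (ha τ hτ m).2) (p : Fin 5 → ℤ)
      choose q' hq' hq'' using h
      refine ⟨q', fun _ p => ⟨hq' p, (hq'' p).trans ?_⟩⟩
      refine Finset.sum_le_sum fun i _ => Finset.prod_le_prod' fun l _ => ?_
      split_ifs
      · exact enorm_rhs_le ha hL hτ _
      · exact le_rfl
    · exact ⟨0, fun h => absurd h hτ⟩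
  choose q' hq' using hq
  -- Differentiating the exponential in the correction gives `i` times the term of the equation,
  -- which cancels it. Only derivatives of the coefficients and the quintuples outside `F` remain.
  let g' : ℝ → ℂ := fun τ => -Complex.I * (∑' p : hyperplane n,
      if p ∈ F then 0 else fullTerm L (a τ) τ n p)
    + ∑ p ∈ F, -1 / (phase L p n : ℂ) * (q' τ p *
      Complex.exp (-Complex.I * (τ : ℂ) * (phase L p n : ℂ)))
  have hsplit : ∀ τ ∈ Set.Icc (0 : ℝ) T, ∑' p : hyperplane n, fullTerm L (a τ) τ n p
      = ∑ p ∈ F, fullTerm L (a τ) τ n p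
        + ∑' p : hyperplane n, if p ∈ F then 0 else fullTerm L (a τ) τ n p := by
    intro τ hτ
    rw [← ((ha τ hτ n).1).sum_add_tsum_compl (s := F)]
    congr 1
    refine (tsum_subtype ((↑F : Set (hyperplane n))ᶜ)
      fun p : hyperplane n => fullTerm L (a τ) τ n p).trans (tsum_congr fun p => ?_)
    by_cases hp : p ∈ F <;> simp [hp]
  have hg : ∀ τ ∈ Set.Icc (0 : ℝ) T, HasDerivWithinAt g (g' τ) (Set.Icc 0 T) τ := by
    intro τ hτ
    have h1 := ((ha τ hτ n).2).const_mul ((L : ℂ) ^ 4)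
    have h2 : ∀ p ∈ F, HasDerivWithinAt (fun τ : ℝ => -1 / (phase L p n : ℂ) * (quintic (a τ) p *
        Complex.exp (-Complex.I * (τ : ℂ) * (phase L p n : ℂ))))
        (-1 / (phase L p n : ℂ) * (q' τ p *
          Complex.exp (-Complex.I * (τ : ℂ) * (phase L p n : ℂ)))
          + Complex.I * fullTerm L (a τ) τ n p) (Set.Icc 0 T) τ := by
      intro p hp
      have hφ : (phase L p n : ℂ) ≠ 0 := by exact_mod_cast hF p hp
      have he : HasDerivAt (fun τ : ℝ =>
          Complex.exp (-Complex.I * (τ : ℂ) * (phase L p n : ℂ)))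
          (Complex.exp (-Complex.I * (τ : ℂ) * (phase L p n : ℂ))
            * (-Complex.I * 1 * (phase L p n : ℂ))) τ :=
        (((Complex.ofRealCLM.hasDerivAt (x := τ)).const_mul (-Complex.I)).mul_const _).cexp
      refine ((((hq' τ hτ p).1).mul he.hasDerivWithinAt).const_mul _).congr_deriv ?_
      rw [fullTerm]
      field_simp
      ring
    refine (h1.add (HasDerivWithinAt.fun_sum h2)).congr_deriv ?_
    rw [hsplit τ hτ, Finset.sum_add_distrib, ← Finset.mul_sum]
    have e : ∀ Z : ℂ, (L : ℂ) ^ 4 * (-Complex.I * (1 / (L : ℂ) ^ 4 * Z)) = -Complex.I * Z :=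
      fun Z => by field_simp
    rw [e]
    simp only [g']
    ring
  have hb : ∀ τ ∈ Set.Icc (0 : ℝ) T, ‖g' τ‖ₑ
      ≤ (∑' p : hyperplane n, if p ∈ F then 0 else absQuintic a τ p)
        + ∑ p ∈ F, ENNReal.ofReal (1 / |phase L p n|) * ∑ i, absQuinticDeriv L a i τ p := by
    intro τ hτ
    refine (enorm_add_le _ _).trans (add_le_add ?_ ?_)
    · rw [enorm_mul, enorm_neg_I, one_mul]
      have hs : Summable fun p : hyperplane n =>
          if p ∈ F then 0 else fullTerm L (a τ) τ n p := by
        refine ((ha τ hτ n).1.norm).of_norm_bounded fun p => ?_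
        split_ifs
        · rw [norm_zero]; exact norm_nonneg _
        · exact le_rfl
      refine (enorm_tsum_le hs).trans (ENNReal.tsum_le_tsum fun p => ?_)
      split_ifs
      · simp
      · exact (enorm_fullTerm a τ n p).le
    · refine (enorm_sum_le _ _).trans (Finset.sum_le_sum fun p _ => ?_)
      rw [enorm_mul, enorm_mul, enorm_exp_phase, mul_one, hce]
      gcongr
      exact (hq' τ hτ p).2
  have hmain := enorm_sub_le_lintegral_of_hasDerivWithinAt ht hg hb
  have hdiff : (L : ℂ) ^ 4 * (a t n - a 0 n) = (g t - g 0)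
      - ∑ p ∈ F, -1 / (phase L p n : ℂ) * (fullTerm L (a t) t n p - fullTerm L (a 0) 0 n p) := by
    simp only [g, fullTerm, mul_sub, Finset.sum_sub_distrib]
    ring
  have hLe : ‖(L : ℂ) ^ 4‖ₑ = (L : ℝ≥0∞) ^ 4 := by
    rw [← ofReal_norm, norm_pow, Complex.norm_natCast, ENNReal.ofReal_pow (by positivity),
      ENNReal.ofReal_natCast]
  rw [← hLe, ← enorm_mul, hdiff]
  refine enorm_sub_le.trans (add_le_add hmain ?_)
  refine (enorm_sum_le _ _).trans (Finset.sum_le_sum fun p _ => ?_)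
  rw [enorm_mul, hce]
  gcongr
  refine enorm_sub_le.trans ?_
  rw [enorm_fullTerm, enorm_fullTerm]

-- The finite version is applied to the quintuples of `F` outside `P`. As `F` grows, the leftover
-- integral tends to `0` by `hfin`, while all other terms are already bounded uniformly in `F`.
open Classical in
theorem enorm_sub_le_of_splitting (ha : IsFullSolution L T a) (hL : 0 < L) {t : ℝ}
    (ht : t ∈ Set.Icc (0 : ℝ) T) (n : ℤ) (P : (Fin 5 → ℤ) → Prop)
    (hP : ∀ p : hyperplane n, ¬ P p → phase L p n ≠ 0)
    (hfin : ∫⁻ τ in Set.Icc 0 t, ∑' p : hyperplane n, absQuintic a τ p ≠ ∞) :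
    (L : ℝ≥0∞) ^ 4 * ‖a t n - a 0 n‖ₑ ≤
      (∫⁻ τ in Set.Icc 0 t, ∑' p : hyperplane n, if P p then absQuintic a τ p else 0)
      + (∫⁻ τ in Set.Icc 0 t, ∑ i, ∑' p : hyperplane n,
          if P p then 0 else ENNReal.ofReal (1 / |phase L p n|) * absQuinticDeriv L a i τ p)
      + ((∑' p : hyperplane n,
          if P p then 0 else ENNReal.ofReal (1 / |phase L p n|) * absQuintic a t p)
        + ∑' p : hyperplane n,
          if P p then 0 else ENNReal.ofReal (1 / |phase L p n|) * absQuintic a 0 p) := by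
  let μ := volume.restrict (Set.Icc 0 t)
  have hmQ : ∀ p : hyperplane n, AEMeasurable (fun τ => absQuintic a τ p) μ := fun p =>
    aemeasurable_absQuintic (continuousOn_coeff ha) ht.2 p
  let f : hyperplane n → ℝ≥0∞ := fun p => ∫⁻ τ, absQuintic a τ p ∂μ
  have hf' : ∑' p, f p ≠ ∞ := by
    exact (lintegral_tsum hmQ).symm.trans_ne hfin
  have hfinset : ∀ F : Finset (hyperplane n), (L : ℝ≥0∞) ^ 4 * ‖a t n - a 0 n‖ₑ ≤
      (∑' p : {p // p ∉ F}, f p) + ((∫⁻ τ in Set.Icc 0 t, ∑' p : hyperplane n, if P p then absQuintic a τ p else 0)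
      + (∫⁻ τ in Set.Icc 0 t, ∑ i, ∑' p : hyperplane n,
          if P p then 0 else ENNReal.ofReal (1 / |phase L p n|) * absQuinticDeriv L a i τ p)
      + ((∑' p : hyperplane n,
          if P p then 0 else ENNReal.ofReal (1 / |phase L p n|) * absQuintic a t p)
        + ∑' p : hyperplane n,
          if P p then 0 else ENNReal.ofReal (1 / |phase L p n|) * absQuintic a 0 p)) := by
    intro F
    have hsum : ∀ G : hyperplane n → ℝ≥0∞, ∑ p ∈ F.filter (fun p : hyperplane n => ¬ P p), G p
        ≤ ∑' p : hyperplane n, if P p then 0 else G p := by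
      intro G
      calc ∑ p ∈ F.filter (fun p : hyperplane n => ¬ P p), G p
          = ∑ p ∈ F.filter (fun p : hyperplane n => ¬ P p), if P p then 0 else G p :=
            Finset.sum_congr rfl fun p hp => by rw [if_neg (Finset.mem_filter.1 hp).2]
        _ ≤ _ := ENNReal.sum_le_tsum _
    refine (enorm_sub_le_of_finset ha hL ht n (F.filter fun p : hyperplane n => ¬ P p)
      (fun p hp => hP p (Finset.mem_filter.1 hp).2)).trans ?_
    have h1 : ∀ τ, (∑' p : hyperplane n, if p ∈ F.filter (fun p : hyperplane n => ¬ P p) then 0 else absQuintic a τ p)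
          + ∑ p ∈ F.filter (fun p : hyperplane n => ¬ P p),
            ENNReal.ofReal (1 / |phase L p n|) * ∑ i, absQuinticDeriv L a i τ p
        ≤ (∑' p : {p // p ∉ F}, absQuintic a τ p.1)
          + ((∑' p : hyperplane n, if P p then absQuintic a τ p else 0)
          + ∑ i, ∑' p : hyperplane n,
          if P p then 0 else ENNReal.ofReal (1 / |phase L p n|) * absQuinticDeriv L a i τ p) := by
      intro τ
      rw [← add_assoc]
      refine add_le_add ?_ ?_
      · have : ∑' p : {p // p ∉ F}, absQuintic a τ p.1
            = ∑' p : hyperplane n, if p ∈ F then 0 else absQuintic a τ p := by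
          rw [show (∑' p : {p // p ∉ F}, absQuintic a τ p.1)
            = ∑' p : ({p | p ∉ F} : Set (hyperplane n)), absQuintic a τ p.1 from rfl,
            tsum_subtype {p : hyperplane n | p ∉ F} fun p => absQuintic a τ p]
          refine tsum_congr fun p => ?_
          by_cases hp : p ∈ F <;> simp [hp]
        rw [this, ← ENNReal.tsum_add]
        refine ENNReal.tsum_le_tsum fun p => ?_
        by_cases hp : p ∈ F <;> by_cases hp' : P p <;> simp [hp, hp']
      · refine (hsum _).trans ?_
        rw [← tsum_mul_sum]
        refine ENNReal.tsum_le_tsum fun p => ?_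
        split_ifs
        · simp
        · rw [Finset.mul_sum]
    have h2 : AEMeasurable (fun τ => ∑' p : {p // p ∉ F}, absQuintic a τ p.1) μ :=
      AEMeasurable.tsum fun p => hmQ p.1
    have h3 : AEMeasurable (fun τ => ∑' p : hyperplane n, if P p then absQuintic a τ p else 0) μ :=
      AEMeasurable.tsum fun p => by
        by_cases hp : P p
        · simpa [hp] using hmQ p
        · simp [hp]
    have h4 : ∑ p ∈ F.filter (fun p : hyperplane n => ¬ P p), ENNReal.ofReal (1 / |phase L p n|)
          * (absQuintic a t p + absQuintic a 0 p)
        ≤ (∑' p : hyperplane n,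
          if P p then 0 else ENNReal.ofReal (1 / |phase L p n|) * absQuintic a t p)
        + ∑' p : hyperplane n,
          if P p then 0 else ENNReal.ofReal (1 / |phase L p n|) * absQuintic a 0 p := by
      simp only [mul_add, Finset.sum_add_distrib]
      exact add_le_add (hsum _) (hsum _)
    have h5 : ∫⁻ τ, ∑' p : {p // p ∉ F}, absQuintic a τ p.1 ∂μ = ∑' p : {p // p ∉ F}, f p :=
      lintegral_tsum fun p => hmQ p.1
    refine (add_le_add (lintegral_mono h1) h4).trans ?_
    rw [← h5]
    refine le_trans (add_le_add (le_of_eq ?_) le_rfl) (le_of_eq (add_assoc _ _ _))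
    exact (lintegral_add_left' h2 _).trans (congrArg _ (lintegral_add_left' h3 _))
  have htend := ENNReal.tendsto_tsum_compl_atTop_zero hf'
  have := ge_of_tendsto' (htend.add_const _) hfinset
  simpa using this

end QuinticNLS

namespace QuinticNLS

open scoped ENNReal
open MeasureTheory

/-! ### The time-integrated estimate for the full system -/

theorem sq_lintegral_Icc_le {t : ℝ} {G : ℝ → ℝ≥0∞}
    (hG : AEMeasurable G (volume.restrict (Set.Icc 0 t))) :
    (∫⁻ τ in Set.Icc 0 t, G τ) ^ 2 ≤ ENNReal.ofReal t * ∫⁻ τ in Set.Icc 0 t, G τ ^ 2 := by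
  have h := ENNReal.lintegral_mul_le_Lp_mul_Lq (volume.restrict (Set.Icc 0 t))
    Real.HolderConjugate.two_two (f := 1) (g := G) aemeasurable_const hG
  have key : ∀ x : ℝ≥0∞, (x ^ (1 / (2 : ℝ))) ^ 2 = x := fun x => by
    rw [← ENNReal.rpow_natCast, ← ENNReal.rpow_mul]; norm_num
  refine (pow_le_pow_left' (le_trans (le_of_eq (by simp)) h) 2).trans (le_of_eq ?_)
  rw [mul_pow, key, key]
  simp

theorem tsum_sq_lintegral_Icc_le {t : ℝ} {G : ℤ → ℝ → ℝ≥0∞} {B : ℝ≥0∞}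
    (hG : ∀ n, AEMeasurable (G n) (volume.restrict (Set.Icc 0 t)))
    (hB : ∀ τ ∈ Set.Icc 0 t, ∑' n, G n τ ^ 2 ≤ B) :
    ∑' n, (∫⁻ τ in Set.Icc 0 t, G n τ) ^ 2 ≤ ENNReal.ofReal t ^ 2 * B := by
  calc ∑' n, (∫⁻ τ in Set.Icc 0 t, G n τ) ^ 2
      ≤ ∑' n, ENNReal.ofReal t * ∫⁻ τ in Set.Icc 0 t, G n τ ^ 2 :=
        ENNReal.tsum_le_tsum fun n => sq_lintegral_Icc_le (hG n)
    _ = ENNReal.ofReal t * ∫⁻ τ in Set.Icc 0 t, ∑' n, G n τ ^ 2 := by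
        rw [ENNReal.tsum_mul_left, lintegral_tsum fun n => (hG n).pow_const 2]
    _ ≤ ENNReal.ofReal t * ∫⁻ _τ in Set.Icc 0 t, B := by
        exact mul_le_mul' le_rfl (setLIntegral_mono' measurableSet_Icc hB)
    _ = _ := by
        rw [setLIntegral_const, Real.volume_Icc, sub_zero]; ring

/-- Cauchy–Schwarz against `1/m`: the weighted `ℓ²` norm controls `ℓ¹`, with the power of `L` that
the multilinear bounds expect. -/
theorem sq_tsum_le_of_weighted {s Z : ℝ} {L κ : ℕ} (hs : 1 < s)
    (hZ : ∑' n : ℤ, ENNReal.ofReal (1 / mult s L κ n ^ 2) ≤ L * ENNReal.ofReal Z)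
    {f : ℤ → ℝ≥0∞} {N : ℝ≥0∞} (hf : ∑' n, (emult s L κ n * f n) ^ 2 ≤ L * N) :
    (∑' n, f n) ^ 2 ≤ L ^ 2 * (ENNReal.ofReal Z * N) := by
  have h0 : ∀ n, emult s L κ n ≠ 0 := fun n => by
    simpa [emult] using mult_pos hs
  have h1 : ∀ n, emult s L κ n ≠ ∞ := fun n => ENNReal.ofReal_ne_top
  calc (∑' n, f n) ^ 2 = (∑' n, (emult s L κ n)⁻¹ * (emult s L κ n * f n)) ^ 2 := by
        congr 1
        refine tsum_congr fun n => ?_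
        rw [← mul_assoc, ENNReal.inv_mul_cancel (h0 n) (h1 n), one_mul]
    _ ≤ _ := tsum_mul_sq_le _ _
    _ ≤ (L * ENNReal.ofReal Z) * (L * N) := by
        gcongr
        refine le_trans (le_of_eq (tsum_congr fun n => ?_)) hZ
        have := mult_pos (s := s) (L := L) (κ := κ) (n := n) hs
        rw [one_div, ENNReal.ofReal_inv_of_pos (by positivity), ENNReal.ofReal_pow this.le,
          ENNReal.inv_pow, emult]
    _ = _ := by ring

variable {L κ : ℕ} {T : ℝ} {a : ℝ → ℤ → ℂ} {s C : ℝ} {X : ℝ≥0∞}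

theorem inv_pow_sq_mul (hL : 0 < L) (m : ℕ) (Y : ℝ≥0∞) :
    (((L : ℝ≥0∞) ^ 4)⁻¹) ^ 2 * (L ^ (8 + m) * Y) = L ^ m * Y := by
  have h0 : (L : ℝ≥0∞) ≠ 0 := by exact_mod_cast hL.ne'
  have h1 : (L : ℝ≥0∞) ≠ ∞ := ENNReal.natCast_ne_top L
  rw [← ENNReal.inv_pow, ← pow_mul, pow_add, ← mul_assoc, ← mul_assoc,
    ENNReal.inv_mul_cancel (pow_ne_zero _ h0) (ENNReal.pow_ne_top h1), one_mul]

theorem sq_tsum_absQuintic_le {τ : ℝ} (h1 : (∑' m, ‖a τ m‖ₑ) ^ 2 ≤ L ^ 2 * X) :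
    (∑' p : Fin 5 → ℤ, absQuintic a τ p) ^ 2 ≤ L ^ 10 * X ^ 5 := by
  simp only [absQuintic]
  rw [tsum_pi_prod (fun _ m => ‖a τ m‖ₑ), Finset.prod_const, ← pow_mul, mul_comm _ 2, pow_mul]
  refine (pow_le_pow_left' h1 _).trans (le_of_eq ?_)
  simp
  ring

theorem sq_tsum_absRhs_le (hL : 0 < L) {τ : ℝ} (h1 : (∑' m, ‖a τ m‖ₑ) ^ 2 ≤ L ^ 2 * X) :
    (∑' m, absRhs L a τ m) ^ 2 ≤ L ^ 2 * X ^ 5 := by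
  simp only [absRhs]
  rw [ENNReal.tsum_mul_left, tsum_hyperplane, mul_pow, ← inv_pow_sq_mul hL 2]
  gcongr
  exact sq_tsum_absQuintic_le h1

theorem tsum_sq_absRhs_le (hL : 0 < L) {τ : ℝ} (h1 : (∑' m, ‖a τ m‖ₑ) ^ 2 ≤ L ^ 2 * X)
    (h2 : ∑' m, ‖a τ m‖ₑ ^ 2 ≤ L * X) :
    ∑' m, absRhs L a τ m ^ 2 ≤ L * X ^ 5 := by
  have h := one_slot_bound (L := L) 0 (fun _ m => ‖a τ m‖ₑ) 1 1 (fun _ => X) (fun _ => h1)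
    (by simpa using h2)
  simp only [Pi.one_apply, one_mul, one_pow, Finset.prod_const, Finset.card_univ,
    Fintype.card_fin] at h
  simp only [absRhs, mul_pow]
  rw [ENNReal.tsum_mul_left, ← pow_one (L : ℝ≥0∞), ← inv_pow_sq_mul hL 1, pow_one]
  gcongr
  exact h

theorem one_le_emult (hs : 1 < s) (n : ℤ) : 1 ≤ emult s L κ n := by
  rw [emult, ENNReal.one_le_ofReal]; exact one_le_mult hs

theorem ecapped_le (n : ℤ) :
    ecapped s L κ n ≤ ENNReal.ofReal (waveNumber L κ ^ (s - 1 / 2)) :=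
  ENNReal.ofReal_le_ofReal (min_le_right _ _)

theorem tsum_sq_le_of_weighted (hs : 1 < s) {f : ℤ → ℝ≥0∞} {Y : ℝ≥0∞}
    (h : ∑' m, (emult s L κ m * f m) ^ 2 ≤ Y) : ∑' m, f m ^ 2 ≤ Y :=
  (ENNReal.tsum_le_tsum fun m => pow_le_pow_left' (le_mul_of_one_le_left' (one_le_emult hs m)) 2).trans h

theorem tsum_sq_capped_le_of_weighted {f : ℤ → ℝ≥0∞} {Y : ℝ≥0∞}
    (h : ∑' m, (emult s L κ m * f m) ^ 2 ≤ Y) : ∑' m, (ecapped s L κ m * f m) ^ 2 ≤ Y :=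
  (ENNReal.tsum_le_tsum fun m =>
    pow_le_pow_left' (mul_le_mul_left (ecapped_le_emult m) _) 2).trans h

theorem ofReal_rpow_sq_le_one {k e : ℝ} (hk : 1 ≤ k) (he : e ≤ 0) :
    ENNReal.ofReal (k ^ e) ^ 2 ≤ 1 := by
  refine pow_le_one' ?_ 2
  rw [ENNReal.ofReal_le_one]
  exact Real.rpow_le_one_of_one_le_of_nonpos hk he

-- The right-hand side of the system is bounded only in unweighted `ℓ²`, so in the differentiated
-- slot the capped multiplier is replaced by its maximum `k^(s-1/2)`. The factor `1/k` compensates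
-- this precisely because `s ≤ 3/2`.
open Classical in
theorem not_tame_bound_deriv (hT : Trichotomy s C) (hs : 1 < s) (hs' : s ≤ 3 / 2) (hL : 0 < L)
    (hκ : 0 < κ) (i : Fin 5) {τ : ℝ} (h1 : (∑' m, ‖a τ m‖ₑ) ^ 2 ≤ L ^ 2 * X)
    (h2 : ∑' m, (emult s L κ m * ‖a τ m‖ₑ) ^ 2 ≤ L * X) :
    ∑' n : ℤ, (emult s L κ n * ∑' p : hyperplane n,
        if Tame s C L κ p then 0
        else ENNReal.ofReal (1 / |phase L p n|) * absQuinticDeriv L a i τ p) ^ 2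
      ≤ ENNReal.ofReal (100000 * C ^ 7) * (L ^ 9 * X ^ 9) * 2 := by
  -- For `k < 100` every quintuple is tame and the sum vanishes.
  rcases lt_or_ge (waveNumber L κ) 100 with hk | hk
  · have h : ∀ p, Tame s C L κ p := fun p => by
      by_contra h
      linarith [(not_tame_data hT hL h).1]
    simp [h]
  set K := ENNReal.ofReal (waveNumber L κ ^ (s - 1 / 2)) with hK
  have hK1 : 1 ≤ K := by
    rw [hK, ENNReal.one_le_ofReal]
    exact Real.one_le_rpow (by linarith) (by linarith)
  have h3 := tsum_sq_le_of_weighted hs h2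
  have h := not_tame_bound hT hs hL hκ
    (fun l m => if l = i then absRhs L a τ m else ‖a τ m‖ₑ)
    (fun l => if l = i then X ^ 5 else X) (fun l => if l = i then K ^ 2 else 1)
    (fun l => by
      by_cases hl : l = i
      · simpa [hl] using sq_tsum_absRhs_le hL h1
      · simpa [hl] using h1)
    (fun l => by
      by_cases hl : l = i
      · simpa [hl] using tsum_sq_absRhs_le hL h1 h3
      · simpa [hl] using h3)
    (fun l => by
      by_cases hl : l = i
      · simp only [hl, if_true]
        calc ∑' m, (ecapped s L κ m * absRhs L a τ m) ^ 2
            ≤ ∑' m, (K * absRhs L a τ m) ^ 2 := by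
              refine ENNReal.tsum_le_tsum fun m => ?_
              gcongr
              exact ecapped_le m
          _ = K ^ 2 * ∑' m, absRhs L a τ m ^ 2 := by
              simp only [mul_pow, ENNReal.tsum_mul_left]
          _ ≤ K ^ 2 * (L * X ^ 5) := by gcongr; exact tsum_sq_absRhs_le hL h1 h3
          _ = _ := by ring
      · simpa [hl] using tsum_sq_capped_le_of_weighted h2)
    (K ^ 2) (fun l l' hll => by
      have hK2 : 1 ≤ K ^ 2 := one_le_pow₀ hK1
      by_cases hl : l = i
      · have : l' ≠ i := fun h => hll (hl.trans h.symm)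
        simp [hl, this]
      · by_cases hl' : l' = i <;> simp [hl, hl', hK2])
  refine h.trans ?_
  have hprod : ∏ l : Fin 5, (if l = i then X ^ 5 else X) = X ^ 9 := by
    rw [Fin.prod_univ_succAbove _ i]
    simp [Fin.succAbove_ne]
    ring
  rw [hprod]
  gcongr
  have hk0 : 0 < waveNumber L κ := by linarith
  refine (add_le_add (ofReal_rpow_sq_le_one (by linarith) (by linarith)) ?_).trans
    one_add_one_eq_two.le
  rw [hK, ← mul_pow, ← ENNReal.ofReal_mul (p := 1 / waveNumber L κ) (by positivity)]
  have : 1 / waveNumber L κ * waveNumber L κ ^ (s - 1 / 2) = waveNumber L κ ^ (s - 3 / 2) := by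
    rw [one_div, ← Real.rpow_neg_one, ← Real.rpow_add hk0]
    congr 1
    ring
  rw [this]
  exact ofReal_rpow_sq_le_one (by linarith) (by linarith)

open Classical in
theorem not_tame_bound_boundary (hT : Trichotomy s C) (hs : 1 < s) (hs' : s ≤ 3 / 2) (hL : 0 < L)
    (hκ : 0 < κ) {τ : ℝ} (h1 : (∑' m, ‖a τ m‖ₑ) ^ 2 ≤ L ^ 2 * X)
    (h2 : ∑' m, (emult s L κ m * ‖a τ m‖ₑ) ^ 2 ≤ L * X) :
    ∑' n : ℤ, (emult s L κ n * ∑' p : hyperplane n,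
        if Tame s C L κ p then 0
        else ENNReal.ofReal (1 / |phase L p n|) * absQuintic a τ p) ^ 2
      ≤ ENNReal.ofReal (100000 * C ^ 7) * (L ^ 9 * X ^ 5) *
        ENNReal.ofReal (8 * bracket (waveNumber L κ) ^ (s - 5 / 2)) := by
  rcases lt_or_ge (waveNumber L κ) 100 with hk | hk
  · have h : ∀ p, Tame s C L κ p := fun p => by
      by_contra h
      linarith [(not_tame_data hT hL h).1]
    simp [h]
  have h3 := tsum_sq_le_of_weighted hs h2
  have h := not_tame_bound hT hs hL hκ (fun _ m => ‖a τ m‖ₑ) (fun _ => X) (fun _ => 1)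
    (fun _ => h1) (fun _ => h3)
    (fun _ => by simpa using tsum_sq_capped_le_of_weighted h2) 1 (fun _ _ _ => by simp)
  refine h.trans ?_
  rw [Finset.prod_const, Finset.card_univ, Fintype.card_fin]
  gcongr
  set k := waveNumber L κ
  have hk0 : 0 < k := by linarith
  have hk1 : k ^ (s - 5 / 2) ≤ 4 * bracket k ^ (s - 5 / 2) := by
    have hb : bracket k ≤ 2 * k := by
      have := bracket_le k
      rw [abs_of_pos hk0] at this
      linarith
    have hbp := bracket_pos k
    calc k ^ (s - 5 / 2) ≤ (bracket k / 2) ^ (s - 5 / 2) :=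
          Real.rpow_le_rpow_of_nonpos (by positivity) (by linarith) (by linarith)
      _ = bracket k ^ (s - 5 / 2) * 2 ^ (5 / 2 - s) := by
          rw [Real.div_rpow hbp.le (by norm_num), div_eq_mul_inv, ← Real.rpow_neg (by norm_num)]
          ring_nf
      _ ≤ bracket k ^ (s - 5 / 2) * 2 ^ (2 : ℝ) := by
          gcongr
          · norm_num
          · linarith
      _ = _ := by norm_num; ring
  rw [mul_one, ← ENNReal.ofReal_pow (by positivity), ← ENNReal.ofReal_pow (by positivity),
    ← ENNReal.ofReal_add (by positivity) (by positivity)]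
  refine ENNReal.ofReal_le_ofReal ?_
  -- Here `2 s - 4 ≤ s - 5/2` is `s ≤ 3/2`; the next bound uses `-2 ≤ s - 5/2`.
  have e1 : (k ^ (s - 2)) ^ 2 ≤ k ^ (s - 5 / 2) := by
    rw [← Real.rpow_natCast, ← Real.rpow_mul hk0.le]
    exact Real.rpow_le_rpow_of_exponent_le (by linarith) (by push_cast; linarith)
  have e2 : (1 / k) ^ 2 ≤ k ^ (s - 5 / 2) := by
    rw [one_div, ← Real.rpow_neg_one, ← Real.rpow_natCast, ← Real.rpow_mul hk0.le]
    exact Real.rpow_le_rpow_of_exponent_le (by linarith) (by push_cast; linarith)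
  linarith

end QuinticNLS

namespace QuinticNLS

open scoped ENNReal
open MeasureTheory

variable {L κ : ℕ} {T : ℝ} {a : ℝ → ℤ → ℂ} {s C : ℝ} {X : ℝ≥0∞}

theorem add_four_sq_le (x y z w : ℝ≥0∞) :
    (x + y + (z + w)) ^ 2 ≤ 4 * (x ^ 2 + y ^ 2 + z ^ 2 + w ^ 2) := by
  calc _ ≤ 2 * ((x + y) ^ 2 + (z + w) ^ 2) := add_sq_le_two_mul _ _
    _ ≤ 2 * (2 * (x ^ 2 + y ^ 2) + 2 * (z ^ 2 + w ^ 2)) := by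
        gcongr <;> exact add_sq_le_two_mul _ _
    _ = _ := by ring

theorem lintegral_tsum_absQuintic_ne_top (hX : X ≠ ∞) {t : ℝ}
    (h1 : ∀ τ ∈ Set.Icc 0 t, (∑' m, ‖a τ m‖ₑ) ^ 2 ≤ L ^ 2 * X) (n : ℤ) :
    ∫⁻ τ in Set.Icc 0 t, ∑' p : hyperplane n, absQuintic a τ p ≠ ∞ := by
  set B : ℝ≥0∞ := 1 + L ^ 10 * X ^ 5
  have hB : B ≠ ∞ := ENNReal.add_ne_top.2 ⟨ENNReal.one_ne_top,
    ENNReal.mul_ne_top (ENNReal.pow_ne_top (ENNReal.natCast_ne_top L)) (ENNReal.pow_ne_top hX)⟩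
  have hle : ∫⁻ τ in Set.Icc 0 t, ∑' p : hyperplane n, absQuintic a τ p
      ≤ ∫⁻ _τ in Set.Icc 0 t, B := by
    refine setLIntegral_mono' measurableSet_Icc fun τ hτ => ?_
    have h2 : ∑' p : hyperplane n, absQuintic a τ p ≤ ∑' p : Fin 5 → ℤ, absQuintic a τ p :=
      ENNReal.tsum_comp_le_tsum_of_injective Subtype.val_injective _
    refine h2.trans ?_
    rcases le_total (∑' p : Fin 5 → ℤ, absQuintic a τ p) 1 with h | h
    · exact h.trans le_self_add
    · exact (le_self_pow₀ h two_ne_zero).trans ((sq_tsum_absQuintic_le (h1 τ hτ)).trans le_add_self)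
  refine ne_top_of_le_ne_top ?_ hle
  rw [setLIntegral_const, Real.volume_Icc]
  exact ENNReal.mul_ne_top hB ENNReal.ofReal_ne_top

/-- The terms on the right come from the tame quintuples, the differentiated factors and the two
boundary terms. The weighted norm is taken under the time integral by Cauchy–Schwarz, and the factor
`L⁻⁴` of the equation reduces `L^9` to `L`. -/
theorem tsum_sq_sub_initial_le (hT : Trichotomy s C) (hs : 1 < s) (hs' : s ≤ 3 / 2) (hL : 0 < L)
    (hκ : 0 < κ) (ha : IsFullSolution L T a) {t : ℝ} (ht : t ∈ Set.Icc (0 : ℝ) T) (hX : X ≠ ∞)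
    (h1 : ∀ τ ∈ Set.Icc 0 T, (∑' m, ‖a τ m‖ₑ) ^ 2 ≤ L ^ 2 * X)
    (h2 : ∀ τ ∈ Set.Icc 0 T, ∑' m, (emult s L κ m * ‖a τ m‖ₑ) ^ 2 ≤ L * X) :
    ∑' n, (emult s L κ n * ‖a t n - a 0 n‖ₑ) ^ 2 ≤
      L * (ENNReal.ofReal (100000 * C ^ 7) * (200 * (ENNReal.ofReal t ^ 2 * X ^ 5
        + ENNReal.ofReal t ^ 2 * X ^ 9
        + X ^ 5 * ENNReal.ofReal (bracket (waveNumber L κ) ^ (s - 5 / 2))))) := by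
  classical
  have hsub : Set.Icc 0 t ⊆ Set.Icc 0 T := Set.Icc_subset_Icc_right ht.2
  have h0T : (0 : ℝ) ∈ Set.Icc (0 : ℝ) T := ⟨le_rfl, ht.1.trans ht.2⟩
  set D := ENNReal.ofReal (100000 * C ^ 7)
  set B := ENNReal.ofReal (bracket (waveNumber L κ) ^ (s - 5 / 2)) with hB
  let G₁ : ℤ → ℝ → ℝ≥0∞ := fun n τ => emult s L κ n *
    ∑' p : hyperplane n, if Tame s C L κ p then absQuintic a τ p else 0
  let G₂ : ℤ → ℝ → ℝ≥0∞ := fun n τ => ∑ i, emult s L κ n * ∑' p : hyperplane n,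
    if Tame s C L κ p then 0 else ENNReal.ofReal (1 / |phase L p n|) * absQuinticDeriv L a i τ p
  let b : ℤ → ℝ → ℝ≥0∞ := fun n τ => emult s L κ n * ∑' p : hyperplane n,
    if Tame s C L κ p then 0 else ENNReal.ofReal (1 / |phase L p n|) * absQuintic a τ p
  have hm₁ : ∀ n, AEMeasurable (fun τ => ∑' p : hyperplane n,
      if Tame s C L κ p then absQuintic a τ p else 0) (volume.restrict (Set.Icc 0 t)) := fun n =>
    AEMeasurable.tsum fun p => by
      by_cases hp : Tame s C L κ p
      · simpa [hp] using aemeasurable_absQuintic (continuousOn_coeff ha) ht.2 p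
      · simp [hp]
  have hm₂ : ∀ n i, AEMeasurable (fun τ => ∑' p : hyperplane n,
      if Tame s C L κ p then 0
      else ENNReal.ofReal (1 / |phase L p n|) * absQuinticDeriv L a i τ p)
      (volume.restrict (Set.Icc 0 t)) := fun n i =>
    AEMeasurable.tsum fun p => by
      by_cases hp : Tame s C L κ p
      · simp [hp]
      · simpa [hp] using (aemeasurable_absQuinticDeriv (continuousOn_coeff ha) ht.2 i p).const_mul _
  have hG₁ : ∑' n, (∫⁻ τ in Set.Icc 0 t, G₁ n τ) ^ 2
      ≤ ENNReal.ofReal t ^ 2 * (D * (L ^ 9 * X ^ 5)) :=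
    tsum_sq_lintegral_Icc_le (fun n => (hm₁ n).const_mul _) fun τ hτ =>
      tame_bound hT hs hL hκ (fun m => ‖a τ m‖ₑ) X (h1 τ (hsub hτ)) (h2 τ (hsub hτ))
  have hG₂ : ∑' n, (∫⁻ τ in Set.Icc 0 t, G₂ n τ) ^ 2
      ≤ ENNReal.ofReal t ^ 2 * ((Fintype.card (Fin 5) : ℝ≥0∞) ^ 2 * (D * (L ^ 9 * X ^ 9) * 2)) :=
    tsum_sq_lintegral_Icc_le
      (fun n => Finset.aemeasurable_fun_sum _ fun i _ => (hm₂ n i).const_mul _) fun τ hτ =>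
      tsum_sq_sum_le _ _ fun i => not_tame_bound_deriv hT hs hs' hL hκ i
        (h1 τ (hsub hτ)) (h2 τ (hsub hτ))
  have hb : ∀ τ ∈ Set.Icc 0 T, ∑' n, b n τ ^ 2 ≤ D * (L ^ 9 * X ^ 5) * (8 * B) := fun τ hτ => by
    refine (not_tame_bound_boundary hT hs hs' hL hκ (h1 τ hτ) (h2 τ hτ)).trans (le_of_eq ?_)
    rw [ENNReal.ofReal_mul (p := 8) (by norm_num), ENNReal.ofReal_ofNat]
  have hpt : ∀ n, (L : ℝ≥0∞) ^ 4 * (emult s L κ n * ‖a t n - a 0 n‖ₑ) ≤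
      (∫⁻ τ in Set.Icc 0 t, G₁ n τ) + (∫⁻ τ in Set.Icc 0 t, G₂ n τ) + (b n t + b n 0) := by
    intro n
    have h := enorm_sub_le_of_splitting ha hL ht n (Tame s C L κ) (fun p hp h0 => by
        have := not_tame_data hT hL hp
        rw [out_of_mem p, h0, abs_zero] at this
        linarith [this.1, this.2])
      (lintegral_tsum_absQuintic_ne_top hX (fun τ hτ => h1 τ (hsub hτ)) n)
    rw [mul_left_comm]
    refine (mul_le_mul_right h _).trans (le_of_eq ?_)
    have e2 : ∫⁻ τ in Set.Icc 0 t, G₂ n τ = emult s L κ n * ∫⁻ τ in Set.Icc 0 t, ∑ i,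
        ∑' p : hyperplane n, if Tame s C L κ p then 0
          else ENNReal.ofReal (1 / |phase L p n|) * absQuinticDeriv L a i τ p := by
      rw [← lintegral_const_mul'' _ (Finset.aemeasurable_fun_sum _ fun i _ => hm₂ n i)]
      simp only [G₂, Finset.mul_sum]
    rw [e2]
    simp only [G₁, b]
    rw [lintegral_const_mul'' _ (hm₁ n)]
    ring
  have hsum : (L : ℝ≥0∞) ^ (8 + 0) * ∑' n, (emult s L κ n * ‖a t n - a 0 n‖ₑ) ^ 2 ≤
      L ^ (8 + 1) * (D * (200 * (ENNReal.ofReal t ^ 2 * X ^ 5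
        + ENNReal.ofReal t ^ 2 * X ^ 9 + X ^ 5 * B))) := by
    calc (L : ℝ≥0∞) ^ (8 + 0) * ∑' n, (emult s L κ n * ‖a t n - a 0 n‖ₑ) ^ 2
        = ∑' n, ((L : ℝ≥0∞) ^ 4 * (emult s L κ n * ‖a t n - a 0 n‖ₑ)) ^ 2 := by
          rw [← ENNReal.tsum_mul_left]
          exact tsum_congr fun n => by ring
      _ ≤ ∑' n, 4 * ((∫⁻ τ in Set.Icc 0 t, G₁ n τ) ^ 2 + (∫⁻ τ in Set.Icc 0 t, G₂ n τ) ^ 2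
            + b n t ^ 2 + b n 0 ^ 2) :=
          ENNReal.tsum_le_tsum fun n =>
            (pow_le_pow_left' (hpt n) 2).trans (add_four_sq_le _ _ _ _)
      _ ≤ 4 * (ENNReal.ofReal t ^ 2 * (D * (L ^ 9 * X ^ 5))
          + ENNReal.ofReal t ^ 2 * ((Fintype.card (Fin 5) : ℝ≥0∞) ^ 2 * (D * (L ^ 9 * X ^ 9) * 2))
          + D * (L ^ 9 * X ^ 5) * (8 * B) + D * (L ^ 9 * X ^ 5) * (8 * B)) := by
          rw [ENNReal.tsum_mul_left, ENNReal.tsum_add, ENNReal.tsum_add, ENNReal.tsum_add]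
          gcongr
          · exact hb t ht
          · exact hb 0 h0T
      _ = L ^ (8 + 1) * (D * (4 * (ENNReal.ofReal t ^ 2 * X ^ 5)
        + 200 * (ENNReal.ofReal t ^ 2 * X ^ 9) + 64 * (X ^ 5 * B))) := by
          rw [Fintype.card_fin]; push_cast; ring
      _ ≤ _ := by
          gcongr
          rw [mul_add, mul_add]
          gcongr <;> norm_num
  have h := mul_le_mul_right hsum ((((L : ℝ≥0∞) ^ 4)⁻¹) ^ 2)
  rw [inv_pow_sq_mul hL, inv_pow_sq_mul hL] at h
  simpa using h

end QuinticNLS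

namespace QuinticNLS

open scoped ENNReal
open MeasureTheory

variable {L κ : ℕ} {T : ℝ} {r : ℝ → ℤ → ℂ} {s : ℝ} {X : ℝ≥0∞}

/-! ### The resonant truncation -/

theorem finite_resonantModes (L κ : ℕ) : (resonantModes L κ).Finite := by
  refine Set.Finite.subset (s := ⋃ m : Fin 4, (alpha κ m) '' Set.Ico (0 : ℤ) L)
    (Set.finite_iUnion fun m => (Set.finite_Ico _ _).image _) ?_
  rintro n ⟨m, j, h0, h1, rfl⟩
  exact Set.mem_iUnion.2 ⟨m, j, ⟨h0, h1⟩, rfl⟩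

theorem mult_le_two_of_mem_resonantModes (hs : 1 < s) (hs' : s ≤ 3 / 2) (hL : 0 < L) (hκ : 0 < κ)
    {n : ℤ} (hn : n ∈ resonantModes L κ) : mult s L κ n ≤ 2 := by
  obtain ⟨m, j, h0, h1, rfl⟩ := hn
  have hk : 0 < waveNumber L κ := by unfold waveNumber; positivity
  have ht : tau L κ (shift m) (alpha κ m j) = 0 :=
    (tau_eq_iff hL κ _ _ _).2 ⟨j, h0, h1, by unfold alpha; ring⟩
  have hc : CenteredAt L κ (shift m) (alpha κ m j) := by
    rw [CenteredAt, ht]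
    constructor <;> push_cast <;> linarith
  have hnear : alpha κ m j ∈ nearModes L κ := by
    fin_cases m
    · exact Or.inr (Or.inr (Or.inl hc))
    · exact Or.inr (Or.inl hc)
    · exact Or.inl hc
    · exact Or.inr (Or.inr (Or.inr hc))
  rw [mult_of_near hnear]
  obtain ⟨⟨h2, h3⟩, -⟩ := centeredAt_etaTilde hnear
  set η := etaTilde L κ (alpha κ m j)
  have h4 := tau_bounds hL κ η (alpha κ m j)
  have h5 := tau_bounds hL κ (shift m) (alpha κ m j)
  rw [ht] at h5
  set τ := tau L κ η (alpha κ m j)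
  -- For a non-integer `k` the least admissible center may differ from the one in `alpha`. Centers
  -- are at least `k` apart, so both can be admissible only for `k < 2`, and the offset is still at
  -- most `1`.
  have hτ : |(τ : ℝ)| ≤ 1 := by
    rcases lt_trichotomy η (shift m) with h | h | h
    · have h' : (η : ℝ) + 1 ≤ shift m := by exact_mod_cast h
      have h6 : -1 < (τ : ℝ) := by push_cast at h5; nlinarith
      have h7 : (τ : ℝ) < 2 := by push_cast at h5; nlinarith
      have h6' : -1 < τ := by exact_mod_cast h6
      have h7' : τ < 2 := by exact_mod_cast h7
      rw [abs_le]
      constructor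
      · linarith
      · exact_mod_cast Int.lt_add_one_iff.1 h7'
    · have : τ = 0 := by simp only [τ, h, ht]
      simp [this]
    · have h' : (shift m : ℝ) + 1 ≤ η := by exact_mod_cast h
      have h6 : (τ : ℝ) < 1 := by push_cast at h5; nlinarith
      have h7 : -2 < (τ : ℝ) := by push_cast at h5; nlinarith
      have h7' : -2 < τ := by exact_mod_cast h7
      rw [abs_le]
      constructor
      · have : -1 ≤ τ := by omega
        exact_mod_cast this
      · linarith
  have hb : bracket τ ≤ 2 := (bracket_le _).trans (by linarith)
  calc bracket τ ^ (s - 1 / 2) ≤ bracket τ ^ (1 : ℝ) :=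
        Real.rpow_le_rpow_of_exponent_le (one_le_bracket _) (by linarith)
    _ ≤ 2 := by rwa [Real.rpow_one]

theorem IsResonant.mem_resonantModes {p : Fin 5 → ℤ} {n : ℤ} (h : IsResonant L κ p n) :
    n ∈ resonantModes L κ ∧ ∀ l, p l ∈ resonantModes L κ := by
  obtain ⟨-, m₁, m₂, m₃, m₄, -, j, hj, h1, h2, -⟩ := h
  have hα : ∀ m i, alpha κ m (j i) ∈ resonantModes L κ := fun m i =>
    ⟨m, j i, (hj i).1, (hj i).2, rfl⟩
  have k1 : ∀ x ∈ ({p 0, p 2, p 4} : Multiset ℤ), x ∈ resonantModes L κ := by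
    rw [h1]; intro x hx
    simp only [Multiset.insert_eq_cons, Multiset.mem_cons, Multiset.mem_singleton] at hx
    rcases hx with rfl | rfl | rfl <;> exact hα _ _
  have k2 : ∀ x ∈ ({p 1, p 3, n} : Multiset ℤ), x ∈ resonantModes L κ := by
    rw [h2]; intro x hx
    simp only [Multiset.insert_eq_cons, Multiset.mem_cons, Multiset.mem_singleton] at hx
    rcases hx with rfl | rfl | rfl <;> exact hα _ _
  simp only [Multiset.insert_eq_cons, Multiset.mem_cons, Multiset.mem_singleton] at k1 k2
  refine ⟨k2 _ (by simp), fun l => ?_⟩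
  fin_cases l
  · exact k1 _ (by simp)
  · exact k2 _ (by simp)
  · exact k1 _ (by simp)
  · exact k2 _ (by simp)
  · exact k1 _ (by simp)

theorem finite_res (L κ : ℕ) (n : ℤ) : (res L κ n).Finite :=
  (Set.Finite.pi' fun _ : Fin 5 => finite_resonantModes L κ).subset
    fun _ hp l => hp.2.mem_resonantModes.2 l

/-- The exchange of the frequencies with a bar and those without. -/
def swapSlots : ℤ × (Fin 5 → ℤ) ≃ ℤ × (Fin 5 → ℤ) where
  toFun x := (x.2 4, ![x.2 1, x.2 0, x.2 3, x.2 2, x.1])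
  invFun x := (x.2 4, ![x.2 1, x.2 0, x.2 3, x.2 2, x.1])
  left_inv x := by
    refine Prod.ext rfl (funext fun l => ?_)
    fin_cases l <;> rfl
  right_inv x := by
    refine Prod.ext rfl (funext fun l => ?_)
    fin_cases l <;> rfl

theorem IsResonant.swap {x : ℤ × (Fin 5 → ℤ)} (h : IsResonant L κ x.2 x.1) :
    IsResonant L κ (swapSlots x).2 (swapSlots x).1 := by
  obtain ⟨h0, m₁, m₂, m₃, m₄, hm, j, hj, h1, h2, h3, h4, h5, h6⟩ := h
  refine ⟨?_, m₂, m₁, m₄, m₃, ?_, ![j 1, j 0, j 3, j 2, j 5, j 4], ?_, h2, h1, h3.symm, h5, h4,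
    h6.symm⟩
  · change x.2 1 + x.2 3 + x.1 = x.2 0 + x.2 2 + x.2 4
    exact h0.symm
  · rcases hm with ⟨a, b, c, d⟩ | ⟨a, b, c, d⟩
    · exact Or.inr ⟨c, d, a, b⟩
    · exact Or.inl ⟨c, d, a, b⟩
  · intro i
    fin_cases i
    exacts [hj 1, hj 0, hj 3, hj 2, hj 5, hj 4]

theorem isResonant_swap_iff {x : ℤ × (Fin 5 → ℤ)} :
    IsResonant L κ (swapSlots x).2 (swapSlots x).1 ↔ IsResonant L κ x.2 x.1 :=
  ⟨fun h => by
    have := h.swap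
    rwa [show swapSlots (swapSlots x) = x from swapSlots.left_inv x] at this, IsResonant.swap⟩

theorem mem_res_iff {n : ℤ} {p : Fin 5 → ℤ} : p ∈ res L κ n ↔ IsResonant L κ p n := by
  refine ⟨fun h => h.2, fun h => ⟨?_, h⟩⟩
  have := h.1
  change p 0 - p 1 + p 2 - p 3 + p 4 = n
  linarith

/-- Gauge invariance: the resonance relation is symmetric under exchanging the barred and unbarred
frequencies, an exchange that conjugates each summand. So the sixfold sum is real, which is
conservation of mass. -/
theorem im_sum_quintic_mul_star (L κ : ℕ) (u : ℤ → ℂ) :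
    (∑ n ∈ (finite_resonantModes L κ).toFinset,
      (∑' p : res L κ n, quintic u p) * star (u n)).im = 0 := by
  classical
  let g : ℤ × (Fin 5 → ℤ) → ℂ := fun x =>
    if IsResonant L κ x.2 x.1 then quintic u x.2 * star (u x.1) else 0
  have hstar : star (∑' x, g x) = ∑' x, g x := by
    rw [tsum_star, ← swapSlots.tsum_eq g]
    refine tsum_congr fun x => ?_
    by_cases hx : IsResonant L κ x.2 x.1
    · simp only [g, hx, isResonant_swap_iff, if_true]
      change star (quintic u x.2 * star (u x.1))
        = quintic u ![x.2 1, x.2 0, x.2 3, x.2 2, x.1] * star (u (x.2 4))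
      simp only [quintic, star_mul', star_star]
      change _ = u (x.2 1) * star (u (x.2 0)) * u (x.2 3) * star (u (x.2 2)) * u x.1
        * star (u (x.2 4))
      ring
    · simp only [g, hx, isResonant_swap_iff, if_false, star_zero]
  have hfin : (Function.support g).Finite := by
    refine ((finite_resonantModes L κ).prod
      (Set.Finite.pi' fun _ : Fin 5 => finite_resonantModes L κ)).subset fun x hx => ?_
    have : IsResonant L κ x.2 x.1 := by
      by_contra h
      exact hx (if_neg h)
    exact this.mem_resonantModes
  have hs : Summable g := summable_of_hasFiniteSupport hfin
  have hsum : ∑' x, g x = ∑ n ∈ (finite_resonantModes L κ).toFinset,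
      (∑' p : res L κ n, quintic u p) * star (u n) := by
    rw [hs.tsum_prod, tsum_eq_sum (s := (finite_resonantModes L κ).toFinset)]
    · refine Finset.sum_congr rfl fun n _ => ?_
      rw [tsum_subtype (res L κ n) (quintic u), ← tsum_mul_right]
      refine tsum_congr fun p => ?_
      by_cases hp : IsResonant L κ p n
      · simp [g, hp, mem_res_iff.2 hp]
      · simp [g, hp, mem_res_iff]
    · intro n hn
      rw [← tsum_zero]
      refine tsum_congr fun p => if_neg fun h => hn ?_
      exact (finite_resonantModes L κ).mem_toFinset.2 h.mem_resonantModes.1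
  rw [hsum] at hstar
  exact Complex.conj_eq_iff_im.1 hstar

theorem hasDerivWithinAt_of_isResonantSolution (hr : IsResonantSolution L κ T r) {τ : ℝ}
    (hτ : τ ∈ Set.Icc (0 : ℝ) T) (n : ℤ) :
    HasDerivWithinAt (fun t => r t n)
      (-Complex.I * ((1 / (L : ℂ) ^ 4) * ∑' p : res L κ n, quintic (r τ) p)) (Set.Icc 0 T) τ := by
  by_cases hn : n ∈ resonantModes L κ
  · exact (hr τ hτ n).2 hn
  · have : IsEmpty (res L κ n) := ⟨fun p => hn p.2.2.mem_resonantModes.1⟩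
    rw [tsum_empty, mul_zero, mul_zero]
    exact (hasDerivWithinAt_const τ _ (0 : ℂ)).congr (fun t ht => (hr t ht n).1 hn)
      ((hr τ hτ n).1 hn)

theorem sum_norm_sq_eq_initial (hr : IsResonantSolution L κ T r) {t : ℝ}
    (ht : t ∈ Set.Icc (0 : ℝ) T) :
    ∑ n ∈ (finite_resonantModes L κ).toFinset, ‖r t n‖ ^ 2
      = ∑ n ∈ (finite_resonantModes L κ).toFinset, ‖r 0 n‖ ^ 2 := by
  have hd : ∀ τ ∈ Set.Icc (0 : ℝ) T, HasDerivWithinAt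
      (fun τ => ∑ n ∈ (finite_resonantModes L κ).toFinset, ‖r τ n‖ ^ 2) 0 (Set.Icc 0 T) τ := by
    intro τ hτ
    refine (HasDerivWithinAt.fun_sum fun n _ =>
      (hasDerivWithinAt_of_isResonantSolution hr hτ n).norm_sq).congr_deriv ?_
    have h := im_sum_quintic_mul_star L κ (r τ)
    have e : ∀ n, inner ℝ (r τ n)
        (-Complex.I * ((1 / (L : ℂ) ^ 4) * ∑' p : res L κ n, quintic (r τ) p))
        = 1 / (L : ℝ) ^ 4 * ((∑' p : res L κ n, quintic (r τ) p) * star (r τ n)).im := by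
      intro n
      have hL : (1 / (L : ℂ) ^ 4) = ((1 / (L : ℝ) ^ 4 : ℝ) : ℂ) := by push_cast; rfl
      rw [Complex.inner, hL]
      generalize 1 / (L : ℝ) ^ 4 = c
      generalize ∑' p : res L κ n, quintic (r τ) p = Z
      simp
      ring
    simp only [e]
    rw [← Finset.mul_sum, ← Finset.mul_sum, ← Complex.im_sum, h]
    simp
  exact constant_of_derivWithin_zero (fun τ hτ => (hd τ hτ).differentiableWithinAt)
    (fun τ hτ => (hd τ ⟨hτ.1, hτ.2.le⟩).derivWithin
      (uniqueDiffOn_Icc (hτ.1.trans_lt hτ.2) τ ⟨hτ.1, hτ.2.le⟩)) t ht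

theorem tsum_enorm_sq_eq_initial (hr : IsResonantSolution L κ T r) {t : ℝ}
    (ht : t ∈ Set.Icc (0 : ℝ) T) : ∑' n, ‖r t n‖ₑ ^ 2 = ∑' n, ‖r 0 n‖ₑ ^ 2 := by
  have key : ∀ τ ∈ Set.Icc (0 : ℝ) T, ∑' n, ‖r τ n‖ₑ ^ 2 = ENNReal.ofReal
      (∑ n ∈ (finite_resonantModes L κ).toFinset, ‖r τ n‖ ^ 2) := by
    intro τ hτ
    rw [ENNReal.ofReal_sum_of_nonneg fun _ _ => by positivity,
      tsum_eq_sum (s := (finite_resonantModes L κ).toFinset)]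
    · refine Finset.sum_congr rfl fun n _ => ?_
      rw [ENNReal.ofReal_pow (norm_nonneg _), ofReal_norm]
    · intro n hn
      rw [(hr τ hτ n).1 fun h => hn ((finite_resonantModes L κ).mem_toFinset.2 h)]
      simp
  rw [key t ht, key 0 ⟨le_rfl, ht.1.trans ht.2⟩, sum_norm_sq_eq_initial hr ht]

theorem tsum_emult_sq_le_of_support (hs : 1 < s) (hs' : s ≤ 3 / 2) (hL : 0 < L) (hκ : 0 < κ)
    {f g : ℤ → ℝ≥0∞} (h0 : ∀ n ∉ resonantModes L κ, f n = 0) (hfg : ∀ n, f n ≤ g n) :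
    ∑' n, (emult s L κ n * f n) ^ 2 ≤ 4 * ∑' n, g n ^ 2 := by
  rw [← ENNReal.tsum_mul_left]
  refine ENNReal.tsum_le_tsum fun n => ?_
  by_cases hn : n ∈ resonantModes L κ
  · have h2 : emult s L κ n ≤ 2 := by
      rw [emult, ← ENNReal.ofReal_ofNat 2]
      exact ENNReal.ofReal_le_ofReal (mult_le_two_of_mem_resonantModes hs hs' hL hκ hn)
    calc (emult s L κ n * f n) ^ 2 ≤ (2 * g n) ^ 2 := by gcongr; exact hfg n
      _ = _ := by ring
  · simp [h0 n hn]

theorem enorm_resonant_sub_le (hr : IsResonantSolution L κ T r) (hL : 0 < L) {t : ℝ}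
    (ht : t ∈ Set.Icc (0 : ℝ) T) (n : ℤ) :
    ‖r t n - r 0 n‖ₑ ≤ ∫⁻ τ in Set.Icc 0 t, absRhs L r τ n := by
  refine enorm_sub_le_lintegral_of_hasDerivWithinAt ht
    (fun τ hτ => hasDerivWithinAt_of_isResonantSolution hr hτ n) fun τ _ => ?_
  have := (finite_res L κ n).to_subtype
  rw [enorm_mul, enorm_mul, enorm_neg_I, enorm_inv_pow L hL, one_mul, absRhs]
  gcongr
  refine (enorm_tsum_le (summable_of_hasFiniteSupport (Set.toFinite _))).trans ?_
  simp only [enorm_quintic]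
  exact ENNReal.tsum_mono_subtype (absQuintic r τ) fun p (hp : p ∈ res L κ n) => hp.1

/-- No cancellation is needed: on the support of `r` the weight is at most `2`, and the resonant sum
is dominated by the sum over the whole hyperplane. -/
theorem tsum_sq_resonant_sub_initial_le (hs : 1 < s) (hs' : s ≤ 3 / 2) (hL : 0 < L) (hκ : 0 < κ)
    (hr : IsResonantSolution L κ T r) {t : ℝ} (ht : t ∈ Set.Icc (0 : ℝ) T)
    (h1 : ∀ τ ∈ Set.Icc 0 T, (∑' m, ‖r τ m‖ₑ) ^ 2 ≤ L ^ 2 * X)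
    (h2 : ∀ τ ∈ Set.Icc 0 T, ∑' m, ‖r τ m‖ₑ ^ 2 ≤ L * X) :
    ∑' n, (emult s L κ n * ‖r t n - r 0 n‖ₑ) ^ 2 ≤ 4 * (ENNReal.ofReal t ^ 2 * (L * X ^ 5)) := by
  refine (tsum_emult_sq_le_of_support hs hs' hL hκ (fun n hn => ?_)
    (enorm_resonant_sub_le hr hL ht)).trans ?_
  · rw [(hr t ht n).1 hn, (hr 0 ⟨le_rfl, ht.1.trans ht.2⟩ n).1 hn]
    simp
  · gcongr
    refine tsum_sq_lintegral_Icc_le (fun n => aemeasurable_absRhs (fun m τ hτ =>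
      (hasDerivWithinAt_of_isResonantSolution hr hτ m).continuousWithinAt) ht.2 n) fun τ hτ => ?_
    have hτ' : τ ∈ Set.Icc 0 T := ⟨hτ.1, hτ.2.trans ht.2⟩
    exact tsum_sq_absRhs_le hL (h1 τ hτ') (h2 τ hτ')

end QuinticNLS

namespace QuinticNLS

open scoped ENNReal

variable {L κ : ℕ} {s : ℝ}

/-! ### The main theorem -/

theorem normSq_eq (hs : 1 < s) (u : ℤ → ℂ) :
    normSq s L κ u = (∑' n, (emult s L κ n * ‖u n‖ₑ) ^ 2) / L := by
  rw [normSq]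
  congr 1
  refine tsum_congr fun n => ?_
  rw [ENNReal.ofReal_mul (by positivity), ENNReal.ofReal_pow (mult_pos hs).le,
    ENNReal.ofReal_pow (norm_nonneg _), ofReal_norm, emult, mul_pow]

theorem mass_eq (u : ℤ → ℂ) : mass L u = (∑' n, ‖u n‖ₑ ^ 2) / L := by
  rw [mass]
  congr 1
  refine tsum_congr fun n => ?_
  rw [ENNReal.ofReal_pow (norm_nonneg _), ofReal_norm]

theorem div_natCast_le_iff (hL : 0 < L) {x y : ℝ≥0∞} : x / L ≤ y ↔ x ≤ L * y := by
  have h0 : (L : ℝ≥0∞) ≠ 0 := by exact_mod_cast hL.ne'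
  rw [ENNReal.div_le_iff h0 (ENNReal.natCast_ne_top L), mul_comm]

theorem tsum_weighted_add_sq_le {u v w : ℤ → ℂ} (h : ∀ n, u n = v n + w n) :
    ∑' n, (emult s L κ n * ‖u n‖ₑ) ^ 2 ≤
      2 * (∑' n, (emult s L κ n * ‖v n‖ₑ) ^ 2 + ∑' n, (emult s L κ n * ‖w n‖ₑ) ^ 2) := by
  refine le_trans (ENNReal.tsum_le_tsum fun n => ?_) (tsum_add_sq_le _ _)
  rw [← mul_add, h n]
  gcongr
  exact enorm_add_le _ _

/-- The final comparison of the bound for the drift with the claimed bound. -/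
theorem drift_bound_le {E ν t b b' : ℝ} (hE : 0 ≤ E) (hν : 0 < ν) (hν' : ν ≤ 1) (ht : 0 ≤ t)
    (hb : 0 ≤ b) (hb' : 0 ≤ b') :
    E * (ν ^ 5 * t ^ 2 + ν ^ 5 * b) ≤ 2 * E * (ν ^ 3 * b * Real.exp (1 * ν ^ 2 * t)
      + ν ^ 3 * b' * (Real.exp (1 * ν ^ 2 * t) - 1)
      + ν * (Real.exp (1 * ν ^ 2 * t) - 1 - 1 * ν ^ 2 * t)) := by
  have hx : 0 ≤ 1 * ν ^ 2 * t := by positivity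
  have h1 := Real.quadratic_le_exp_of_nonneg hx
  have h2 : 1 ≤ Real.exp (1 * ν ^ 2 * t) := Real.one_le_exp hx
  have h3 : ν ^ 5 * b ≤ ν ^ 3 * b * Real.exp (1 * ν ^ 2 * t) := by
    calc ν ^ 5 * b ≤ ν ^ 3 * b * 1 := by
          rw [mul_one]
          exact mul_le_mul_of_nonneg_right
            (pow_le_pow_of_le_one hν.le hν' (by norm_num)) hb
      _ ≤ _ := mul_le_mul_of_nonneg_left h2 (by positivity)
  have h4 : 0 ≤ ν ^ 3 * b' * (Real.exp (1 * ν ^ 2 * t) - 1) :=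
    mul_nonneg (by positivity) (by linarith)
  -- From `x²/2 ≤ e^x - 1 - x` with `x = ν² t`; this is why `c = 1` works and why the constant
  -- doubles.
  have h5 : ν * ((1 * ν ^ 2 * t) ^ 2 / 2)
      ≤ ν * (Real.exp (1 * ν ^ 2 * t) - 1 - 1 * ν ^ 2 * t) :=
    mul_le_mul_of_nonneg_left (by linarith) hν.le
  have h6 : 0 ≤ ν ^ 5 * b := by positivity
  have h7 : ν * ((1 * ν ^ 2 * t) ^ 2 / 2) = ν ^ 5 * t ^ 2 / 2 := by ring
  rw [mul_comm 2 E, mul_assoc]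
  exact mul_le_mul_of_nonneg_left (by linarith) hE

theorem ofReal_drift {D A t ν b : ℝ} (hD : 0 ≤ D) (hA : 0 ≤ A) (hν : 0 < ν) (hν' : ν ≤ 1)
    (ht : 0 ≤ t) (hb : 0 ≤ b) :
    2 * (ENNReal.ofReal D * (200 * (ENNReal.ofReal t ^ 2 * ENNReal.ofReal (A * ν) ^ 5
        + ENNReal.ofReal t ^ 2 * ENNReal.ofReal (A * ν) ^ 9
        + ENNReal.ofReal (A * ν) ^ 5 * ENNReal.ofReal b))
      + 4 * (ENNReal.ofReal t ^ 2 * ENNReal.ofReal (A * ν) ^ 5))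
    ≤ ENNReal.ofReal ((400 * D * (A ^ 5 + A ^ 9) + 8 * A ^ 5)
        * (ν ^ 5 * t ^ 2 + ν ^ 5 * b)) := by
  have hAν : 0 ≤ A * ν := by positivity
  have e : 2 * (D * (200 * (t ^ 2 * (A * ν) ^ 5 + t ^ 2 * (A * ν) ^ 9 + (A * ν) ^ 5 * b))
      + 4 * (t ^ 2 * (A * ν) ^ 5))
      ≤ (400 * D * (A ^ 5 + A ^ 9) + 8 * A ^ 5) * (ν ^ 5 * t ^ 2 + ν ^ 5 * b) := by
    have h1 : ν ^ 9 ≤ ν ^ 5 := pow_le_pow_of_le_one hν.le hν' (by norm_num)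
    have h2 : 0 ≤ 400 * D * A ^ 9 * t ^ 2 * (ν ^ 5 - ν ^ 9) :=
      mul_nonneg (by positivity) (by linarith)
    have h3 : 0 ≤ (400 * D * A ^ 9 + 8 * A ^ 5) * (ν ^ 5 * b) := by positivity
    linarith [show (400 * D * (A ^ 5 + A ^ 9) + 8 * A ^ 5) * (ν ^ 5 * t ^ 2 + ν ^ 5 * b)
      - 2 * (D * (200 * (t ^ 2 * (A * ν) ^ 5 + t ^ 2 * (A * ν) ^ 9 + (A * ν) ^ 5 * b))
      + 4 * (t ^ 2 * (A * ν) ^ 5)) = 400 * D * A ^ 9 * t ^ 2 * (ν ^ 5 - ν ^ 9)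
        + (400 * D * A ^ 9 + 8 * A ^ 5) * (ν ^ 5 * b) by ring]
  refine le_trans (le_of_eq ?_) (ENNReal.ofReal_le_ofReal e)
  rw [ENNReal.ofReal_mul (p := 2) (by norm_num), ENNReal.ofReal_add (by positivity) (by positivity),
    ENNReal.ofReal_mul hD, ENNReal.ofReal_mul (p := 200) (by norm_num),
    ENNReal.ofReal_add (by positivity) (by positivity),
    ENNReal.ofReal_add (by positivity) (by positivity),
    ENNReal.ofReal_mul (p := t ^ 2) (by positivity), ENNReal.ofReal_mul (p := t ^ 2) (by positivity),
    ENNReal.ofReal_mul (p := (A * ν) ^ 5) (by positivity), ENNReal.ofReal_mul (p := 4) (by norm_num),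
    ENNReal.ofReal_mul (p := t ^ 2) (by positivity), ENNReal.ofReal_pow hAν,
    ENNReal.ofReal_pow hAν, ENNReal.ofReal_pow ht, ENNReal.ofReal_ofNat, ENNReal.ofReal_ofNat,
    ENNReal.ofReal_ofNat]

end QuinticNLS

theorem mainTheorem2 (s : ℝ) (hs₁ : 1 < s) (hs₂ : s ≤ 3 / 2)
    (C₀ C₁ : ℝ) (hC₀ : 0 < C₀) (hC₁ : 0 < C₁) :
    ∃ C : ℝ, 0 < C ∧ ∃ c : ℝ, 0 < c ∧
      ∀ (L κ : ℕ) (ν T : ℝ) (a r : ℝ → ℤ → ℂ),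
        0 < L → 0 < κ → 0 < ν → ν ≤ 1 → 0 < T →
        QuinticNLS.IsFullSolution L T a →
        QuinticNLS.IsResonantSolution L κ T r →
        a 0 = r 0 →
        QuinticNLS.mass L (r 0) ≤ ENNReal.ofReal (C₁ * ν) →
        (⨆ t ∈ Set.Icc (0 : ℝ) T, QuinticNLS.normSq s L κ (a t - r t))
          ≤ ENNReal.ofReal (C₀ * ν) →
        ∀ t ∈ Set.Icc (0 : ℝ) T,
          QuinticNLS.normSq s L κ (a t - r t) ≤ ENNReal.ofReal
            (C * (ν ^ 3 * QuinticNLS.bracket (QuinticNLS.waveNumber L κ) ^ (s - 5 / 2)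
                  * Real.exp (c * ν ^ 2 * t)
                + ν ^ 3 * QuinticNLS.bracket (QuinticNLS.waveNumber L κ) ^ (s - 3 / 2)
                  * (Real.exp (c * ν ^ 2 * t) - 1)
                + ν * (Real.exp (c * ν ^ 2 * t) - 1 - c * ν ^ 2 * t))) := by
  open QuinticNLS in
  obtain ⟨K, hT⟩ := exists_trichotomy_constant hs₁ hs₂
  obtain ⟨Z, hZ, hZ'⟩ := exists_tsum_inv_mult_sq_le hs₁ hs₂
  have hK := hT.1
  -- From `‖a‖_s² ≤ 2 (‖e‖_s² + ‖r‖_s²)` and `‖r‖_s² ≤ 4 C₁ ν`, the `4` being the square of the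
  -- bound for `m` on `𝓡`.
  set M : ℝ := 2 * (C₀ + 4 * C₁) with hM
  have hM0 : 0 < M := by positivity
  -- One constant for both the `ℓ¹` bound, which costs `Z`, and the weighted `ℓ²` bound, which needs
  -- a factor at least `1`.
  set A : ℝ := max Z 1 * M with hA
  have hA0 : 0 < A := by positivity
  have hMA : M ≤ A := le_mul_of_one_le_left hM0.le (le_max_right _ _)
  set E : ℝ := 400 * (100000 * K ^ 7) * (A ^ 5 + A ^ 9) + 8 * A ^ 5 with hE
  have hE0 : 0 < E := by positivity
  refine ⟨2 * E, by positivity, 1, one_pos, ?_⟩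
  intro L κ ν T a r hL hκ hν hν' _ ha hr h0 hmass hsup t ht
  have hmass' : ∑' n, ‖r 0 n‖ₑ ^ 2 ≤ L * ENNReal.ofReal (C₁ * ν) := by
    rwa [mass_eq, div_natCast_le_iff hL] at hmass
  have hr1 : ∀ τ ∈ Set.Icc 0 T, ∑' n, ‖r τ n‖ₑ ^ 2 ≤ L * ENNReal.ofReal (C₁ * ν) := fun τ hτ =>
    (tsum_enorm_sq_eq_initial hr hτ).le.trans hmass'
  have hr2 : ∀ τ ∈ Set.Icc 0 T, ∑' n, (emult s L κ n * ‖r τ n‖ₑ) ^ 2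
      ≤ L * ENNReal.ofReal (4 * C₁ * ν) := fun τ hτ => by
    refine (tsum_emult_sq_le_of_support hs₁ hs₂ hL hκ (fun n hn => ?_) fun n => le_rfl).trans
      ((mul_le_mul_right (hr1 τ hτ) 4).trans (le_of_eq ?_))
    · rw [(hr τ hτ n).1 hn, enorm_zero]
    · rw [mul_assoc 4 C₁, ENNReal.ofReal_mul (p := 4) (by norm_num), ENNReal.ofReal_ofNat]
      ring
  have he : ∀ τ ∈ Set.Icc 0 T, ∑' n, (emult s L κ n * ‖(a τ - r τ) n‖ₑ) ^ 2
      ≤ L * ENNReal.ofReal (C₀ * ν) := fun τ hτ => by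
    rw [← div_natCast_le_iff hL, ← normSq_eq hs₁]
    exact (le_iSup₂ (f := fun t (_ : t ∈ Set.Icc (0 : ℝ) T) => normSq s L κ (a t - r t))
      τ hτ).trans hsup
  have ha2 : ∀ τ ∈ Set.Icc 0 T, ∑' n, (emult s L κ n * ‖a τ n‖ₑ) ^ 2
      ≤ L * ENNReal.ofReal (M * ν) := fun τ hτ => by
    refine (tsum_weighted_add_sq_le (v := a τ - r τ) (w := r τ) fun n => by simp).trans
      ((mul_le_mul_right (add_le_add (he τ hτ) (hr2 τ hτ)) 2).trans (le_of_eq ?_))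
    rw [← mul_add, ← ENNReal.ofReal_add (by positivity) (by positivity), hM, mul_assoc 2,
      ENNReal.ofReal_mul (p := 2) (by norm_num), ENNReal.ofReal_ofNat, add_mul]
    ring
  have hr3 : ∀ τ ∈ Set.Icc 0 T, ∑' n, (emult s L κ n * ‖r τ n‖ₑ) ^ 2
      ≤ L * ENNReal.ofReal (M * ν) := fun τ hτ => by
    refine (hr2 τ hτ).trans (mul_le_mul_right (ENNReal.ofReal_le_ofReal ?_) _)
    exact mul_le_mul_of_nonneg_right (by linarith) hν.le
  have hMX : ENNReal.ofReal (M * ν) ≤ ENNReal.ofReal (A * ν) :=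
    ENNReal.ofReal_le_ofReal (mul_le_mul_of_nonneg_right hMA hν.le)
  have hell : ∀ f : ℤ → ENNReal, ∑' n, (emult s L κ n * f n) ^ 2 ≤ L * ENNReal.ofReal (M * ν) →
      (∑' n, f n) ^ 2 ≤ L ^ 2 * ENNReal.ofReal (A * ν) := fun f hf => by
    have h := sq_tsum_le_of_weighted hs₁ (Z := max Z 1) ((hZ' L κ hL).trans
      (mul_le_mul_right (ENNReal.ofReal_le_ofReal (le_max_left _ _)) _)) hf
    rwa [← ENNReal.ofReal_mul (by positivity), ← mul_assoc] at h
  have hda := tsum_sq_sub_initial_le hT hs₁ hs₂ hL hκ ha ht ENNReal.ofReal_ne_top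
    (fun τ hτ => hell _ (ha2 τ hτ)) (fun τ hτ => (ha2 τ hτ).trans (mul_le_mul_right hMX _))
  have hdr := tsum_sq_resonant_sub_initial_le hs₁ hs₂ hL hκ hr ht
    (fun τ hτ => hell _ (hr3 τ hτ))
    (fun τ hτ => tsum_sq_le_of_weighted hs₁ ((hr3 τ hτ).trans (mul_le_mul_right hMX _)))
  -- The common initial value allows the error to be written as a difference of two drifts, which
  -- are estimated separately.
  have hsplit := tsum_weighted_add_sq_le (s := s) (L := L) (κ := κ) (u := a t - r t)
    (v := fun n => a t n - a 0 n) (w := fun n => -(r t n - r 0 n)) fun n => by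
      rw [h0, Pi.sub_apply]; ring
  simp only [enorm_neg] at hsplit
  rw [normSq_eq hs₁, div_natCast_le_iff hL]
  refine hsplit.trans ((mul_le_mul_right (add_le_add hda hdr) 2).trans ?_)
  have hb : ∀ e : ℝ, 0 ≤ bracket (waveNumber L κ) ^ e := fun e =>
    Real.rpow_nonneg (bracket_pos _).le _
  have hfin := (ofReal_drift (D := 100000 * K ^ 7) (by positivity) hA0.le hν hν' ht.1
    (hb (s - 5 / 2))).trans (ENNReal.ofReal_le_ofReal
      (drift_bound_le hE0.le hν hν' ht.1 (hb (s - 5 / 2)) (hb (s - 3 / 2))))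
  refine le_trans (le_of_eq ?_) (mul_le_mul_right hfin _)
  ring
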